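/- Consider one of the following two kinds of networks $\mathcal G$. (E) Edge-network: a finite directed graph whose edges $\Omega_i$, $1\le i\le N$, are bounded open intervals, each joining two distinct vertices (an in-vertex, with $n_i=-1$, and an out-vertex, with $n_i=+1$). $\Gamma$ is the set of vertices belonging to at least three edges, $I_\gamma=\{i:\gamma\in\overline{\Omega_i}\}$, and $\partial\mathcal G=\bigcup_i\partial\Omega_i\setminus\Gamma$. (P) Plane-network: finitely many planar polygonal domains $\Omega_i$, $1\le i\le N$, each isometrically embedded in $\mathbb R^3$, with a finite set $\Gamma$ of nondegenerate segments, each contained in at least three of the closed surfaces and lying in the boundary of every surface whose closure contains it; $I_\gamma=\{i:\gamma\subset\overline{\Omega_i}\}$, $\partial\mathcal G=\bigcup_i\partial\Omega_i\setminus\bigcup_{\gamma\in\Gamma}\gamma$, and $\boldsymbol n_i$ is the outward unit normal of $\Omega_i$ in its plane. Put $D_\gamma=\{(i,j):i<j,\ i,j\in I_\gamma\}$. Let $\kappa_i\in L^\infty(\Omega_i)$ with $\kappa_i\ge\kappa_{\min}>0$ a.e., and $\boldsymbol\sigma_i(v)=\kappa_i\nabla v_i$. Let $\mathcal T_{h,i}$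 be meshes of the $\Omega_i$: in case (E) partitions into intervals such that any two intervals sharing an interior mesh point or a bifurcation have lengths of ratio at most $\sigma$; in case (P) conforming triangulations, each triangle $K$ containing a ball of diameter at least $\operatorname{diam}(K)/\sigma$, that match at the bifurcations: each $\gamma\in\Gamma$ is a union of mesh edges of $\mathcal T_{h,i}$ for every $i\in I_\gamma$, and these edges are the same for all $i\in I_\gamma$; they form the set $\mathcal F_h^\gamma$. Assume that $\kappa_i$ has one-sided limits from inside each element at (almost) every point of the faces of that element; these are its traces. Let $\mathcal F_{h,i}^{\rm int}$ be the interior mesh faces (points in case (E), edges in case (P)) of $\mathcal T_{h,i}$ and $\mathcal F_{h,i}^{\partial\mathcal G}$ those contained in the boundary of $\Omega_i$ and belonging to $\partial\mathcal G$ (in case (P): the mesh edges in $\partial\Omega_i$ not contained in a segment of $\Gamma$). In case (P), $h_F$ is the length of $F$; in case (E), $h_F$ is the largest length of the mesh intervals of $\mathcal T_{h,i}$ containing $F$, and $h_\gamma$ is the largest length of the mesh intervals that have $\gamma$ as an end point. $V_h^p$ is the space of functions whose restriction to each element is a polynomial of degree at most $p$. On an interior face shared by $K_1,K_2$, with unit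 normal $\boldsymbol n_F$ pointing from $K_1$ to $K_2$, put $[v]=v|_{K_1}-v|_{K_2}$ and $\{v\}=\frac12(v|_{K_1}+v|_{K_2})$; on a face in $\partial\mathcal G$, $\boldsymbol n_F=\boldsymbol n_i$. At $\gamma\in\Gamma$ put $[v]_{(i,j)}=v_i-v_j$, $\{\boldsymbol w\}_{(i,j)}=\boldsymbol w_i\cdot\boldsymbol n_i-\boldsymbol w_j\cdot\boldsymbol n_j$, $$\{\boldsymbol\sigma(w)\}\odot[v]=\frac1{\operatorname{card}I_\gamma}\sum_{(i,j)\in D_\gamma}\{\boldsymbol\sigma(w)\}_{(i,j)}[v]_{(i,j)},\qquad [w]\odot[v]=\sum_{(i,j)\in D_\gamma}[w]_{(i,j)}[v]_{(i,j)}.$$ With $\epsilon_i,\epsilon\in\{-1,0,1\}$ and positive penalty parameters $\eta_{F,i},\eta_\gamma$, define $$\begin{aligned}a_i(w,v)=&\sum_{K\in\mathcal T_{h,i}}\int_K\kappa_i\nabla w_i\cdot\nabla v_i-\sum_{F\in\mathcal F_{h,i}^{\rm int}}\int_F\{\kappa_i\nabla w_i\cdot\boldsymbol n_F\}[v_i]-\epsilon_i\sum_{F\in\mathcal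 F_{h,i}^{\rm int}}\int_F\{\kappa_i\nabla v_i\cdot\boldsymbol n_F\}[w_i]+\sum_{F\in\mathcal F_{h,i}^{\rm int}}\frac{\eta_{F,i}}{h_F}\int_F[w_i][v_i]\\&-\sum_{F\in\mathcal F_{h,i}^{\partial\mathcal G}}\int_F\kappa_i\nabla w_i\cdot\boldsymbol n_F\,v_i-\epsilon_i\sum_{F\in\mathcal F_{h,i}^{\partial\mathcal G}}\int_F\kappa_i\nabla v_i\cdot\boldsymbol n_F\,w_i+\sum_{F\in\mathcal F_{h,i}^{\partial\mathcal G}}\frac{\eta_{F,i}}{h_F}\int_Fw_iv_i,\end{aligned}$$ $$\begin{aligned}a(w,v)=&\sum_ia_i(w,v)-\sum_{\gamma\in\Gamma}\sum_{F\in\mathcal F_h^\gamma}\int_F\{\boldsymbol\sigma(w)\}\odot[v]-\epsilon\sum_{\gamma\in\Gamma}\sum_{F\in\mathcal F_h^\gamma}\int_F\{\boldsymbol\sigma(v)\}\odot[w]+\sum_{\gamma\in\Gamma}\eta_\gamma\sum_{F\in\mathcal F_h^\gamma}\frac1{h_F}\int_F[w]\odot[v],\end{aligned}$$ $$\|v\|_{\rm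 DG}^2=\sum_i\Big(\sum_{K\in\mathcal T_{h,i}}\|\nabla v_i\|_{L^2(K)}^2+\sum_{F\in\mathcal F_{h,i}^{\rm int}}\frac{\eta_{F,i}}{h_F}\|[v_i]\|_{L^2(F)}^2+\sum_{F\in\mathcal F_{h,i}^{\partial\mathcal G}}\frac{\eta_{F,i}}{h_F}\|v_i\|_{L^2(F)}^2\Big)+\sum_{\gamma\in\Gamma}\eta_\gamma\sum_{F\in\mathcal F_h^\gamma}\frac1{h_F}\sum_{(i,j)\in D_\gamma}\|[v]_{(i,j)}\|_{L^2(F)}^2,$$ where in case (E) $\nabla$ is the derivative, integrals over a face $F$ are values at the point $F$, $\mathcal F_h^\gamma=\{\gamma\}$, and the weight $1/h_F$ at $\gamma$ is $1/h_\gamma$. Then for every network, every coefficient $\kappa$, every $p\ge0$ and every $\sigma$ there are $\eta_0>0$ and $C>0$ such that the following holds for all meshes as above with regularity constant $\sigma$, all choices of $\epsilon_i,\epsilon\in\{-1,0,1\}$, and all penalty parameters with $\eta_{F,i}>0$ if $\epsilon_i=-1$ (NIPG), $\eta_{F,i}\ge\eta_0$ if $\epsilon_i\in\{0,1\}$, and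 $\eta_\gamma\ge\eta_0$: 1. (Coercivity) $\|v_h\|_{\rm DG}^2\le C\,a(v_h,v_h)$ for all $v_h\in V_h^p$. 2. (Well-posedness) If moreover every $\Omega_i$ can be joined, through a chain of domains in which consecutive ones share a bifurcation of $\Gamma$, to some $\Omega_j$ whose boundary meets $\partial\mathcal G$ (for instance, if the network is connected through its bifurcations and $\partial\mathcal G\ne\emptyset$), then for all $f_i\in L^2(\Omega_i)$ there is a unique $u_h\in V_h^p$ with $a(u_h,v_h)=\sum_i\int_{\Omega_i}f_iv_h$ for all $v_h\in V_h^p$. -/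

import Mathlib

open Set Filter Topology MeasureTheory

noncomputable section

/-! ## Edge-networks -/

namespace EdgeDG

/-- A directed graph with finitely many edges and vertices.  Each edge `i` carries its own
coordinate system, in which it is the interval `(left i, right i)`; `vin i` and `vout i` are the
vertices of the graph located at the left and the right end of the interval. -/
structure Network where
  N : ℕ
  numVert : ℕ
  left : Fin N → ℝ
  right : Fin N → ℝ
  left_lt_right : ∀ i, left i < right i
  vin : Fin N → Fin numVert
  vout : Fin N → Fin numVert
  vin_ne_vout : ∀ i, vin i ≠ vout i

namespace Network

variable (G : Network)

/-- `I_γ`: the edges that have `γ` as a vertex. -/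
def I (γ : Fin G.numVert) : Finset (Fin G.N) :=
  Finset.univ.filter fun i => G.vin i = γ ∨ G.vout i = γ

/-- `D_γ`: the ordered pairs `i < j` in `I_γ`. -/
def D (γ : Fin G.numVert) : Finset (Fin G.N × Fin G.N) :=
  (G.I γ ×ˢ G.I γ).filter fun ij => ij.1 < ij.2

/-- The bifurcation nodes: the vertices that belong to at least three edges. -/
def bifs : Finset (Fin G.numVert) :=
  Finset.univ.filter fun γ => 3 ≤ (G.I γ).card

/-- The two ends of edge `i` are labelled by a Boolean: `false` is the in-vertex (left end),
`true` is the out-vertex (right end). -/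
def vert (i : Fin G.N) (b : Bool) : Fin G.numVert := cond b (G.vout i) (G.vin i)

/-- The coordinate of an end of edge `i`. -/
def endPt (i : Fin G.N) (b : Bool) : ℝ := cond b (G.right i) (G.left i)

/-- The normal `n_i`: `-1` at the in-vertex and `+1` at the out-vertex. -/
def nrm (b : Bool) : ℝ := cond b 1 (-1)

/-- The end of edge `i` at which the vertex `γ` lies (for `i ∈ I_γ`). -/
def endAt (i : Fin G.N) (γ : Fin G.numVert) : Bool := decide (G.vout i = γ)

/-- The ends of the edge `i` that belong to `∂G`. -/
def bdryFaces (i : Fin G.N) : Finset Bool :=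
  Finset.univ.filter fun b => G.vert i b ∉ G.bifs

/-- Two edges are linked if they share a bifurcation node. -/
def Linked (i j : Fin G.N) : Prop := ∃ γ ∈ G.bifs, i ∈ G.I γ ∧ j ∈ G.I γ

/-- Every edge is joined, through a chain of edges sharing bifurcation nodes, to an edge with an
end in `∂G`, the set of end points of edges that are not bifurcations. -/
def ReachesBoundary : Prop :=
  ∀ i, ∃ j, Relation.ReflTransGen G.Linked i j ∧ ∃ b, G.vert j b ∉ G.bifs

/-- The diffusion coefficient: `κ i` is a representative of an element of `L^∞` of the edge `i`,
bounded below by a positive constant. -/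
def IsCoefficient (κ : Fin G.N → ℝ → ℝ) : Prop :=
  (∀ i, Measurable (κ i)) ∧
  (∃ c > 0, ∀ i, ∀ᵐ x ∂(volume.restrict (Ioo (G.left i) (G.right i))), c ≤ κ i x) ∧
  (∃ c, ∀ i, ∀ᵐ x ∂(volume.restrict (Ioo (G.left i) (G.right i))), κ i x ≤ c)

end Network

/-- A mesh: the edge `i` is cut at `left i = pt i 0 < pt i 1 < ⋯ < pt i (n i) = right i`. -/
structure Mesh (G : Network) where
  n : Fin G.N → ℕ
  n_pos : ∀ i, 0 < n i
  pt : ∀ i, Fin (n i + 1) → ℝ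
  strictMono : ∀ i, StrictMono (pt i)
  pt_zero : ∀ i, pt i 0 = G.left i
  pt_last : ∀ i, pt i (Fin.last (n i)) = G.right i

namespace Mesh

variable {G : Network} (M : Mesh G)

/-- Left end point of the mesh interval `K`. -/
def lo (i : Fin G.N) (K : Fin (M.n i)) : ℝ := M.pt i K.castSucc

/-- Right end point of the mesh interval `K`. -/
def hi (i : Fin G.N) (K : Fin (M.n i)) : ℝ := M.pt i K.succ

/-- Length of the mesh interval `K`. -/
def len (i : Fin G.N) (K : Fin (M.n i)) : ℝ := M.hi i K - M.lo i K

/-- The mesh interval at an end of the edge `i`. -/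
def endElem (i : Fin G.N) (b : Bool) : Fin (M.n i) :=
  cond b ⟨M.n i - 1, Nat.sub_lt (M.n_pos i) Nat.one_pos⟩ ⟨0, M.n_pos i⟩

/-- The interior mesh points of the edge `i`, given by the pair of successive intervals `(K, K')`
sharing the point; the point is `hi i K = lo i K'`. -/
def intFaces (i : Fin G.N) : Finset (Fin (M.n i) × Fin (M.n i)) :=
  Finset.univ.filter fun KK => KK.1.val + 1 = KK.2.val

/-- `h_F` at an interior mesh point: the larger length of the two neighbouring intervals. -/
def hInt (i : Fin G.N) (F : Fin (M.n i) × Fin (M.n i)) : ℝ := max (M.len i F.1) (M.len i F.2)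

/-- `h_F` at an end of the edge `i`. -/
def hBdry (i : Fin G.N) (b : Bool) : ℝ := M.len i (M.endElem i b)

/-- `h_γ`: the largest length of the mesh intervals that have `γ` as an end point. -/
def hBif (γ : Fin G.numVert) : ℝ := ⨆ i : {i // i ∈ G.I γ}, M.hBdry i.1 (G.endAt i.1 γ)

/-- Mesh regularity: any two mesh intervals that share a mesh point (an interior mesh point or a
bifurcation node) have lengths of ratio at most `σ`. -/
def ShapeRegular (σ : ℝ) : Prop :=
  (∀ i, ∀ F ∈ M.intFaces i,
    M.len i F.1 ≤ σ * M.len i F.2 ∧ M.len i F.2 ≤ σ * M.len i F.1) ∧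
  (∀ γ ∈ G.bifs, ∀ i ∈ G.I γ, ∀ j ∈ G.I γ,
    M.hBdry i (G.endAt i γ) ≤ σ * M.hBdry j (G.endAt j γ))

/-- The coefficient has one-sided limits at the mesh points. -/
def HasTraces (κ : Fin G.N → ℝ → ℝ) : Prop :=
  ∀ i K, ∀ x ∈ ({M.lo i K, M.hi i K} : Set ℝ),
    ∃ l, Tendsto (κ i) (𝓝[Ioo (M.lo i K) (M.hi i K)] x) (𝓝 l)

/-- The value at `x` of the coefficient, seen from inside the mesh interval `K`. -/
def kTrace (κ : Fin G.N → ℝ → ℝ) (i : Fin G.N) (K : Fin (M.n i)) (x : ℝ) : ℝ :=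
  limUnder (𝓝[Ioo (M.lo i K) (M.hi i K)] x) (κ i)

/-- The DG space `V_h^p`: a polynomial of degree at most `p` on every mesh interval. -/
abbrev V (p : ℕ) : Type :=
  (i : Fin G.N) → (K : Fin (M.n i)) → Polynomial.degreeLE ℝ (p : WithBot ℕ)

variable {M} {p : ℕ}

/-- `v|_K` at `x`. -/
def val (v : M.V p) (i : Fin G.N) (K : Fin (M.n i)) (x : ℝ) : ℝ :=
  (v i K : Polynomial ℝ).eval x

/-- `∂v|_K / ∂s` at `x`. -/
def dval (v : M.V p) (i : Fin G.N) (K : Fin (M.n i)) (x : ℝ) : ℝ :=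
  (v i K : Polynomial ℝ).derivative.eval x

/-- The trace of `κ_i ∂v/∂s` at `x` from inside the mesh interval `K`. -/
def flux (κ : Fin G.N → ℝ → ℝ) (v : M.V p) (i : Fin G.N) (K : Fin (M.n i)) (x : ℝ) : ℝ :=
  M.kTrace κ i K x * dval v i K x

/-- Jump at an interior mesh point. -/
def jumpInt (v : M.V p) (i : Fin G.N) (F : Fin (M.n i) × Fin (M.n i)) : ℝ :=
  val v i F.1 (M.hi i F.1) - val v i F.2 (M.hi i F.1)

/-- Average of `κ_i ∂v/∂s` at an interior mesh point. -/
def avgInt (κ : Fin G.N → ℝ → ℝ) (v : M.V p) (i : Fin G.N)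
    (F : Fin (M.n i) × Fin (M.n i)) : ℝ :=
  (1 / 2) * flux κ v i F.1 (M.hi i F.1) + (1 / 2) * flux κ v i F.2 (M.hi i F.1)

/-- `v_i` at an end of the edge `i`. -/
def valEnd (v : M.V p) (i : Fin G.N) (b : Bool) : ℝ := val v i (M.endElem i b) (G.endPt i b)

/-- `κ_i ∂v_i/∂s n_i` at an end of the edge `i`. -/
def fluxEnd (κ : Fin G.N → ℝ → ℝ) (v : M.V p) (i : Fin G.N) (b : Bool) : ℝ :=
  flux κ v i (M.endElem i b) (G.endPt i b) * Network.nrm b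

/-- Generalized jump `[v]_(i,j)` at the bifurcation `γ`. -/
def jumpBif (v : M.V p) (γ : Fin G.numVert) (ij : Fin G.N × Fin G.N) : ℝ :=
  valEnd v ij.1 (G.endAt ij.1 γ) - valEnd v ij.2 (G.endAt ij.2 γ)

/-- Generalized average `{σ(v)}_(i,j)` at the bifurcation `γ`. -/
def avgBif (κ : Fin G.N → ℝ → ℝ) (v : M.V p) (γ : Fin G.numVert) (ij : Fin G.N × Fin G.N) : ℝ :=
  fluxEnd κ v ij.1 (G.endAt ij.1 γ) - fluxEnd κ v ij.2 (G.endAt ij.2 γ)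

/-- `{σ(w)} ⊙ [v]` at the bifurcation `γ`. -/
def avgJump (κ : Fin G.N → ℝ → ℝ) (w v : M.V p) (γ : Fin G.numVert) : ℝ :=
  (1 / ((G.I γ).card : ℝ)) * ∑ ij ∈ G.D γ, avgBif κ w γ ij * jumpBif v γ ij

/-- `[w] ⊙ [v]` at the bifurcation `γ`. -/
def jumpJump (w v : M.V p) (γ : Fin G.numVert) : ℝ :=
  ∑ ij ∈ G.D γ, jumpBif w γ ij * jumpBif v γ ij

/-- The interior penalty form `a_i` on the edge `i`; `ηF i F` is the penalty parameter at the
mesh point of coordinate `F`. -/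
def aEdge (κ : Fin G.N → ℝ → ℝ) (ε : Fin G.N → ℝ) (ηF : Fin G.N → ℝ → ℝ) (i : Fin G.N)
    (w v : M.V p) : ℝ :=
  (∑ K, ∫ x in (M.lo i K)..(M.hi i K), κ i x * dval w i K x * dval v i K x)
  - (∑ F ∈ M.intFaces i, avgInt κ w i F * jumpInt v i F)
  - ε i * (∑ F ∈ M.intFaces i, avgInt κ v i F * jumpInt w i F)
  + (∑ F ∈ M.intFaces i, ηF i (M.hi i F.1) / M.hInt i F * (jumpInt w i F * jumpInt v i F))
  + (∑ b ∈ G.bdryFaces i, ηF i (G.endPt i b) / M.hBdry i b * (valEnd w i b * valEnd v i b))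
  - (∑ b ∈ G.bdryFaces i, fluxEnd κ w i b * valEnd v i b)
  - ε i * (∑ b ∈ G.bdryFaces i, fluxEnd κ v i b * valEnd w i b)

/-- The DG bilinear form of the edge-network. -/
def a (κ : Fin G.N → ℝ → ℝ) (ε : Fin G.N → ℝ) (ε₀ : ℝ) (ηF : Fin G.N → ℝ → ℝ)
    (ηΓ : Fin G.numVert → ℝ) (w v : M.V p) : ℝ :=
  (∑ i, aEdge κ ε ηF i w v)
  - (∑ γ ∈ G.bifs, avgJump κ w v γ)
  - ε₀ * (∑ γ ∈ G.bifs, avgJump κ v w γ)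
  + (∑ γ ∈ G.bifs, ηΓ γ / M.hBif γ * jumpJump w v γ)

/-- The square of the DG semi-norm on the edge `i`. -/
def dgSqEdge (ηF : Fin G.N → ℝ → ℝ) (i : Fin G.N) (v : M.V p) : ℝ :=
  (∑ K, ∫ x in (M.lo i K)..(M.hi i K), dval v i K x ^ 2)
  + (∑ F ∈ M.intFaces i, ηF i (M.hi i F.1) / M.hInt i F * jumpInt v i F ^ 2)
  + (∑ b ∈ G.bdryFaces i, ηF i (G.endPt i b) / M.hBdry i b * valEnd v i b ^ 2)

/-- The DG norm. -/
def dgNorm (ηF : Fin G.N → ℝ → ℝ) (ηΓ : Fin G.numVert → ℝ) (v : M.V p) : ℝ :=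
  Real.sqrt ((∑ i, dgSqEdge ηF i v)
    + ∑ γ ∈ G.bifs, ηΓ γ / M.hBif γ * ∑ ij ∈ G.D γ, jumpBif v γ ij ^ 2)

/-- The right-hand side `∑ i, ∫_{Ω_i} f_i v`. -/
def load (f : Fin G.N → ℝ → ℝ) (v : M.V p) : ℝ :=
  ∑ i, ∑ K, ∫ x in (M.lo i K)..(M.hi i K), f i x * val v i K x

end Mesh

end EdgeDG

/-! ## Plane-networks -/

namespace PlaneDG

/-- The plane, in which every surface has its own coordinate system. -/
abbrev E2 : Type := EuclideanSpace ℝ (Fin 2)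

/-- The ambient space. -/
abbrev E3 : Type := EuclideanSpace ℝ (Fin 3)

/-- The closed segment with the given unordered pair of end points. -/
def seg {E : Type} [AddCommGroup E] [Module ℝ E] (s : Sym2 E) : Set E :=
  convexHull ℝ {x | x ∈ s}

/-! ### Triangles -/

/-- A nondegenerate triangle, given by its three vertices. -/
abbrev Tri : Type := Affine.Triangle ℝ E2

namespace Tri

/-- The closed triangle. -/
def carrier (T : Tri) : Set E2 := convexHull ℝ (range T.points)

/-- The first end point of the edge opposite to vertex `e`. -/
def fst (T : Tri) (e : Fin 3) : E2 := T.points (e + 1)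

/-- The second end point of the edge opposite to vertex `e`. -/
def snd (T : Tri) (e : Fin 3) : E2 := T.points (e + 2)

/-- The edge opposite to vertex `e`, as an unordered pair of end points. -/
def edge (T : Tri) (e : Fin 3) : Sym2 E2 := s(T.fst e, T.snd e)

/-- The length of the edge opposite to vertex `e`. -/
def len (T : Tri) (e : Fin 3) : ℝ := dist (T.fst e) (T.snd e)

/-- The vector from the line through the edge to which vertex `e` is opposite, orthogonal to that
line and pointing away from vertex `e`. -/
def outward (T : Tri) (e : Fin 3) : E2 :=
  (T.fst e - T.points e)
    - (inner ℝ (T.snd e - T.fst e) (T.fst e - T.points e) / ‖T.snd e - T.fst e‖ ^ 2)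
      • (T.snd e - T.fst e)

/-- The outward unit normal on the edge opposite to vertex `e`. -/
def normal (T : Tri) (e : Fin 3) : E2 := ‖T.outward e‖⁻¹ • T.outward e

/-- Affine parametrization of the edge opposite to vertex `e` by `[0, 1]`. -/
def edgePt (T : Tri) (e : Fin 3) (t : ℝ) : E2 := AffineMap.lineMap (T.fst e) (T.snd e) t

/-- The integral of `g` over the edge opposite to vertex `e`, with respect to arc length. -/
def edgeInt (T : Tri) (e : Fin 3) (g : E2 → ℝ) : ℝ :=
  T.len e * ∫ t in (0 : ℝ)..1, g (T.edgePt e t)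

end Tri

/-- A polygonal domain: a connected open set that is the interior of its closure and whose
closure is a finite union of triangles. -/
def IsPolygonalDomain (Ω : Set E2) : Prop :=
  IsOpen Ω ∧ IsConnected Ω ∧ interior (closure Ω) = Ω ∧
    ∃ S : Set Tri, S.Finite ∧ closure Ω = ⋃ T ∈ S, T.carrier

/-- A network of planar polygonal surfaces.  The surface `i` is the polygonal domain `dom i` in
its own coordinate plane, embedded in space by the isometry `emb i`.  The bifurcations are
nondegenerate segments; each belongs to at least three surfaces and lies in the boundary of the
surfaces it belongs to. -/
structure Network where
  N : ℕ
  dom : Fin N → Set E2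
  polygonal : ∀ i, IsPolygonalDomain (dom i)
  emb : Fin N → E2 →ᵃⁱ[ℝ] E3
  bifs : Finset (Sym2 E3)
  nondegenerate : ∀ γ ∈ bifs, ¬ γ.IsDiag
  three_le : ∀ γ ∈ bifs, 3 ≤ {i | seg γ ⊆ emb i '' closure (dom i)}.ncard
  subset_boundary : ∀ γ ∈ bifs, ∀ i, seg γ ⊆ emb i '' closure (dom i) →
    seg γ ⊆ emb i '' frontier (dom i)

namespace Network

variable (G : Network)

open Classical in
/-- `I_γ`: the surfaces whose closure contains `γ`. -/
def I (γ : Sym2 E3) : Finset (Fin G.N) :=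
  Finset.univ.filter fun i => seg γ ⊆ G.emb i '' closure (G.dom i)

/-- `D_γ`: the ordered pairs `i < j` in `I_γ`. -/
def D (γ : Sym2 E3) : Finset (Fin G.N × Fin G.N) :=
  (G.I γ ×ˢ G.I γ).filter fun ij => ij.1 < ij.2

/-- The union of all bifurcations. -/
def bifSet : Set E3 := ⋃ γ ∈ G.bifs, seg γ

/-- Two surfaces are linked if they share a bifurcation. -/
def Linked (i j : Fin G.N) : Prop := ∃ γ ∈ G.bifs, i ∈ G.I γ ∧ j ∈ G.I γ

/-- Every surface is joined, through a chain of surfaces sharing bifurcations, to a surface whose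
boundary has a part in `∂G`, the boundaries of the surfaces without the bifurcations. -/
def ReachesBoundary : Prop :=
  ∀ i, ∃ j, Relation.ReflTransGen G.Linked i j ∧
    ((G.emb j '' frontier (G.dom j)) \ G.bifSet).Nonempty

/-- The diffusion coefficient: `κ i` is a representative of an element of `L^∞` of the surface
`i`, bounded below by a positive constant. -/
def IsCoefficient (κ : Fin G.N → E2 → ℝ) : Prop :=
  (∀ i, Measurable (κ i)) ∧
  (∃ c > 0, ∀ i, ∀ᵐ x ∂(volume.restrict (G.dom i)), c ≤ κ i x) ∧
  (∃ c, ∀ i, ∀ᵐ x ∂(volume.restrict (G.dom i)), κ i x ≤ c)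

end Network

/-- A conforming triangulation of every surface.  The triangulations match at the bifurcations:
each bifurcation is partitioned by the mesh edges of any surface that contains it, and any two
such surfaces give the same partition. -/
structure Mesh (G : Network) where
  n : Fin G.N → ℕ
  tri : ∀ i, Fin (n i) → Tri
  cover : ∀ i, ⋃ K, (tri i K).carrier = closure (G.dom i)
  disjoint_interior : ∀ i, Pairwise fun K K' =>
    Disjoint (interior (tri i K).carrier) (interior (tri i K').carrier)
  conforming : ∀ i, Pairwise fun K K' =>
    (tri i K).carrier ∩ (tri i K').carrier
      = convexHull ℝ (range (tri i K).points ∩ range (tri i K').points)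
  bif_partition : ∀ γ ∈ G.bifs, ∀ i ∈ G.I γ, ∀ y ∈ seg γ, ∃ K e,
    seg (((tri i K).edge e).map (G.emb i)) ⊆ seg γ ∧ y ∈ seg (((tri i K).edge e).map (G.emb i))
  bif_match : ∀ γ ∈ G.bifs, ∀ i ∈ G.I γ, ∀ j ∈ G.I γ, ∀ K e,
    seg (((tri i K).edge e).map (G.emb i)) ⊆ seg γ →
      ∃ K' e', ((tri j K').edge e').map (G.emb j) = ((tri i K).edge e).map (G.emb i)

namespace Mesh

variable {G : Network} (M : Mesh G)

/-- A local edge of the mesh of surface `i`: a triangle and one of its edges (labelled by the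
opposite vertex). -/
abbrev Loc (i : Fin G.N) : Type := Fin (M.n i) × Fin 3

/-- The mesh edge (in the coordinate plane) of a local edge. -/
def edge {i : Fin G.N} (F : M.Loc i) : Sym2 E2 := (M.tri i F.1).edge F.2

/-- The mesh edge, embedded in space. -/
def edge3 {i : Fin G.N} (F : M.Loc i) : Sym2 E3 := (M.edge F).map (G.emb i)

/-- `h_F`: the length of the edge. -/
def len {i : Fin G.N} (F : M.Loc i) : ℝ := (M.tri i F.1).len F.2

/-- The outward unit normal of the triangle on the edge. -/
def normal {i : Fin G.N} (F : M.Loc i) : E2 := (M.tri i F.1).normal F.2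

/-- `∫_F g` (arc length). -/
def faceInt {i : Fin G.N} (F : M.Loc i) (g : E2 → ℝ) : ℝ := (M.tri i F.1).edgeInt F.2 g

open Classical in
/-- The interior mesh edges of surface `i`.  An interior edge is shared by two triangles `K < K'`
and is represented by its two local edges, the first one on `K`; the fixed unit normal `n_F` is
the one pointing from `K` to `K'`. -/
def intFaces (i : Fin G.N) : Finset (M.Loc i × M.Loc i) :=
  Finset.univ.filter fun F => F.1.1 < F.2.1 ∧ M.edge F.1 = M.edge F.2

open Classical in
/-- The mesh edges of surface `i` that belong to `∂G`: those in the boundary of the surface and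
not in a bifurcation. -/
def bdryFaces (i : Fin G.N) : Finset (M.Loc i) :=
  Finset.univ.filter fun F =>
    seg (M.edge F) ⊆ frontier (G.dom i) ∧ ∀ γ ∈ G.bifs, ¬ seg (M.edge3 F) ⊆ seg γ

open Classical in
/-- The mesh edges in the bifurcation `γ`, for a pair `(i, j)` in `D_γ`.  Since `γ` lies in the
boundaries of both surfaces and the meshes match, every mesh edge in `γ` is the edge of exactly
one triangle of surface `i` and of exactly one triangle of surface `j`; it is represented by these
two local edges. -/
def bifFaces (γ : Sym2 E3) (i j : Fin G.N) : Finset (M.Loc i × M.Loc j) :=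
  Finset.univ.filter fun F => M.edge3 F.1 = M.edge3 F.2 ∧ seg (M.edge3 F.1) ⊆ seg γ

/-- Shape regularity: every triangle contains a ball of diameter at least `diam K / σ`. -/
def ShapeRegular (σ : ℝ) : Prop :=
  ∀ i K, ∃ c r, Metric.closedBall c r ⊆ (M.tri i K).carrier ∧
    Metric.diam (M.tri i K).carrier ≤ σ * (2 * r) ∧ 0 ≤ r

/-- The coefficient has, from inside every triangle, a limit at almost every point of the edges of
that triangle. -/
def HasTraces (κ : Fin G.N → E2 → ℝ) : Prop :=
  ∀ i K e, ∀ᵐ t ∂(volume.restrict (Icc (0 : ℝ) 1)),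
    ∃ l, Tendsto (κ i) (𝓝[interior (M.tri i K).carrier] ((M.tri i K).edgePt e t)) (𝓝 l)

/-- The value at `x` of the coefficient, seen from inside the triangle `K`. -/
def kTrace (κ : Fin G.N → E2 → ℝ) (i : Fin G.N) (K : Fin (M.n i)) (x : E2) : ℝ :=
  limUnder (𝓝[interior (M.tri i K).carrier] x) (κ i)

/-- The DG space `V_h^p`: a polynomial of total degree at most `p` on every triangle. -/
abbrev V (p : ℕ) : Type :=
  (i : Fin G.N) → (K : Fin (M.n i)) → MvPolynomial.restrictTotalDegree (Fin 2) ℝ p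

variable {M} {p : ℕ}

/-- `v|_K` at `x`. -/
def val (v : M.V p) (i : Fin G.N) (K : Fin (M.n i)) (x : E2) : ℝ :=
  MvPolynomial.eval (fun k => x k) (v i K : MvPolynomial (Fin 2) ℝ)

/-- `∇v|_K` at `x`. -/
def grad (v : M.V p) (i : Fin G.N) (K : Fin (M.n i)) (x : E2) : E2 :=
  WithLp.toLp 2 fun l =>
    MvPolynomial.eval (fun k => x k) (MvPolynomial.pderiv l (v i K : MvPolynomial (Fin 2) ℝ))

/-- The trace of `κ_i ∇v · n` at `x` from inside the triangle `K`. -/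
def flux (κ : Fin G.N → E2 → ℝ) (v : M.V p) (i : Fin G.N) (K : Fin (M.n i)) (n : E2) (x : E2) :
    ℝ :=
  M.kTrace κ i K x * inner ℝ (grad v i K x) n

/-- Jump on an interior edge. -/
def jumpInt (v : M.V p) (i : Fin G.N) (F : M.Loc i × M.Loc i) (x : E2) : ℝ :=
  val v i F.1.1 x - val v i F.2.1 x

/-- Average of `κ_i ∇v · n_F` on an interior edge. -/
def avgInt (κ : Fin G.N → E2 → ℝ) (v : M.V p) (i : Fin G.N) (F : M.Loc i × M.Loc i) (x : E2) :
    ℝ :=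
  (1 / 2) * flux κ v i F.1.1 (M.normal F.1) x + (1 / 2) * flux κ v i F.2.1 (M.normal F.1) x

/-- The point of the coordinate plane of surface `j` that is the same point in space as the point
`x` of the coordinate plane of surface `i`. -/
def transfer (G : Network) (i j : Fin G.N) (x : E2) : E2 :=
  Function.invFun (G.emb j) (G.emb i x)

/-- Generalized jump `[v]_(i,j)` on a mesh edge in a bifurcation; `x` is in the coordinates of
surface `i`. -/
def jumpBif (v : M.V p) (i j : Fin G.N) (F : M.Loc i × M.Loc j) (x : E2) : ℝ :=
  val v i F.1.1 x - val v j F.2.1 (transfer G i j x)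

/-- Generalized average `{σ(v)}_(i,j)` on a mesh edge in a bifurcation. -/
def avgBif (κ : Fin G.N → E2 → ℝ) (v : M.V p) (i j : Fin G.N) (F : M.Loc i × M.Loc j) (x : E2) :
    ℝ :=
  flux κ v i F.1.1 (M.normal F.1) x - flux κ v j F.2.1 (M.normal F.2) (transfer G i j x)

/-- `∑_F ∫_F {σ(w)} ⊙ [v]` over the mesh edges `F` in the bifurcation `γ`. -/
def avgJump (κ : Fin G.N → E2 → ℝ) (w v : M.V p) (γ : Sym2 E3) : ℝ :=
  (1 / ((G.I γ).card : ℝ)) * ∑ ij ∈ G.D γ, ∑ F ∈ M.bifFaces γ ij.1 ij.2,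
    M.faceInt F.1 fun x => avgBif κ w ij.1 ij.2 F x * jumpBif v ij.1 ij.2 F x

/-- `∑_F h_F⁻¹ ∫_F [w] ⊙ [v]` over the mesh edges `F` in the bifurcation `γ`. -/
def jumpJump (w v : M.V p) (γ : Sym2 E3) : ℝ :=
  ∑ ij ∈ G.D γ, ∑ F ∈ M.bifFaces γ ij.1 ij.2,
    1 / M.len F.1 * M.faceInt F.1 fun x => jumpBif w ij.1 ij.2 F x * jumpBif v ij.1 ij.2 F x

/-- The interior penalty form `a_i` on the surface `i`; `ηF i F` is the penalty parameter of the
mesh edge `F`. -/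
def aSurf (κ : Fin G.N → E2 → ℝ) (ε : Fin G.N → ℝ) (ηF : Fin G.N → Sym2 E2 → ℝ) (i : Fin G.N)
    (w v : M.V p) : ℝ :=
  (∑ K, ∫ x in (M.tri i K).carrier, κ i x * inner ℝ (grad w i K x) (grad v i K x))
  - (∑ F ∈ M.intFaces i, M.faceInt F.1 fun x => avgInt κ w i F x * jumpInt v i F x)
  - ε i * (∑ F ∈ M.intFaces i, M.faceInt F.1 fun x => avgInt κ v i F x * jumpInt w i F x)
  + (∑ F ∈ M.intFaces i, ηF i (M.edge F.1) / M.len F.1 *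
      M.faceInt F.1 fun x => jumpInt w i F x * jumpInt v i F x)
  - (∑ F ∈ M.bdryFaces i, M.faceInt F fun x => flux κ w i F.1 (M.normal F) x * val v i F.1 x)
  - ε i * (∑ F ∈ M.bdryFaces i,
      M.faceInt F fun x => flux κ v i F.1 (M.normal F) x * val w i F.1 x)
  + (∑ F ∈ M.bdryFaces i, ηF i (M.edge F) / M.len F *
      M.faceInt F fun x => val w i F.1 x * val v i F.1 x)

/-- The DG bilinear form of the plane-network. -/
def a (κ : Fin G.N → E2 → ℝ) (ε : Fin G.N → ℝ) (ε₀ : ℝ) (ηF : Fin G.N → Sym2 E2 → ℝ)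
    (ηΓ : Sym2 E3 → ℝ) (w v : M.V p) : ℝ :=
  (∑ i, aSurf κ ε ηF i w v)
  - (∑ γ ∈ G.bifs, avgJump κ w v γ)
  - ε₀ * (∑ γ ∈ G.bifs, avgJump κ v w γ)
  + (∑ γ ∈ G.bifs, ηΓ γ * jumpJump w v γ)

/-- The square of the DG semi-norm on the surface `i`. -/
def dgSqSurf (ηF : Fin G.N → Sym2 E2 → ℝ) (i : Fin G.N) (v : M.V p) : ℝ :=
  (∑ K, ∫ x in (M.tri i K).carrier, ‖grad v i K x‖ ^ 2)
  + (∑ F ∈ M.intFaces i, ηF i (M.edge F.1) / M.len F.1 *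
      M.faceInt F.1 fun x => jumpInt v i F x ^ 2)
  + (∑ F ∈ M.bdryFaces i, ηF i (M.edge F) / M.len F * M.faceInt F fun x => val v i F.1 x ^ 2)

/-- The DG norm. -/
def dgNorm (ηF : Fin G.N → Sym2 E2 → ℝ) (ηΓ : Sym2 E3 → ℝ) (v : M.V p) : ℝ :=
  Real.sqrt ((∑ i, dgSqSurf ηF i v)
    + ∑ γ ∈ G.bifs, ηΓ γ * ∑ ij ∈ G.D γ, ∑ F ∈ M.bifFaces γ ij.1 ij.2,
        1 / M.len F.1 * M.faceInt F.1 fun x => jumpBif v ij.1 ij.2 F x ^ 2)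

/-- The right-hand side `∑ i, ∫_{Ω_i} f_i v`. -/
def load (f : Fin G.N → E2 → ℝ) (v : M.V p) : ℝ :=
  ∑ i, ∑ K, ∫ x in (M.tri i K).carrier, f i x * val v i K x

end Mesh

end PlaneDG

end

/-!
Testing `a` with `v` itself leaves the energy, the penalties and the consistency terms, the latter
multiplied by `1 + ε i` on the domain `i` and by `1 + ε₀` at the bifurcations. By the inverse trace
inequality and Cauchy–Schwarz, the square of a consistency term is bounded by the energy times the
jumps with unit penalty parameters, with a constant that depends on the mesh only through its
regularity. Large penalty parameters therefore absorb these terms, and at `ε i = -1` there is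
nothing to absorb.

A discrete function of zero DG norm is constant on each element. Its values agree on adjacent
elements, hence on each domain, because removing finitely many points does not disconnect an open
connected subset of the plane. They agree across bifurcations and vanish at faces in `∂G`, so that
the function is zero when every domain is linked to `∂G`. As `a` is then definite on a space of
finite dimension, the discrete problem is well posed.
-/

/-! ## Bilinear forms given by formulas -/

section LinearFunctions

variable {R V W : Type*} [CommRing R] [AddCommGroup V] [Module R V] [AddCommGroup W] [Module R W]

theorem isLinearMap_sum {ι : Type*} (s : Finset ι) {f : ι → V → W}
    (hf : ∀ i ∈ s, IsLinearMap R (f i)) : IsLinearMap R fun v => ∑ i ∈ s, f i v where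
  map_add u v := by
    rw [← Finset.sum_add_distrib]
    exact Finset.sum_congr rfl fun i hi => (hf i hi).map_add u v
  map_smul c v := by
    rw [Finset.smul_sum]
    exact Finset.sum_congr rfl fun i hi => (hf i hi).map_smul c v

theorem isLinearMap_add {f g : V → W} (hf : IsLinearMap R f) (hg : IsLinearMap R g) :
    IsLinearMap R fun v => f v + g v :=
  (hf.mk' f + hg.mk' g).isLinear

theorem isLinearMap_sub {f g : V → W} (hf : IsLinearMap R f) (hg : IsLinearMap R g) :
    IsLinearMap R fun v => f v - g v :=
  (hf.mk' f - hg.mk' g).isLinear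

theorem isLinearMap_const_mul {f : V → R} (hf : IsLinearMap R f) (r : R) :
    IsLinearMap R fun v => r * f v :=
  (r • hf.mk' f).isLinear

theorem isLinearMap_mul_const {f : V → R} (hf : IsLinearMap R f) (r : R) :
    IsLinearMap R fun v => f v * r := by
  simpa only [mul_comm] using isLinearMap_const_mul hf r

theorem isLinearMap_integral {V E α : Type*} [AddCommGroup V] [Module ℝ V]
    [NormedAddCommGroup E] [NormedSpace ℝ E] [MeasurableSpace α] {μ : Measure α} {f : α → V → E}
    (hf : ∀ t, IsLinearMap ℝ (f t)) (hi : ∀ v, Integrable (fun t => f t v) μ) :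
    IsLinearMap ℝ fun v => ∫ t, f t v ∂μ where
  map_add u v := by
    simp_rw [(hf _).map_add]
    exact integral_add (hi u) (hi v)
  map_smul c v := by
    simp_rw [(hf _).map_smul]
    exact integral_smul c _

end LinearFunctions

/-- Bilinearity of a scalar function of two vectors, as a predicate: the discontinuous Galerkin
forms are given by formulas and not as bundled maps. -/
structure IsBilin {R V : Type*} [CommRing R] [AddCommGroup V] [Module R V] (f : V → V → R) :
    Prop where
  left : ∀ v, IsLinearMap R fun u => f u v
  right : ∀ u, IsLinearMap R (f u)

namespace IsBilin

section Ring

variable {R V : Type*} [CommRing R] [AddCommGroup V] [Module R V] {f g : V → V → R}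

theorem mul {k l : V → R} (hk : IsLinearMap R k) (hl : IsLinearMap R l) :
    IsBilin fun u v => k u * l v :=
  ⟨fun v => isLinearMap_mul_const hk (l v), fun u => isLinearMap_const_mul hl (k u)⟩

theorem swap (hf : IsBilin f) : IsBilin fun u v => f v u :=
  ⟨hf.right, hf.left⟩

theorem add (hf : IsBilin f) (hg : IsBilin g) : IsBilin fun u v => f u v + g u v :=
  ⟨fun v => isLinearMap_add (hf.left v) (hg.left v),
    fun u => isLinearMap_add (hf.right u) (hg.right u)⟩

theorem sub (hf : IsBilin f) (hg : IsBilin g) : IsBilin fun u v => f u v - g u v :=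
  ⟨fun v => isLinearMap_sub (hf.left v) (hg.left v),
    fun u => isLinearMap_sub (hf.right u) (hg.right u)⟩

theorem const_mul (hf : IsBilin f) (r : R) : IsBilin fun u v => r * f u v :=
  ⟨fun v => isLinearMap_const_mul (hf.left v) r, fun u => isLinearMap_const_mul (hf.right u) r⟩

theorem sum {ι : Type*} (s : Finset ι) {f : ι → V → V → R} (hf : ∀ i ∈ s, IsBilin (f i)) :
    IsBilin fun u v => ∑ i ∈ s, f i u v :=
  ⟨fun v => isLinearMap_sum s fun i hi => (hf i hi).left v,
    fun u => isLinearMap_sum s fun i hi => (hf i hi).right u⟩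

/-- The bundled form of a bilinear function. -/
def toBilinForm (hf : IsBilin f) : LinearMap.BilinForm R V :=
  LinearMap.mk₂ R f (fun u u' v => (hf.left v).map_add u u')
    (fun c u v => (hf.left v).map_smul c u) (fun u => (hf.right u).map_add)
    fun c u => (hf.right u).map_smul c

end Ring

section Real

variable {V : Type*} [AddCommGroup V] [Module ℝ V] {f : V → V → ℝ}

theorem integral {α : Type*} [MeasurableSpace α] {μ : Measure α} {f : α → V → V → ℝ}
    (hf : ∀ t, IsBilin (f t)) (hi : ∀ u v, Integrable (fun t => f t u v) μ) :
    IsBilin fun u v => ∫ t, f t u v ∂μ :=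
  ⟨fun v => isLinearMap_integral (fun t => (hf t).left v) fun u => hi u v,
    fun u => isLinearMap_integral (fun t => (hf t).right u) (hi u)⟩

theorem existsUnique_of_definite [Module.Finite ℝ V] (hf : IsBilin f)
    (hd : ∀ u, f u u = 0 → u = 0) {ℓ : V → ℝ} (hℓ : IsLinearMap ℝ ℓ) : ∃! u, ∀ v, f u v = ℓ v := by
  have hB : hf.toBilinForm.Nondegenerate := ⟨fun u hu => hd u (hu u), fun u hu => hd u (hu u)⟩
  obtain ⟨u, hu, huniq⟩ := (hf.toBilinForm.toDual hB).bijective.existsUnique (hℓ.mk' ℓ)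
  exact ⟨u, LinearMap.congr_fun hu, fun w hw => huniq w (LinearMap.ext hw)⟩

theorem exists_sq_le [Module.Finite ℝ V] (hf : IsBilin f) (hs : ∀ u v, f u v = f v u)
    (hn : ∀ u, 0 ≤ f u u) (hd : ∀ u, f u u = 0 → u = 0) {ℓ : V → ℝ} (hℓ : IsLinearMap ℝ ℓ) :
    ∃ C, 0 ≤ C ∧ ∀ v, ℓ v ^ 2 ≤ C * f v v := by
  obtain ⟨u, hu, -⟩ := hf.existsUnique_of_definite hd hℓ
  refine ⟨f u u, hn u, fun v => ?_⟩
  rw [← hu v]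
  exact LinearMap.BilinForm.apply_sq_le_of_symm hf.toBilinForm hn ⟨hs⟩ u v

theorem exists_forall_sq_le [Module.Finite ℝ V] (hf : IsBilin f) (hs : ∀ u v, f u v = f v u)
    (hn : ∀ u, 0 ≤ f u u) (hd : ∀ u, f u u = 0 → u = 0) {α : Type*} {ℓ : α → V → ℝ}
    (hℓ : ∀ a, IsLinearMap ℝ (ℓ a)) (hbdd : ∀ v, ∃ D, ∀ a, ℓ a v ^ 2 ≤ D) :
    ∃ C, 0 ≤ C ∧ ∀ a v, ℓ a v ^ 2 ≤ C * f v v := by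
  let b := Module.finBasis ℝ V
  choose D hD using hbdd
  choose A hA₀ hA using fun k => hf.exists_sq_le hs hn hd (b.coord k).isLinear
  have hD₀ (v : V) : 0 ≤ max (D v) 0 := le_max_right _ _
  refine ⟨(∑ k, max (D (b k)) 0) * ∑ k, A k,
    mul_nonneg (Finset.sum_nonneg fun k _ => hD₀ (b k)) (Finset.sum_nonneg fun k _ => hA₀ k),
    fun a v => ?_⟩
  have hexpand : ℓ a v = ∑ k, ℓ a (b k) * b.coord k v := by
    conv_lhs => rw [← b.sum_repr v]
    exact (map_sum ((hℓ a).mk' _) _ _).trans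
      (Finset.sum_congr rfl fun k _ => ((hℓ a).map_smul _ _).trans (mul_comm _ _))
  calc
    ℓ a v ^ 2 ≤ (∑ k, ℓ a (b k) ^ 2) * ∑ k, b.coord k v ^ 2 := by
      rw [hexpand]
      exact Finset.sum_mul_sq_le_sq_mul_sq _ _ _
    _ ≤ (∑ k, max (D (b k)) 0) * ∑ k, A k * f v v := by
      refine mul_le_mul ?_ (Finset.sum_le_sum fun k _ => hA k v)
        (Finset.sum_nonneg fun k _ => sq_nonneg _) (Finset.sum_nonneg fun k _ => hD₀ (b k))
      exact Finset.sum_le_sum fun k _ => (hD (b k) a).trans (le_max_left _ _)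
    _ = (∑ k, max (D (b k)) 0) * (∑ k, A k) * f v v := by rw [← Finset.sum_mul, mul_assoc]

end Real

end IsBilin

/-! ## Absorption of the consistency terms -/

theorem exists_pos_le_mul {b : ℝ} (hb : 0 < b) (x : ℝ) : ∃ η > 0, x ≤ b * η := by
  refine ⟨(|x| + 1) / b, by positivity, ?_⟩
  rw [mul_div_cancel₀ _ hb.ne']
  linarith [le_abs_self x]

theorem mul_le_of_sq_le_mul {b t T R η g q j x : ℝ} (hb : 0 ≤ b) (hbη : 4 * T ^ 2 * R ≤ b * η)
    (ht : |t| ≤ T) (hg : 0 ≤ g) (hq : 0 ≤ q) (hj : 0 ≤ j) (hx : x ^ 2 ≤ R * (g * q))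
    (hqj : η * q ≤ j) : t * x ≤ b / 4 * g + j / 4 := by
  have htT : t ^ 2 ≤ T ^ 2 := sq_le_sq' (neg_le_of_abs_le ht) (le_of_abs_le ht)
  have hsq : (t * x) ^ 2 ≤ (b / 4 * g + j / 4) ^ 2 := calc
    (t * x) ^ 2 = t ^ 2 * x ^ 2 := mul_pow t x 2
    _ ≤ T ^ 2 * (R * (g * q)) := by gcongr
    _ = 4 * T ^ 2 * R * (g * q) / 4 := by ring
    _ ≤ b * η * (g * q) / 4 := by gcongr
    _ = b * g * (η * q) / 4 := by ring
    _ ≤ b * g * j / 4 := by gcongr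
    _ ≤ (b / 4 * g + j / 4) ^ 2 := by nlinarith [sq_nonneg (b * g - j)]
  exact le_of_abs_le (abs_le_of_sq_le_sq hsq (by positivity))

/-- In the application `A` is the energy weighted by the coefficient, `g` the Dirichlet energy, `x`
and `y` are the consistency terms, `q` and `r` the jumps with unit penalty parameters and `j` and
`z` the jumps with the actual ones. -/
theorem energy_add_penalty_le {ι : Type*} [Fintype ι] {b e R η : ℝ} {A g x q j ε : ι → ℝ}
    {y r z ε₀ : ℝ} (hb : 0 < b) (hbη : 4 * (1 + e) ^ 2 * R ≤ b * η)
    (hg : ∀ i, 0 ≤ g i) (hq : ∀ i, 0 ≤ q i) (hj : ∀ i, 0 ≤ j i) (hr : 0 ≤ r) (hz : 0 ≤ z)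
    (hA : ∀ i, b * g i ≤ A i) (hx : ∀ i, x i ^ 2 ≤ R * (g i * q i))
    (hy : y ^ 2 ≤ R * ((∑ i, g i) * r)) (hε : ∀ i, |ε i| ≤ e) (hε₀ : |ε₀| ≤ e)
    (hqj : ∀ i, ε i ≠ -1 → η * q i ≤ j i) (hrz : η * r ≤ z) :
    ∑ i, g i + (∑ i, j i + z) ≤
      (2 / b + 4 / 3) * (∑ i, (A i - (1 + ε i) * x i + j i) - (1 + ε₀) * y + z) := by
  have abs_one_add_le {t : ℝ} (ht : |t| ≤ e) : |1 + t| ≤ 1 + e := by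
    simpa using (abs_add_le 1 t).trans (add_le_add_right ht |1|)
  have hG : 0 ≤ ∑ i, g i := Finset.sum_nonneg fun i _ => hg i
  have hJ : 0 ≤ ∑ i, j i := Finset.sum_nonneg fun i _ => hj i
  have hlocal : ∀ i, 3 * b / 4 * g i + 3 / 4 * j i ≤ A i - (1 + ε i) * x i + j i := by
    intro i
    have hbg : 0 ≤ b * g i := mul_nonneg hb.le (hg i)
    have hxi : (1 + ε i) * x i ≤ b / 4 * g i + j i / 4 := by
      rcases eq_or_ne (ε i) (-1) with h | h
      · rw [h]; linarith [hj i]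
      · exact mul_le_of_sq_le_mul hb.le hbη (abs_one_add_le (hε i)) (hg i) (hq i) (hj i) (hx i)
          (hqj i h)
    linarith [hA i]
  have hyG : (1 + ε₀) * y ≤ b / 4 * ∑ i, g i + z / 4 :=
    mul_le_of_sq_le_mul hb.le hbη (abs_one_add_le hε₀) hG hr hz hy hrz
  have hsum : b / 2 * ∑ i, g i + 3 / 4 * (∑ i, j i + z) ≤
      ∑ i, (A i - (1 + ε i) * x i + j i) - (1 + ε₀) * y + z := by
    have h := Finset.sum_le_sum fun i (_ : i ∈ Finset.univ) => hlocal i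
    rw [Finset.sum_add_distrib, ← Finset.mul_sum, ← Finset.mul_sum] at h
    linarith
  have h₁ := mul_le_mul_of_nonneg_left hsum (by positivity : 0 ≤ 2 / b + 4 / 3)
  have h₂ : (2 / b + 4 / 3) * (b / 2 * ∑ i, g i + 3 / 4 * (∑ i, j i + z)) =
      ∑ i, g i + (∑ i, j i + z) + 2 * b / 3 * ∑ i, g i + 3 / (2 * b) * (∑ i, j i + z) := by
    field_simp
    ring
  have h₃ : 0 ≤ 2 * b / 3 * ∑ i, g i + 3 / (2 * b) * (∑ i, j i + z) := by positivity
  linarith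

/-- The symmetrization parameters `ε`, `ε₀` and penalty parameters `ηF`, `ηΓ` for which the forms
are shown to be coercive, the thresholds being `e` and `η₀`. At `ε i = -1` the consistency terms on
the domain `i` cancel, and any positive penalty is admissible there. -/
structure AdmissibleParams {ι Φ β : Type*} (e η₀ : ℝ) (ε : ι → ℝ) (ε₀ : ℝ) (ηF : ι → Φ → ℝ)
    (ηΓ : β → ℝ) : Prop where
  abs_le : ∀ i, |ε i| ≤ e
  abs_le₀ : |ε₀| ≤ e
  pos_of_eq : ∀ i, ε i = -1 → ∀ F, 0 < ηF i F
  le_of_ne : ∀ i, ε i ≠ -1 → ∀ F, η₀ ≤ ηF i F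
  le_bif : ∀ γ, η₀ ≤ ηΓ γ

namespace AdmissibleParams

variable {ι Φ β : Type*} {e η₀ : ℝ} {ε : ι → ℝ} {ε₀ : ℝ} {ηF : ι → Φ → ℝ} {ηΓ : β → ℝ}

theorem pos (h : AdmissibleParams e η₀ ε ε₀ ηF ηΓ) (hη₀ : 0 < η₀) (i : ι) (F : Φ) : 0 < ηF i F := by
  rcases eq_or_ne (ε i) (-1) with hi | hi
  · exact h.pos_of_eq i hi F
  · exact hη₀.trans_le (h.le_of_ne i hi F)

theorem bif_pos (h : AdmissibleParams e η₀ ε ε₀ ηF ηΓ) (hη₀ : 0 < η₀) (γ : β) : 0 < ηΓ γ :=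
  hη₀.trans_le (h.le_bif γ)

theorem of_mem (hε : ∀ i, ε i ∈ ({-1, 0, 1} : Set ℝ)) (hε₀ : ε₀ ∈ ({-1, 0, 1} : Set ℝ))
    (hpos : ∀ i, ε i = -1 → ∀ F, 0 < ηF i F) (hle : ∀ i, ε i = 0 ∨ ε i = 1 → ∀ F, η₀ ≤ ηF i F)
    (hΓ : ∀ γ, η₀ ≤ ηΓ γ) : AdmissibleParams 1 η₀ ε ε₀ ηF ηΓ := by
  have abs_le_one {t : ℝ} (ht : t ∈ ({-1, 0, 1} : Set ℝ)) : |t| ≤ 1 := by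
    rcases ht with rfl | rfl | rfl <;> norm_num
  exact ⟨fun i => abs_le_one (hε i), abs_le_one hε₀, hpos,
    fun i hi => hle i ((hε i).resolve_left hi), hΓ⟩

end AdmissibleParams

theorem sq_add_le_add_mul_add {x₁ x₂ e₁ e₂ q₁ q₂ : ℝ} (he₁ : 0 ≤ e₁) (he₂ : 0 ≤ e₂) (hq₁ : 0 ≤ q₁)
    (hq₂ : 0 ≤ q₂) (h₁ : x₁ ^ 2 ≤ e₁ * q₁) (h₂ : x₂ ^ 2 ≤ e₂ * q₂) :
    (x₁ + x₂) ^ 2 ≤ (e₁ + e₂) * (q₁ + q₂) := by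
  have h := Finset.sum_sq_le_sum_mul_sum_of_sq_le_mul (Finset.univ : Finset (Fin 2))
    (r := ![x₁, x₂]) (f := ![e₁, e₂]) (g := ![q₁, q₂]) (by simp [Fin.forall_fin_two, he₁, he₂])
    (by simp [Fin.forall_fin_two, hq₁, hq₂]) (by simp [Fin.forall_fin_two, h₁, h₂])
  simpa [Fin.sum_univ_two] using h

theorem mul_sq_le_of_mul_sq_le {h x y e : ℝ} (hh : 0 < h) (hx : h * x ^ 2 ≤ e) :
    (x * y) ^ 2 ≤ e * (1 / h * y ^ 2) := calc
  (x * y) ^ 2 = h * x ^ 2 * (1 / h * y ^ 2) := by field_simp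
  _ ≤ e * (1 / h * y ^ 2) := by gcongr

theorem sum_comp_le_sum {ι κ : Type*} [Fintype κ] {f : κ → ℝ} (hf : ∀ k, 0 ≤ f k) {s : Finset ι}
    {g : ι → κ} (hg : Set.InjOn g s) : ∑ x ∈ s, f (g x) ≤ ∑ k, f k := by
  classical
  rw [← Finset.sum_image (f := f) hg]
  exact Finset.sum_le_sum_of_subset_of_nonneg (Finset.subset_univ _) fun k _ _ => hf k

theorem sum_comp_le_card_mul_sum {ι κ : Type*} [Fintype κ] [DecidableEq κ] {f : κ → ℝ}
    (hf : ∀ k, 0 ≤ f k) {s : Finset ι} {g : ι → κ} {n : ℕ}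
    (hg : ∀ k, (s.filter fun x => g x = k).card ≤ n) : ∑ x ∈ s, f (g x) ≤ n * ∑ k, f k := by
  rw [Finset.sum_comp, Finset.mul_sum]
  simp_rw [nsmul_eq_mul]
  have hterm (k : κ) : ((s.filter fun x => g x = k).card : ℝ) * f k ≤ n * f k :=
    mul_le_mul_of_nonneg_right (by exact_mod_cast hg k) (hf k)
  refine (Finset.sum_le_sum fun k _ => hterm k).trans ?_
  exact Finset.sum_le_sum_of_subset_of_nonneg (Finset.subset_univ _)
    fun k _ _ => mul_nonneg n.cast_nonneg (hf k)

theorem eq_zero_of_sum_mul_sq_eq_zero {ι : Type*} {s : Finset ι} {w x : ι → ℝ}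
    (hw : ∀ i ∈ s, 0 < w i) (h : ∑ i ∈ s, w i * x i ^ 2 = 0) {i : ι} (hi : i ∈ s) : x i = 0 := by
  have h' := (Finset.sum_eq_zero_iff_of_nonneg
    fun i hi => mul_nonneg (hw i hi).le (sq_nonneg (x i))).1 h i hi
  simpa [(hw i hi).ne'] using h'

theorem eq_zero_of_reaches {ι α : Type*} [Zero α] {r : ι → ι → Prop} {P : ι → Prop} {c : ι → α}
    (hreach : ∀ i, ∃ j, Relation.ReflTransGen r i j ∧ P j) (hr : ∀ i j, r i j → c i = c j)
    (hP : ∀ j, P j → c j = 0) (i : ι) : c i = 0 := by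
  obtain ⟨j, hij, hj⟩ := hreach i
  induction hij using Relation.ReflTransGen.head_induction_on with
  | refl => exact hP j hj
  | head hik _ ih => rw [hr _ _ hik, ih]

/-! ## Limits and integrals of functions on open sets -/

theorem sq_integral_mul_le {α : Type*} [MeasurableSpace α] {μ : Measure α} [IsProbabilityMeasure μ]
    {g j : α → ℝ} {B : ℝ} (hj : MemLp j 2 μ) (hg : ∀ᵐ t ∂μ, g t ^ 2 ≤ B) :
    (∫ t, g t * j t ∂μ) ^ 2 ≤ B * ∫ t, j t ^ 2 ∂μ := by
  obtain ⟨t₀, ht₀⟩ := hg.exists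
  have hB : 0 ≤ B := (sq_nonneg _).trans ht₀
  have hbound : |∫ t, g t * j t ∂μ| ≤ √B * ∫ t, |j t| ∂μ := by
    rw [← integral_const_mul]
    refine norm_integral_le_of_norm_le (f := fun t => g t * j t)
      ((hj.integrable one_le_two).abs.const_mul (√B)) ?_
    filter_upwards [hg] with t ht
    rw [Real.norm_eq_abs, abs_mul]
    gcongr
    exact Real.abs_le_sqrt ht
  have hjensen : (∫ t, |j t| ∂μ) ^ 2 ≤ ∫ t, j t ^ 2 ∂μ := by
    have h := ProbabilityTheory.variance_nonneg |j| μ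
    rw [ProbabilityTheory.variance_eq_sub hj.abs, sub_nonneg] at h
    simpa only [Pi.pow_apply, Pi.abs_apply, sq_abs] using h
  calc (∫ t, g t * j t ∂μ) ^ 2 ≤ (√B * ∫ t, |j t| ∂μ) ^ 2 :=
        sq_le_sq.2 (hbound.trans (le_abs_self _))
    _ = B * (∫ t, |j t| ∂μ) ^ 2 := by rw [mul_pow, Real.sq_sqrt hB]
    _ ≤ B * ∫ t, j t ^ 2 ∂μ := by gcongr

section OpenSets

variable {X : Type*} [TopologicalSpace X] [MeasurableSpace X] {μ : Measure X}
  [μ.IsOpenPosMeasure]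

theorem mem_of_tendsto_nhdsWithin_of_ae_mem {Y : Type*} [TopologicalSpace Y] {κ : X → Y}
    {U : Set X} {s : Set Y} {x : X} {l : Y} (hU : IsOpen U) (hs : IsClosed s) (hx : x ∈ closure U)
    (hκ : ∀ᵐ y ∂(μ.restrict U), κ y ∈ s) (hl : Tendsto κ (𝓝[U] x) (𝓝 l)) : l ∈ s := by
  refine hs.mem_of_frequently_of_tendsto ?_ hl
  intro hne
  rw [eventually_nhdsWithin_iff, eventually_nhds_iff] at hne
  obtain ⟨O, hO, hOo, hxO⟩ := hne
  have hpos : μ (O ∩ U) ≠ 0 := ((hOo.inter hU).measure_pos μ (mem_closure_iff.1 hx O hOo hxO)).ne'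
  have hsub : O ∩ U ⊆ {y | κ y ∉ s} := fun y hy => hO y hy.1 hy.2
  have hnull := measure_mono_null hsub hκ
  rw [Measure.restrict_eq_self μ inter_subset_right] at hnull
  exact hpos hnull

theorem eqOn_zero_of_setIntegral_eq_zero {f : X → ℝ} {U s : Set X} (hU : IsOpen U) (hUs : U ⊆ s)
    (hf : ContinuousOn f U) (h0 : ∀ x, 0 ≤ f x) (hi : IntegrableOn f s μ)
    (h : ∫ x in s, f x ∂μ = 0) : EqOn f 0 U := by
  have hae := (setIntegral_eq_zero_iff_of_nonneg_ae (.of_forall h0) hi).1 h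
  exact Measure.eqOn_open_of_ae_eq (ae_restrict_of_ae_restrict_of_subset hUs hae) hU hf
    continuousOn_const

end OpenSets

/-! ## Polynomials of one variable on an interval -/

section IntervalPolynomials

open Polynomial

theorem finite_degreeLE (p : ℕ) : Module.Finite ℝ (degreeLE ℝ (p : WithBot ℕ)) := by
  rw [← degreeLT_succ_eq_degreeLE]
  exact .of_basis (degreeLT.basis ℝ (p + 1))

theorem exists_eval_sq_le_integral (p : ℕ) (x : ℝ) : ∃ C, 0 ≤ C ∧
    ∀ q ∈ degreeLE ℝ (p : WithBot ℕ), q.eval x ^ 2 ≤ C * ∫ t in (0 : ℝ)..1, q.eval t ^ 2 := by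
  have := finite_degreeLE p
  have heval (t : ℝ) : IsLinearMap ℝ fun q : degreeLE ℝ (p : WithBot ℕ) => (q : ℝ[X]).eval t :=
    ((leval t).comp (degreeLE ℝ (p : WithBot ℕ)).subtype).isLinear
  have hint (q r : ℝ[X]) : IntegrableOn (fun t => q.eval t * r.eval t) (Ioc (0 : ℝ) 1) :=
    ((by fun_prop : Continuous fun t => q.eval t * r.eval t).integrableOn_Ioc)
  have hbilin : IsBilin fun q r : degreeLE ℝ (p : WithBot ℕ) =>
      ∫ t in Ioc (0 : ℝ) 1, (q : ℝ[X]).eval t * (r : ℝ[X]).eval t :=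
    .integral (fun t => .mul (heval t) (heval t)) fun q r => hint q r
  have hdef (q : degreeLE ℝ (p : WithBot ℕ))
      (hq : ∫ t in Ioc (0 : ℝ) 1, (q : ℝ[X]).eval t * (q : ℝ[X]).eval t = 0) : q = 0 := by
    have hzero := eqOn_zero_of_setIntegral_eq_zero isOpen_Ioo Ioo_subset_Ioc_self
      (by fun_prop) (fun x => mul_self_nonneg _) (hint q q) hq
    exact Subtype.ext (eq_zero_of_infinite_isRoot _
      ((Ioo_infinite one_pos).mono fun x hx => mul_self_eq_zero.1 (hzero hx)))
  obtain ⟨C, hC, h⟩ := hbilin.exists_sq_le (fun q r => by simp_rw [mul_comm])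
    (fun q => integral_nonneg fun t => mul_self_nonneg _) hdef (heval x)
  refine ⟨C, hC, fun q hq => ?_⟩
  rw [intervalIntegral.integral_of_le zero_le_one]
  simpa only [sq] using h ⟨q, hq⟩

/-- Inverse trace inequality: the constant is the one of the unit interval, by scaling. -/
theorem exists_length_mul_eval_sq_le (p : ℕ) : ∃ C, 0 ≤ C ∧
    ∀ q ∈ degreeLE ℝ (p : WithBot ℕ), ∀ a b : ℝ, a < b → ∀ x ∈ ({a, b} : Set ℝ),
      (b - a) * q.eval x ^ 2 ≤ C * ∫ t in a..b, q.eval t ^ 2 := by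
  obtain ⟨C₀, hC₀, h₀⟩ := exists_eval_sq_le_integral p 0
  obtain ⟨C₁, -, h₁⟩ := exists_eval_sq_le_integral p 1
  refine ⟨max C₀ C₁, le_max_of_le_left hC₀, fun q hq a b hab x hx => ?_⟩
  have hba : 0 < b - a := sub_pos.2 hab
  let φ : ℝ[X] := C a + C (b - a) * X
  have hφ (t : ℝ) : (q.comp φ).eval t = q.eval (a + (b - a) * t) := by simp [φ]
  have hdeg : q.comp φ ∈ degreeLE ℝ (p : WithBot ℕ) := by
    rw [mem_degreeLE, ← natDegree_le_iff_degree_le] at hq ⊢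
    have : φ.natDegree ≤ 1 := by simp only [φ]; compute_degree
    exact natDegree_comp_le.trans (by nlinarith)
  have hscale : ∫ t in (0 : ℝ)..1, (q.comp φ).eval t ^ 2 =
      (b - a)⁻¹ * ∫ t in a..b, q.eval t ^ 2 := by
    simp_rw [hφ]
    rw [intervalIntegral.integral_comp_add_mul (fun t => q.eval t ^ 2) hba.ne' a]
    simp
  have hnonneg : 0 ≤ ∫ t in (0 : ℝ)..1, (q.comp φ).eval t ^ 2 :=
    intervalIntegral.integral_nonneg zero_le_one fun t _ => sq_nonneg _
  have hunit : q.eval x ^ 2 ≤ max C₀ C₁ * ∫ t in (0 : ℝ)..1, (q.comp φ).eval t ^ 2 := by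
    rcases hx with rfl | rfl
    · have h := h₀ _ hdeg
      rw [hφ, mul_zero, add_zero] at h
      exact h.trans (mul_le_mul_of_nonneg_right (le_max_left _ _) hnonneg)
    · have h := h₁ _ hdeg
      rw [hφ, mul_one, add_sub_cancel] at h
      exact h.trans (mul_le_mul_of_nonneg_right (le_max_right _ _) hnonneg)
  rw [hscale, mul_left_comm] at hunit
  exact (le_inv_mul_iff₀ hba).1 hunit

end IntervalPolynomials

/-! ## Edge-networks -/

theorem EdgeDG.Network.IsCoefficient.exists_bounds {G : EdgeDG.Network} {κ : Fin G.N → ℝ → ℝ}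
    (hκ : G.IsCoefficient κ) : ∃ b c, 0 < b ∧
      (∀ i, ∀ᵐ x ∂(volume.restrict (Ioo (G.left i) (G.right i))), b ≤ κ i x) ∧
      ∀ i, ∀ᵐ x ∂(volume.restrict (Ioo (G.left i) (G.right i))), |κ i x| ≤ c := by
  obtain ⟨-, ⟨b, hb₀, hb⟩, c, hc⟩ := hκ
  refine ⟨b, c, hb₀, hb, fun i => ?_⟩
  filter_upwards [hb i, hc i] with x hbx hxc
  exact abs_le.2 ⟨by linarith, hxc⟩

namespace EdgeDG.Mesh

variable {G : Network} {M : Mesh G} {p : ℕ}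

theorem lo_lt_hi (M : Mesh G) (i : Fin G.N) (K : Fin (M.n i)) : M.lo i K < M.hi i K :=
  M.strictMono i K.castSucc_lt_succ

theorem len_pos (M : Mesh G) (i : Fin G.N) (K : Fin (M.n i)) : 0 < M.len i K :=
  sub_pos.2 (M.lo_lt_hi i K)

theorem Ioo_lo_hi_subset (M : Mesh G) (i : Fin G.N) (K : Fin (M.n i)) :
    Ioo (M.lo i K) (M.hi i K) ⊆ Ioo (G.left i) (G.right i) := by
  rw [← M.pt_zero i, ← M.pt_last i]
  exact Ioo_subset_Ioo ((M.strictMono i).monotone (Fin.zero_le _))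
    ((M.strictMono i).monotone (Fin.le_last _))

theorem ae_Ioc_of_ae_edge (M : Mesh G) {i : Fin G.N} (K : Fin (M.n i)) {P : ℝ → Prop}
    (h : ∀ᵐ x ∂(volume.restrict (Ioo (G.left i) (G.right i))), P x) :
    ∀ᵐ x ∂(volume.restrict (Ioc (M.lo i K) (M.hi i K))), P x := by
  rw [← Measure.restrict_congr_set (Ioo_ae_eq_Ioc (a := M.lo i K) (b := M.hi i K) (μ := volume))]
  exact ae_restrict_of_ae_restrict_of_subset (M.Ioo_lo_hi_subset i K) h

theorem hi_fst_eq_lo_snd {i : Fin G.N} {F : Fin (M.n i) × Fin (M.n i)} (hF : F ∈ M.intFaces i) :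
    M.hi i F.1 = M.lo i F.2 :=
  congrArg (M.pt i) (Fin.ext (Finset.mem_filter.1 hF).2)

theorem injOn_fst_intFaces (M : Mesh G) (i : Fin G.N) :
    Set.InjOn Prod.fst (M.intFaces i : Set (Fin (M.n i) × Fin (M.n i))) := by
  intro F hF F' hF' h
  refine Prod.ext h (Fin.ext ?_)
  rw [← (Finset.mem_filter.1 hF).2, ← (Finset.mem_filter.1 hF').2, h]

theorem injOn_snd_intFaces (M : Mesh G) (i : Fin G.N) :
    Set.InjOn Prod.snd (M.intFaces i : Set (Fin (M.n i) × Fin (M.n i))) := by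
  intro F hF F' hF' h
  refine Prod.ext (Fin.ext (Nat.succ_injective ?_)) h
  exact ((Finset.mem_filter.1 hF).2.trans (congrArg _ h)).trans (Finset.mem_filter.1 hF').2.symm

theorem endPt_mem (M : Mesh G) (i : Fin G.N) (b : Bool) :
    G.endPt i b ∈ ({M.lo i (M.endElem i b), M.hi i (M.endElem i b)} : Set ℝ) := by
  cases b
  · exact .inl (M.pt_zero i).symm
  · refine .inr ((M.pt_last i).symm.trans (congrArg (M.pt i) (Fin.ext ?_)))
    exact (Nat.sub_add_cancel (M.n_pos i)).symm

theorem hBdry_pos (M : Mesh G) (i : Fin G.N) (b : Bool) : 0 < M.hBdry i b := M.len_pos i _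

theorem hInt_pos (M : Mesh G) (i : Fin G.N) (F : Fin (M.n i) × Fin (M.n i)) : 0 < M.hInt i F :=
  lt_max_of_lt_left (M.len_pos i _)

theorem I_nonempty {γ : Fin G.numVert} (hγ : γ ∈ G.bifs) : (G.I γ).Nonempty :=
  Finset.card_pos.1 (zero_lt_three.trans_le (Finset.mem_filter.1 hγ).2)

theorem hBif_pos (M : Mesh G) {γ : Fin G.numVert} (hγ : γ ∈ G.bifs) : 0 < M.hBif γ := by
  obtain ⟨i, hi⟩ := I_nonempty hγ
  exact (M.hBdry_pos i _).trans_le (le_ciSup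
    (f := fun i : {i // i ∈ G.I γ} => M.hBdry i.1 (G.endAt i.1 γ)) (Set.finite_range _).bddAbove
    ⟨i, hi⟩)

theorem ShapeRegular.mono {σ s : ℝ} (hM : M.ShapeRegular σ) (hs : σ ≤ s) : M.ShapeRegular s := by
  have mul_len_le (i : Fin G.N) (K : Fin (M.n i)) : σ * M.len i K ≤ s * M.len i K :=
    mul_le_mul_of_nonneg_right hs (M.len_pos i K).le
  exact ⟨fun i F hF => ⟨(hM.1 i F hF).1.trans (mul_len_le _ _),
    (hM.1 i F hF).2.trans (mul_len_le _ _)⟩,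
    fun γ hγ i hi j hj => (hM.2 γ hγ i hi j hj).trans (mul_len_le _ _)⟩

theorem hBif_le {σ : ℝ} (hM : M.ShapeRegular σ) {γ : Fin G.numVert} (hγ : γ ∈ G.bifs)
    {i : Fin G.N} (hi : i ∈ G.I γ) : M.hBif γ ≤ σ * M.hBdry i (G.endAt i γ) := by
  have : Nonempty {i // i ∈ G.I γ} := ⟨⟨i, hi⟩⟩
  exact ciSup_le fun j => hM.2 γ hγ j.1 j.2 i hi

theorem hInt_le {σ : ℝ} (hM : M.ShapeRegular σ) (hσ : 1 ≤ σ) {i : Fin G.N}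
    {F : Fin (M.n i) × Fin (M.n i)} (hF : F ∈ M.intFaces i) :
    M.hInt i F ≤ σ * M.len i F.1 ∧ M.hInt i F ≤ σ * M.len i F.2 :=
  ⟨max_le (le_mul_of_one_le_left (M.len_pos i _).le hσ) (hM.1 i F hF).2,
    max_le (hM.1 i F hF).1 (le_mul_of_one_le_left (M.len_pos i _).le hσ)⟩

/-! ### Inverse trace inequality -/

theorem abs_kTrace_le {κ : Fin G.N → ℝ → ℝ} (hκ : M.HasTraces κ) {c : ℝ}
    (hc : ∀ i, ∀ᵐ x ∂(volume.restrict (Ioo (G.left i) (G.right i))), |κ i x| ≤ c)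
    (i : Fin G.N) (K : Fin (M.n i)) {x : ℝ} (hx : x ∈ ({M.lo i K, M.hi i K} : Set ℝ)) :
    |M.kTrace κ i K x| ≤ c := by
  have hcl : x ∈ closure (Ioo (M.lo i K) (M.hi i K)) := by
    rw [closure_Ioo (M.lo_lt_hi i K).ne]
    rcases hx with rfl | rfl
    exacts [left_mem_Icc.2 (M.lo_lt_hi i K).le, right_mem_Icc.2 (M.lo_lt_hi i K).le]
  have : (𝓝[Ioo (M.lo i K) (M.hi i K)] x).NeBot := mem_closure_iff_nhdsWithin_neBot.1 hcl
  exact mem_of_tendsto_nhdsWithin_of_ae_mem (s := {y | |y| ≤ c}) isOpen_Ioo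
    (isClosed_le continuous_abs continuous_const) hcl
    (ae_restrict_of_ae_restrict_of_subset (M.Ioo_lo_hi_subset i K) (hc i))
    (tendsto_nhds_limUnder (hκ i K x hx))

/-- The Dirichlet energy of a mesh function on a mesh interval. -/
noncomputable def energy (v : M.V p) (i : Fin G.N) (K : Fin (M.n i)) : ℝ :=
  ∫ x in (M.lo i K)..(M.hi i K), dval v i K x ^ 2

/-- The broken Dirichlet energy of a mesh function on an edge of the network. -/
noncomputable def edgeEnergy (v : M.V p) (i : Fin G.N) : ℝ := ∑ K, energy v i K

theorem energy_nonneg (v : M.V p) (i : Fin G.N) (K : Fin (M.n i)) : 0 ≤ energy v i K :=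
  intervalIntegral.integral_nonneg (M.lo_lt_hi i K).le fun _ _ => sq_nonneg _

theorem edgeEnergy_nonneg (v : M.V p) (i : Fin G.N) : 0 ≤ edgeEnergy v i :=
  Finset.sum_nonneg fun K _ => energy_nonneg v i K

theorem sum_edgeEnergy_nonneg (v : M.V p) : 0 ≤ ∑ i, edgeEnergy v i :=
  Finset.sum_nonneg fun i _ => edgeEnergy_nonneg v i

theorem energy_le_edgeEnergy (v : M.V p) (i : Fin G.N) (K : Fin (M.n i)) :
    energy v i K ≤ edgeEnergy v i :=
  Finset.single_le_sum (f := fun K => energy v i K) (fun K _ => energy_nonneg v i K)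
    (Finset.mem_univ K)

theorem energy_le_sum_edgeEnergy (v : M.V p) (i : Fin G.N) (K : Fin (M.n i)) :
    energy v i K ≤ ∑ i, edgeEnergy v i :=
  (energy_le_edgeEnergy v i K).trans (Finset.single_le_sum (f := fun i => edgeEnergy v i)
    (fun i _ => edgeEnergy_nonneg v i) (Finset.mem_univ i))

/-- The inverse trace inequality for the flux, with constant `C`. -/
def FluxBound (κ : Fin G.N → ℝ → ℝ) (M : Mesh G) (p : ℕ) (C : ℝ) : Prop :=
  ∀ (v : M.V p) (i : Fin G.N) (K : Fin (M.n i)), ∀ x ∈ ({M.lo i K, M.hi i K} : Set ℝ),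
    M.len i K * flux κ v i K x ^ 2 ≤ C * energy v i K

theorem exists_fluxBound {κ : Fin G.N → ℝ → ℝ} {c : ℝ}
    (hc : ∀ i, ∀ᵐ x ∂(volume.restrict (Ioo (G.left i) (G.right i))), |κ i x| ≤ c) (p : ℕ) :
    ∃ C, 0 ≤ C ∧ ∀ M : Mesh G, M.HasTraces κ → FluxBound κ M p C := by
  obtain ⟨C, hC, hinv⟩ := exists_length_mul_eval_sq_le p
  refine ⟨c ^ 2 * C, by positivity, fun M hM v i K x hx => ?_⟩
  have hderiv : (v i K : Polynomial ℝ).derivative ∈ Polynomial.degreeLE ℝ (p : WithBot ℕ) :=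
    Polynomial.mem_degreeLE.2
      (Polynomial.degree_derivative_le.trans (Polynomial.mem_degreeLE.1 (v i K).2))
  have htrace : M.kTrace κ i K x ^ 2 ≤ c ^ 2 :=
    sq_le_sq' (neg_le_of_abs_le (abs_kTrace_le hM hc i K hx))
      (le_of_abs_le (abs_kTrace_le hM hc i K hx))
  have hlen := (M.len_pos i K).le
  calc M.len i K * flux κ v i K x ^ 2
      = M.kTrace κ i K x ^ 2 * (M.len i K * dval v i K x ^ 2) := by rw [flux]; ring
    _ ≤ c ^ 2 * (C * energy v i K) :=
      mul_le_mul htrace (hinv _ hderiv _ _ (M.lo_lt_hi i K) x hx) (by positivity) (sq_nonneg c)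
    _ = c ^ 2 * C * energy v i K := by ring

/-! ### Consistency terms -/

/-- The consistency term of an edge: the fluxes of `w` tested with the jumps of `v`. -/
noncomputable def consEdge (κ : Fin G.N → ℝ → ℝ) (i : Fin G.N) (w v : M.V p) : ℝ :=
  (∑ F ∈ M.intFaces i, avgInt κ w i F * jumpInt v i F)
    + ∑ b ∈ G.bdryFaces i, fluxEnd κ w i b * valEnd v i b

/-- The penalty term of an edge. -/
noncomputable def penEdge (ηF : Fin G.N → ℝ → ℝ) (i : Fin G.N) (v : M.V p) : ℝ :=
  (∑ F ∈ M.intFaces i, ηF i (M.hi i F.1) / M.hInt i F * jumpInt v i F ^ 2)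
    + ∑ b ∈ G.bdryFaces i, ηF i (G.endPt i b) / M.hBdry i b * valEnd v i b ^ 2

/-- The penalty term of the bifurcations. -/
noncomputable def penBif (ηΓ : Fin G.numVert → ℝ) (v : M.V p) : ℝ :=
  ∑ γ ∈ G.bifs, ηΓ γ / M.hBif γ * ∑ ij ∈ G.D γ, jumpBif v γ ij ^ 2

theorem penEdge_nonneg {ηF : Fin G.N → ℝ → ℝ} {i : Fin G.N} (h : ∀ F, 0 ≤ ηF i F) (v : M.V p) :
    0 ≤ penEdge ηF i v :=
  add_nonneg
    (Finset.sum_nonneg fun F _ => mul_nonneg (div_nonneg (h _) (M.hInt_pos i F).le) (sq_nonneg _))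
    (Finset.sum_nonneg fun b _ => mul_nonneg (div_nonneg (h _) (M.hBdry_pos i b).le) (sq_nonneg _))

theorem penBif_nonneg {ηΓ : Fin G.numVert → ℝ} (h : ∀ γ, 0 ≤ ηΓ γ) (v : M.V p) :
    0 ≤ penBif ηΓ v :=
  Finset.sum_nonneg fun _ hγ => mul_nonneg (div_nonneg (h _) (M.hBif_pos hγ).le)
    (Finset.sum_nonneg fun _ _ => sq_nonneg _)

theorem mul_penEdge_one_le {ηF : Fin G.N → ℝ → ℝ} {i : Fin G.N} {η₀ : ℝ} (h : ∀ F, η₀ ≤ ηF i F)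
    (v : M.V p) : η₀ * penEdge (fun _ _ => 1) i v ≤ penEdge ηF i v := by
  rw [penEdge, penEdge, mul_add, Finset.mul_sum, Finset.mul_sum]
  refine add_le_add (Finset.sum_le_sum fun F _ => ?_) (Finset.sum_le_sum fun b _ => ?_)
  · rw [← mul_assoc, mul_one_div]
    have := (M.hInt_pos i F).le
    gcongr
    exact h _
  · rw [← mul_assoc, mul_one_div]
    have := (M.hBdry_pos i b).le
    gcongr
    exact h _

theorem mul_penBif_one_le {ηΓ : Fin G.numVert → ℝ} {η₀ : ℝ} (h : ∀ γ, η₀ ≤ ηΓ γ) (v : M.V p) :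
    η₀ * penBif (fun _ => 1) v ≤ penBif ηΓ v := by
  rw [penBif, penBif, Finset.mul_sum]
  refine Finset.sum_le_sum fun γ hγ => ?_
  rw [← mul_assoc, mul_one_div]
  have hpos := (M.hBif_pos hγ).le
  have : 0 ≤ ∑ ij ∈ G.D γ, jumpBif v γ ij ^ 2 := Finset.sum_nonneg fun _ _ => sq_nonneg _
  gcongr
  exact h _

theorem hInt_mul_avgInt_sq_le {κ : Fin G.N → ℝ → ℝ} {C σ : ℝ} (hC : FluxBound κ M p C)
    (hM : M.ShapeRegular σ) (hσ : 1 ≤ σ) (v : M.V p) {i : Fin G.N}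
    {F : Fin (M.n i) × Fin (M.n i)} (hF : F ∈ M.intFaces i) :
    M.hInt i F * avgInt κ v i F ^ 2 ≤ σ * C / 2 * (energy v i F.1 + energy v i F.2) := by
  obtain ⟨hlen₁, hlen₂⟩ := hInt_le hM hσ hF
  have hflux₁ := hC v i F.1 (M.hi i F.1) (.inr rfl)
  have hflux₂ := hC v i F.2 (M.hi i F.1) (.inl (hi_fst_eq_lo_snd hF))
  have havg : avgInt κ v i F ^ 2 ≤
      1 / 2 * (flux κ v i F.1 (M.hi i F.1) ^ 2 + flux κ v i F.2 (M.hi i F.1) ^ 2) := by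
    rw [avgInt]
    linarith [sq_nonneg (flux κ v i F.1 (M.hi i F.1) - flux κ v i F.2 (M.hi i F.1))]
  have hpos := (M.hInt_pos i F).le
  calc M.hInt i F * avgInt κ v i F ^ 2
      ≤ M.hInt i F *
        (1 / 2 * (flux κ v i F.1 (M.hi i F.1) ^ 2 + flux κ v i F.2 (M.hi i F.1) ^ 2)) := by gcongr
    _ = 1 / 2 * (M.hInt i F * flux κ v i F.1 (M.hi i F.1) ^ 2
        + M.hInt i F * flux κ v i F.2 (M.hi i F.1) ^ 2) := by ring
    _ ≤ 1 / 2 * (σ * M.len i F.1 * flux κ v i F.1 (M.hi i F.1) ^ 2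
        + σ * M.len i F.2 * flux κ v i F.2 (M.hi i F.1) ^ 2) := by gcongr
    _ = σ / 2 * (M.len i F.1 * flux κ v i F.1 (M.hi i F.1) ^ 2
        + M.len i F.2 * flux κ v i F.2 (M.hi i F.1) ^ 2) := by ring
    _ ≤ σ / 2 * (C * energy v i F.1 + C * energy v i F.2) := by gcongr
    _ = σ * C / 2 * (energy v i F.1 + energy v i F.2) := by ring

theorem hBdry_mul_fluxEnd_sq_le {κ : Fin G.N → ℝ → ℝ} {C : ℝ} (hC : FluxBound κ M p C)
    (v : M.V p) (i : Fin G.N) (b : Bool) :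
    M.hBdry i b * fluxEnd κ v i b ^ 2 ≤ C * energy v i (M.endElem i b) := by
  have hnrm : Network.nrm b ^ 2 = 1 := by cases b <;> norm_num [Network.nrm]
  rw [hBdry, fluxEnd, mul_pow, hnrm, mul_one]
  exact hC v i _ _ (M.endPt_mem i b)

theorem sum_avgInt_mul_jumpInt_sq_le {κ : Fin G.N → ℝ → ℝ} {C σ : ℝ} (hC₀ : 0 ≤ C)
    (hC : FluxBound κ M p C) (hM : M.ShapeRegular σ) (hσ : 1 ≤ σ) (v : M.V p) (i : Fin G.N) :
    (∑ F ∈ M.intFaces i, avgInt κ v i F * jumpInt v i F) ^ 2 ≤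
      σ * C * edgeEnergy v i * ∑ F ∈ M.intFaces i, 1 / M.hInt i F * jumpInt v i F ^ 2 := by
  have hjump (F : Fin (M.n i) × Fin (M.n i)) : 0 ≤ 1 / M.hInt i F * jumpInt v i F ^ 2 :=
    mul_nonneg (one_div_nonneg.2 (M.hInt_pos i F).le) (sq_nonneg _)
  have henergy (F : Fin (M.n i) × Fin (M.n i)) :
      0 ≤ σ * C / 2 * (energy v i F.1 + energy v i F.2) := by
    have := add_nonneg (energy_nonneg v i F.1) (energy_nonneg v i F.2)
    positivity
  refine (Finset.sum_sq_le_sum_mul_sum_of_sq_le_mul _ (fun F _ => henergy F) (fun F _ => hjump F)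
    fun F hF => mul_sq_le_of_mul_sq_le (M.hInt_pos i F)
      (hInt_mul_avgInt_sq_le hC hM hσ v hF)).trans ?_
  refine mul_le_mul_of_nonneg_right ?_ (Finset.sum_nonneg fun F _ => hjump F)
  have h₁ := sum_comp_le_sum (fun K => energy_nonneg v i K) (M.injOn_fst_intFaces i)
  have h₂ := sum_comp_le_sum (fun K => energy_nonneg v i K) (M.injOn_snd_intFaces i)
  calc ∑ F ∈ M.intFaces i, σ * C / 2 * (energy v i F.1 + energy v i F.2)
      = σ * C / 2 * (∑ F ∈ M.intFaces i, energy v i F.1 + ∑ F ∈ M.intFaces i, energy v i F.2) := by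
        rw [← Finset.mul_sum, Finset.sum_add_distrib]
    _ ≤ σ * C / 2 * (edgeEnergy v i + edgeEnergy v i) := by gcongr <;> assumption
    _ = σ * C * edgeEnergy v i := by ring

theorem sum_fluxEnd_mul_valEnd_sq_le {κ : Fin G.N → ℝ → ℝ} {C : ℝ} (hC₀ : 0 ≤ C)
    (hC : FluxBound κ M p C) (v : M.V p) (i : Fin G.N) :
    (∑ b ∈ G.bdryFaces i, fluxEnd κ v i b * valEnd v i b) ^ 2 ≤
      2 * C * edgeEnergy v i * ∑ b ∈ G.bdryFaces i, 1 / M.hBdry i b * valEnd v i b ^ 2 := by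
  have hE : 0 ≤ C * edgeEnergy v i := mul_nonneg hC₀ (edgeEnergy_nonneg v i)
  have hval (b : Bool) : 0 ≤ 1 / M.hBdry i b * valEnd v i b ^ 2 :=
    mul_nonneg (one_div_nonneg.2 (M.hBdry_pos i b).le) (sq_nonneg _)
  refine (Finset.sum_sq_le_sum_mul_sum_of_sq_le_mul _ (fun b _ => hE) (fun b _ => hval b)
    fun b _ => mul_sq_le_of_mul_sq_le (M.hBdry_pos i b) ((hBdry_mul_fluxEnd_sq_le hC v i b).trans
      (mul_le_mul_of_nonneg_left (energy_le_edgeEnergy v i _) hC₀))).trans ?_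
  refine mul_le_mul_of_nonneg_right ?_ (Finset.sum_nonneg fun b _ => hval b)
  have hcard : ((G.bdryFaces i).card : ℝ) ≤ 2 := by
    exact_mod_cast (Finset.card_le_univ _).trans Fintype.card_bool.le
  rw [Finset.sum_const, nsmul_eq_mul, mul_assoc]
  exact mul_le_mul_of_nonneg_right hcard hE

theorem consEdge_self_sq_le {κ : Fin G.N → ℝ → ℝ} {C σ : ℝ} (hC₀ : 0 ≤ C)
    (hC : FluxBound κ M p C) (hM : M.ShapeRegular σ) (hσ : 1 ≤ σ) (v : M.V p) (i : Fin G.N) :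
    consEdge κ i v v ^ 2 ≤ 3 * σ * C * (edgeEnergy v i * penEdge (fun _ _ => 1) i v) := by
  have hE := edgeEnergy_nonneg v i
  calc consEdge κ i v v ^ 2
      ≤ (σ * C * edgeEnergy v i + 2 * C * edgeEnergy v i) * penEdge (fun _ _ => 1) i v :=
        sq_add_le_add_mul_add (by positivity) (by positivity)
          (Finset.sum_nonneg fun F _ =>
            mul_nonneg (one_div_nonneg.2 (M.hInt_pos i F).le) (sq_nonneg _))
          (Finset.sum_nonneg fun b _ =>
            mul_nonneg (one_div_nonneg.2 (M.hBdry_pos i b).le) (sq_nonneg _))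
          (sum_avgInt_mul_jumpInt_sq_le hC₀ hC hM hσ v i) (sum_fluxEnd_mul_valEnd_sq_le hC₀ hC v i)
    _ ≤ (σ * C * edgeEnergy v i + 2 * (σ * C) * edgeEnergy v i) * penEdge (fun _ _ => 1) i v := by
        have hpen := penEdge_nonneg (ηF := fun _ _ => 1) (i := i) (fun _ => zero_le_one) v
        gcongr
        exact le_mul_of_one_le_left hC₀ hσ
    _ = 3 * σ * C * (edgeEnergy v i * penEdge (fun _ _ => 1) i v) := by ring

theorem hBif_mul_avgBif_sq_le {κ : Fin G.N → ℝ → ℝ} {C σ : ℝ} (hC₀ : 0 ≤ C)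
    (hC : FluxBound κ M p C) (hM : M.ShapeRegular σ) (hσ : 0 ≤ σ) (v : M.V p)
    {γ : Fin G.numVert} (hγ : γ ∈ G.bifs) {ij : Fin G.N × Fin G.N} (hij : ij ∈ G.D γ) :
    M.hBif γ * avgBif κ v γ ij ^ 2 ≤ 4 * σ * C * ∑ i, edgeEnergy v i := by
  obtain ⟨hi, hj⟩ := Finset.mem_product.1 (Finset.mem_filter.1 hij).1
  have hflux {i : Fin G.N} (hi : i ∈ G.I γ) :
      M.hBif γ * fluxEnd κ v i (G.endAt i γ) ^ 2 ≤ σ * C * ∑ i, edgeEnergy v i := calc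
    M.hBif γ * fluxEnd κ v i (G.endAt i γ) ^ 2
      ≤ σ * M.hBdry i (G.endAt i γ) * fluxEnd κ v i (G.endAt i γ) ^ 2 := by
        gcongr
        exact hBif_le hM hγ hi
    _ = σ * (M.hBdry i (G.endAt i γ) * fluxEnd κ v i (G.endAt i γ) ^ 2) := by ring
    _ ≤ σ * (C * ∑ i, edgeEnergy v i) :=
        mul_le_mul_of_nonneg_left ((hBdry_mul_fluxEnd_sq_le hC v i _).trans
          (mul_le_mul_of_nonneg_left (energy_le_sum_edgeEnergy v i _) hC₀)) hσ
    _ = σ * C * ∑ i, edgeEnergy v i := by ring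
  have havg : avgBif κ v γ ij ^ 2 ≤ 2 * (fluxEnd κ v ij.1 (G.endAt ij.1 γ) ^ 2
      + fluxEnd κ v ij.2 (G.endAt ij.2 γ) ^ 2) := by
    rw [avgBif]
    linarith [sq_nonneg (fluxEnd κ v ij.1 (G.endAt ij.1 γ) + fluxEnd κ v ij.2 (G.endAt ij.2 γ))]
  linarith [mul_le_mul_of_nonneg_left havg (M.hBif_pos hγ).le, hflux hi, hflux hj]

theorem avgJump_self_sq_le {κ : Fin G.N → ℝ → ℝ} {C σ : ℝ} (hC₀ : 0 ≤ C)
    (hC : FluxBound κ M p C) (hM : M.ShapeRegular σ) (hσ : 0 ≤ σ) (v : M.V p)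
    {γ : Fin G.numVert} (hγ : γ ∈ G.bifs) :
    avgJump κ v v γ ^ 2 ≤ 4 * G.N ^ 2 * σ * C * (∑ i, edgeEnergy v i)
      * (1 / M.hBif γ * ∑ ij ∈ G.D γ, jumpBif v γ ij ^ 2) := by
  have hE : 0 ≤ 4 * σ * C * ∑ i, edgeEnergy v i := by
    have := sum_edgeEnergy_nonneg v
    positivity
  have hjump (ij : Fin G.N × Fin G.N) : 0 ≤ 1 / M.hBif γ * jumpBif v γ ij ^ 2 :=
    mul_nonneg (one_div_nonneg.2 (M.hBif_pos hγ).le) (sq_nonneg _)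
  have hinv : (1 / ((G.I γ).card : ℝ)) ^ 2 ≤ 1 := by
    refine pow_le_one₀ (by positivity) (div_le_one_of_le₀ ?_ (Nat.cast_nonneg _))
    exact_mod_cast Finset.card_pos.2 (I_nonempty hγ)
  have hcard : ((G.D γ).card : ℝ) ≤ (G.N : ℝ) ^ 2 := by
    have h := Finset.card_le_univ (G.D γ)
    rw [Fintype.card_prod, Fintype.card_fin, ← sq] at h
    exact_mod_cast h
  calc avgJump κ v v γ ^ 2
      = (1 / ((G.I γ).card : ℝ)) ^ 2 * (∑ ij ∈ G.D γ, avgBif κ v γ ij * jumpBif v γ ij) ^ 2 := by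
        rw [avgJump, mul_pow]
    _ ≤ (∑ ij ∈ G.D γ, avgBif κ v γ ij * jumpBif v γ ij) ^ 2 :=
        mul_le_of_le_one_left (sq_nonneg _) hinv
    _ ≤ (∑ ij ∈ G.D γ, 4 * σ * C * ∑ i, edgeEnergy v i)
          * ∑ ij ∈ G.D γ, 1 / M.hBif γ * jumpBif v γ ij ^ 2 :=
        Finset.sum_sq_le_sum_mul_sum_of_sq_le_mul _ (fun _ _ => hE) (fun ij _ => hjump ij)
          fun ij hij => mul_sq_le_of_mul_sq_le (M.hBif_pos hγ)
            (hBif_mul_avgBif_sq_le hC₀ hC hM hσ v hγ hij)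
    _ ≤ G.N ^ 2 * (4 * σ * C * ∑ i, edgeEnergy v i)
          * ∑ ij ∈ G.D γ, 1 / M.hBif γ * jumpBif v γ ij ^ 2 := by
        rw [Finset.sum_const, nsmul_eq_mul]
        exact mul_le_mul_of_nonneg_right (mul_le_mul_of_nonneg_right hcard hE)
          (Finset.sum_nonneg fun ij _ => hjump ij)
    _ = _ := by rw [← Finset.mul_sum]; ring

theorem sum_avgJump_self_sq_le {κ : Fin G.N → ℝ → ℝ} {C σ : ℝ} (hC₀ : 0 ≤ C)
    (hC : FluxBound κ M p C) (hM : M.ShapeRegular σ) (hσ : 0 ≤ σ) (v : M.V p) :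
    (∑ γ ∈ G.bifs, avgJump κ v v γ) ^ 2 ≤
      4 * G.N ^ 2 * G.numVert * σ * C * ((∑ i, edgeEnergy v i) * penBif (fun _ => 1) v) := by
  have hE : 0 ≤ 4 * G.N ^ 2 * σ * C * ∑ i, edgeEnergy v i := by
    have := sum_edgeEnergy_nonneg v
    positivity
  have hcard : (G.bifs.card : ℝ) ≤ G.numVert := by
    exact_mod_cast (Finset.card_le_univ _).trans (Fintype.card_fin _).le
  calc (∑ γ ∈ G.bifs, avgJump κ v v γ) ^ 2
      ≤ (∑ γ ∈ G.bifs, 4 * G.N ^ 2 * σ * C * ∑ i, edgeEnergy v i) * penBif (fun _ => 1) v :=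
        Finset.sum_sq_le_sum_mul_sum_of_sq_le_mul _ (fun _ _ => hE)
          (fun γ hγ => mul_nonneg (one_div_nonneg.2 (M.hBif_pos hγ).le)
            (Finset.sum_nonneg fun _ _ => sq_nonneg _))
          fun γ hγ => avgJump_self_sq_le hC₀ hC hM hσ v hγ
    _ ≤ G.numVert * (4 * G.N ^ 2 * σ * C * ∑ i, edgeEnergy v i) * penBif (fun _ => 1) v := by
        rw [Finset.sum_const, nsmul_eq_mul]
        exact mul_le_mul_of_nonneg_right (mul_le_mul_of_nonneg_right hcard hE)
          (penBif_nonneg (fun _ => zero_le_one) v)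
    _ = _ := by ring

/-! ### Coercivity -/

theorem dgNorm_sq {ηF : Fin G.N → ℝ → ℝ} {ηΓ : Fin G.numVert → ℝ} (hF : ∀ i F, 0 ≤ ηF i F)
    (hΓ : ∀ γ, 0 ≤ ηΓ γ) (v : M.V p) :
    dgNorm ηF ηΓ v ^ 2 = ∑ i, edgeEnergy v i + (∑ i, penEdge ηF i v + penBif ηΓ v) := by
  have hsum : ∑ i, dgSqEdge ηF i v = ∑ i, edgeEnergy v i + ∑ i, penEdge ηF i v := by
    simp only [← Finset.sum_add_distrib, dgSqEdge, penEdge, edgeEnergy, energy, add_assoc]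
  rw [← add_assoc, ← hsum]
  refine Real.sq_sqrt ?_
  rw [hsum]
  exact add_nonneg (add_nonneg (sum_edgeEnergy_nonneg v)
    (Finset.sum_nonneg fun i _ => penEdge_nonneg (hF i) v)) (penBif_nonneg hΓ v)

theorem aEdge_self (κ : Fin G.N → ℝ → ℝ) (ε : Fin G.N → ℝ) (ηF : Fin G.N → ℝ → ℝ) (i : Fin G.N)
    (v : M.V p) : aEdge κ ε ηF i v v =
      (∑ K, ∫ x in (M.lo i K)..(M.hi i K), κ i x * dval v i K x * dval v i K x)
        - (1 + ε i) * consEdge κ i v v + penEdge ηF i v := by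
  simp only [aEdge, consEdge, penEdge, sq]
  ring

theorem a_self (κ : Fin G.N → ℝ → ℝ) (ε : Fin G.N → ℝ) (ε₀ : ℝ) (ηF : Fin G.N → ℝ → ℝ)
    (ηΓ : Fin G.numVert → ℝ) (v : M.V p) :
    a κ ε ε₀ ηF ηΓ v v =
      ∑ i, ((∑ K, ∫ x in (M.lo i K)..(M.hi i K), κ i x * dval v i K x * dval v i K x)
        - (1 + ε i) * consEdge κ i v v + penEdge ηF i v)
      - (1 + ε₀) * (∑ γ ∈ G.bifs, avgJump κ v v γ) + penBif ηΓ v := by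
  simp only [a, aEdge_self, penBif, jumpJump, ← sq]
  ring

theorem continuous_val (v : M.V p) (i : Fin G.N) (K : Fin (M.n i)) : Continuous (val v i K) :=
  (v i K : Polynomial ℝ).continuous

theorem continuous_dval (v : M.V p) (i : Fin G.N) (K : Fin (M.n i)) : Continuous (dval v i K) :=
  (v i K : Polynomial ℝ).derivative.continuous

theorem integrableOn_coeff_mul (M : Mesh G) {κ : Fin G.N → ℝ → ℝ} (hκ : G.IsCoefficient κ)
    (i : Fin G.N) (K : Fin (M.n i)) {f : ℝ → ℝ} (hf : Continuous f) :
    IntegrableOn (fun x => κ i x * f x) (Ioc (M.lo i K) (M.hi i K)) := by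
  obtain ⟨b, c, -, -, hc⟩ := hκ.exists_bounds
  exact Integrable.bdd_mul hf.integrableOn_Ioc (hκ.1 i).aestronglyMeasurable
    (M.ae_Ioc_of_ae_edge K (hc i))

theorem mul_energy_le {κ : Fin G.N → ℝ → ℝ} (hκ : G.IsCoefficient κ) {b : ℝ}
    (hb : ∀ i, ∀ᵐ x ∂(volume.restrict (Ioo (G.left i) (G.right i))), b ≤ κ i x)
    (v : M.V p) (i : Fin G.N) (K : Fin (M.n i)) :
    b * energy v i K ≤ ∫ x in (M.lo i K)..(M.hi i K), κ i x * dval v i K x * dval v i K x := by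
  rw [energy, intervalIntegral.integral_of_le (M.lo_lt_hi i K).le,
    intervalIntegral.integral_of_le (M.lo_lt_hi i K).le, ← integral_const_mul]
  simp_rw [mul_assoc]
  have hd := continuous_dval v i K
  refine integral_mono_ae ((hd.pow 2).const_mul b).integrableOn_Ioc
    (M.integrableOn_coeff_mul hκ i K (hd.mul hd)) ?_
  filter_upwards [M.ae_Ioc_of_ae_edge K (hb i)] with x hx
  rw [sq]
  exact mul_le_mul_of_nonneg_right hx (mul_self_nonneg _)

theorem exists_coercive {κ : Fin G.N → ℝ → ℝ} (hκ : G.IsCoefficient κ) (p : ℕ) (σ e : ℝ) :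
    ∃ η₀ > 0, ∃ C > 0, ∀ M : Mesh G, M.ShapeRegular σ → M.HasTraces κ →
      ∀ ε ε₀ ηF ηΓ, AdmissibleParams e η₀ ε ε₀ ηF ηΓ →
        ∀ v : M.V p, dgNorm ηF ηΓ v ^ 2 ≤ C * a κ ε ε₀ ηF ηΓ v v := by
  obtain ⟨b, c, hb₀, hb, hc⟩ := hκ.exists_bounds
  obtain ⟨B, hB, hflux⟩ := exists_fluxBound hc p
  set s := max σ 1
  have hs : 1 ≤ s := le_max_right σ 1
  have hR₁ : 0 ≤ 3 * s * B := by positivity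
  have hR₂ : 0 ≤ 4 * G.N ^ 2 * G.numVert * s * B := by positivity
  set R := 3 * s * B + 4 * G.N ^ 2 * G.numVert * s * B
  obtain ⟨η₀, hη₀, hbη⟩ := exists_pos_le_mul hb₀ (4 * (1 + e) ^ 2 * R)
  refine ⟨η₀, hη₀, 2 / b + 4 / 3, by positivity, fun M hM hT ε ε₀ ηF ηΓ hparams v => ?_⟩
  have hM' := hM.mono (le_max_left σ 1)
  have hF i F := (hparams.pos hη₀ i F).le
  have hΓ γ := (hparams.bif_pos hη₀ γ).le
  have hE i := edgeEnergy_nonneg v i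
  have hP i := penEdge_nonneg (M := M) (ηF := fun _ _ => 1) (i := i) (fun _ => zero_le_one) v
  have hPΓ := penBif_nonneg (M := M) (ηΓ := fun _ => 1) (fun _ => zero_le_one) v
  have hcons i : consEdge κ i v v ^ 2 ≤ R * (edgeEnergy v i * penEdge (fun _ _ => 1) i v) :=
    (consEdge_self_sq_le hB (hflux M hT) hM' hs v i).trans
      (mul_le_mul_of_nonneg_right (le_add_of_nonneg_right hR₂) (mul_nonneg (hE i) (hP i)))
  have hbif : (∑ γ ∈ G.bifs, avgJump κ v v γ) ^ 2 ≤
      R * ((∑ i, edgeEnergy v i) * penBif (fun _ => 1) v) :=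
    (sum_avgJump_self_sq_le hB (hflux M hT) hM' (zero_le_one.trans hs) v).trans
      (mul_le_mul_of_nonneg_right (le_add_of_nonneg_left hR₁)
        (mul_nonneg (sum_edgeEnergy_nonneg v) hPΓ))
  rw [dgNorm_sq hF hΓ, a_self]
  refine energy_add_penalty_le hb₀ hbη hE hP (fun i => penEdge_nonneg (hF i) v) hPΓ
    (penBif_nonneg hΓ v) (fun i => ?_) hcons hbif hparams.abs_le hparams.abs_le₀
    (fun i hi => mul_penEdge_one_le (hparams.le_of_ne i hi) v)
    (mul_penBif_one_le hparams.le_bif v)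
  rw [edgeEnergy, Finset.mul_sum]
  exact Finset.sum_le_sum fun K _ => mul_energy_le hκ hb v i K

/-! ### Bilinearity -/

theorem isLinearMap_val (i : Fin G.N) (K : Fin (M.n i)) (x : ℝ) :
    IsLinearMap ℝ fun v : M.V p => val v i K x :=
  ⟨fun u v => by simp [val], fun r v => by simp [val]⟩

theorem isLinearMap_dval (i : Fin G.N) (K : Fin (M.n i)) (x : ℝ) :
    IsLinearMap ℝ fun v : M.V p => dval v i K x :=
  ⟨fun u v => by simp [dval], fun r v => by simp [dval]⟩

theorem isLinearMap_flux (κ : Fin G.N → ℝ → ℝ) (i : Fin G.N) (K : Fin (M.n i)) (x : ℝ) :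
    IsLinearMap ℝ fun v : M.V p => flux κ v i K x :=
  isLinearMap_const_mul (isLinearMap_dval i K x) _

theorem isLinearMap_jumpInt (i : Fin G.N) (F : Fin (M.n i) × Fin (M.n i)) :
    IsLinearMap ℝ fun v : M.V p => jumpInt v i F :=
  isLinearMap_sub (isLinearMap_val _ _ _) (isLinearMap_val _ _ _)

theorem isLinearMap_avgInt (κ : Fin G.N → ℝ → ℝ) (i : Fin G.N) (F : Fin (M.n i) × Fin (M.n i)) :
    IsLinearMap ℝ fun v : M.V p => avgInt κ v i F :=
  isLinearMap_add (isLinearMap_const_mul (isLinearMap_flux _ _ _ _) _)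
    (isLinearMap_const_mul (isLinearMap_flux _ _ _ _) _)

theorem isLinearMap_valEnd (i : Fin G.N) (b : Bool) :
    IsLinearMap ℝ fun v : M.V p => valEnd v i b :=
  isLinearMap_val _ _ _

theorem isLinearMap_fluxEnd (κ : Fin G.N → ℝ → ℝ) (i : Fin G.N) (b : Bool) :
    IsLinearMap ℝ fun v : M.V p => fluxEnd κ v i b :=
  isLinearMap_mul_const (isLinearMap_flux _ _ _ _) _

theorem isLinearMap_jumpBif (γ : Fin G.numVert) (ij : Fin G.N × Fin G.N) :
    IsLinearMap ℝ fun v : M.V p => jumpBif v γ ij :=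
  isLinearMap_sub (isLinearMap_valEnd _ _) (isLinearMap_valEnd _ _)

theorem isLinearMap_avgBif (κ : Fin G.N → ℝ → ℝ) (γ : Fin G.numVert) (ij : Fin G.N × Fin G.N) :
    IsLinearMap ℝ fun v : M.V p => avgBif κ v γ ij :=
  isLinearMap_sub (isLinearMap_fluxEnd _ _ _) (isLinearMap_fluxEnd _ _ _)

theorem isBilin_integral_flux {κ : Fin G.N → ℝ → ℝ} (hκ : G.IsCoefficient κ) (i : Fin G.N)
    (K : Fin (M.n i)) : IsBilin fun w v : M.V p =>
      ∫ x in (M.lo i K)..(M.hi i K), κ i x * dval w i K x * dval v i K x := by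
  simp_rw [intervalIntegral.integral_of_le (M.lo_lt_hi i K).le]
  refine .integral (fun x => .mul (isLinearMap_const_mul (isLinearMap_dval i K x) _)
    (isLinearMap_dval i K x)) fun w v => ?_
  simp_rw [mul_assoc]
  exact M.integrableOn_coeff_mul hκ i K ((continuous_dval w i K).mul (continuous_dval v i K))

theorem isBilin_aEdge {κ : Fin G.N → ℝ → ℝ} (hκ : G.IsCoefficient κ) (ε : Fin G.N → ℝ)
    (ηF : Fin G.N → ℝ → ℝ) (i : Fin G.N) : IsBilin (aEdge (M := M) (p := p) κ ε ηF i) := by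
  have hint : IsBilin fun w v : M.V p => ∑ F ∈ M.intFaces i, avgInt κ w i F * jumpInt v i F :=
    .sum _ fun F _ => .mul (isLinearMap_avgInt κ i F) (isLinearMap_jumpInt i F)
  have hbdry : IsBilin fun w v : M.V p => ∑ b ∈ G.bdryFaces i, fluxEnd κ w i b * valEnd v i b :=
    .sum _ fun b _ => .mul (isLinearMap_fluxEnd κ i b) (isLinearMap_valEnd i b)
  have hpenInt : IsBilin fun w v : M.V p =>
      ∑ F ∈ M.intFaces i, ηF i (M.hi i F.1) / M.hInt i F * (jumpInt w i F * jumpInt v i F) :=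
    .sum _ fun F _ => .const_mul (.mul (isLinearMap_jumpInt i F) (isLinearMap_jumpInt i F)) _
  have hpenBdry : IsBilin fun w v : M.V p =>
      ∑ b ∈ G.bdryFaces i, ηF i (G.endPt i b) / M.hBdry i b * (valEnd w i b * valEnd v i b) :=
    .sum _ fun b _ => .const_mul (.mul (isLinearMap_valEnd i b) (isLinearMap_valEnd i b)) _
  exact (((((IsBilin.sum _ fun K _ => isBilin_integral_flux hκ i K).sub hint).sub
    (hint.swap.const_mul _)).add hpenInt).add hpenBdry).sub hbdry |>.sub (hbdry.swap.const_mul _)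

theorem isBilin_a {κ : Fin G.N → ℝ → ℝ} (hκ : G.IsCoefficient κ) (ε : Fin G.N → ℝ) (ε₀ : ℝ)
    (ηF : Fin G.N → ℝ → ℝ) (ηΓ : Fin G.numVert → ℝ) :
    IsBilin (a (M := M) (p := p) κ ε ε₀ ηF ηΓ) := by
  have hcons : IsBilin fun w v : M.V p => ∑ γ ∈ G.bifs, avgJump κ w v γ :=
    .sum _ fun γ _ => .const_mul
      (.sum _ fun ij _ => .mul (isLinearMap_avgBif κ γ ij) (isLinearMap_jumpBif γ ij)) _
  have hpen : IsBilin fun w v : M.V p => ∑ γ ∈ G.bifs, ηΓ γ / M.hBif γ * jumpJump w v γ :=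
    .sum _ fun γ _ => .const_mul
      (.sum _ fun ij _ => .mul (isLinearMap_jumpBif γ ij) (isLinearMap_jumpBif γ ij)) _
  exact ((IsBilin.sum _ fun i _ => isBilin_aEdge hκ ε ηF i).sub hcons).sub
    (hcons.swap.const_mul _) |>.add hpen

theorem isLinearMap_load {f : Fin G.N → ℝ → ℝ}
    (hf : ∀ i, IntegrableOn (f i) (Ioo (G.left i) (G.right i))) :
    IsLinearMap ℝ fun v : M.V p => load f v := by
  refine isLinearMap_sum _ fun i _ => isLinearMap_sum _ fun K _ => ?_
  simp_rw [intervalIntegral.integral_of_le (M.lo_lt_hi i K).le, integral_Ioc_eq_integral_Ioo]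
  refine isLinearMap_integral (fun x => isLinearMap_const_mul (isLinearMap_val i K x) _) fun v => ?_
  exact ((hf i).mono_set (M.Ioo_lo_hi_subset i K)).mul_continuousOn_of_subset
    (continuous_val v i K).continuousOn measurableSet_Ioo isCompact_Icc Ioo_subset_Icc_self

/-! ### Definiteness -/

theorem exists_eq_C_of_energy_eq_zero {v : M.V p} {i : Fin G.N} {K : Fin (M.n i)}
    (h : energy v i K = 0) : ∃ k, (v i K : Polynomial ℝ) = Polynomial.C k := by
  have hd := (continuous_dval v i K).pow 2
  rw [energy, intervalIntegral.integral_of_le (M.lo_lt_hi i K).le] at h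
  have hzero := eqOn_zero_of_setIntegral_eq_zero isOpen_Ioo Ioo_subset_Ioc_self hd.continuousOn
    (fun x => sq_nonneg _) hd.integrableOn_Ioc h
  have hderiv : (v i K : Polynomial ℝ).derivative = 0 :=
    Polynomial.eq_zero_of_infinite_isRoot _ ((Ioo_infinite (M.lo_lt_hi i K)).mono fun x hx =>
      (pow_eq_zero_iff two_ne_zero).1 (hzero hx))
  exact ⟨_, Polynomial.eq_C_of_natDegree_eq_zero (Polynomial.derivative_eq_zero.1 hderiv)⟩

theorem jumpInt_eq_zero_and_valEnd_eq_zero_of_penEdge_eq_zero {ηF : Fin G.N → ℝ → ℝ} {i : Fin G.N}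
    (hF : ∀ F, 0 < ηF i F) {v : M.V p} (h : penEdge ηF i v = 0) :
    (∀ F ∈ M.intFaces i, jumpInt v i F = 0) ∧ ∀ b ∈ G.bdryFaces i, valEnd v i b = 0 := by
  have hint (F : Fin (M.n i) × Fin (M.n i)) : 0 < ηF i (M.hi i F.1) / M.hInt i F :=
    div_pos (hF _) (M.hInt_pos i F)
  have hbdry (b : Bool) : 0 < ηF i (G.endPt i b) / M.hBdry i b := div_pos (hF _) (M.hBdry_pos i b)
  obtain ⟨hsum, hsum'⟩ := (add_eq_zero_iff_of_nonneg
    (Finset.sum_nonneg fun F _ => mul_nonneg (hint F).le (sq_nonneg _))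
    (Finset.sum_nonneg fun b _ => mul_nonneg (hbdry b).le (sq_nonneg _))).1 h
  exact ⟨fun F => eq_zero_of_sum_mul_sq_eq_zero (fun F _ => hint F) hsum,
    fun b => eq_zero_of_sum_mul_sq_eq_zero (fun b _ => hbdry b) hsum'⟩

theorem jumpBif_eq_zero_of_penBif_eq_zero {ηΓ : Fin G.numVert → ℝ} (hΓ : ∀ γ, 0 < ηΓ γ) {v : M.V p}
    (h : penBif ηΓ v = 0) {γ : Fin G.numVert} (hγ : γ ∈ G.bifs) {ij : Fin G.N × Fin G.N}
    (hij : ij ∈ G.D γ) : jumpBif v γ ij = 0 := by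
  have hweight {γ : Fin G.numVert} (hγ : γ ∈ G.bifs) : 0 < ηΓ γ / M.hBif γ :=
    div_pos (hΓ γ) (M.hBif_pos hγ)
  have hsum := (Finset.sum_eq_zero_iff_of_nonneg fun γ hγ =>
    mul_nonneg (hweight hγ).le (Finset.sum_nonneg fun _ _ => sq_nonneg _)).1 h γ hγ
  rw [Finset.mul_sum] at hsum
  exact eq_zero_of_sum_mul_sq_eq_zero (fun _ _ => hweight hγ) hsum hij

theorem exists_val_eq_of_energy_eq_zero {v : M.V p} {i : Fin G.N} (hE : ∀ K, energy v i K = 0)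
    (hjump : ∀ F ∈ M.intFaces i, jumpInt v i F = 0) : ∃ k, ∀ K x, val v i K x = k := by
  choose k hk using fun K => exists_eq_C_of_energy_eq_zero (hE K)
  have hval (K : Fin (M.n i)) (x : ℝ) : val v i K x = k K := by rw [val, hk, Polynomial.eval_C]
  refine ⟨k ⟨0, M.n_pos i⟩, fun K x => (hval K x).trans ?_⟩
  obtain ⟨m, hm⟩ := K
  induction m with
  | zero => rfl
  | succ m ih =>
    have hF := hjump (⟨m, by lia⟩, ⟨m + 1, hm⟩) (Finset.mem_filter.2 ⟨Finset.mem_univ _, rfl⟩)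
    rw [jumpInt, hval, hval, sub_eq_zero] at hF
    rw [← hF, ih]

theorem eq_zero_of_dgNorm_eq_zero (hG : G.ReachesBoundary) {ηF : Fin G.N → ℝ → ℝ}
    {ηΓ : Fin G.numVert → ℝ} (hF : ∀ i F, 0 < ηF i F) (hΓ : ∀ γ, 0 < ηΓ γ) {v : M.V p}
    (hv : dgNorm ηF ηΓ v = 0) : v = 0 := by
  have hP i := penEdge_nonneg (M := M) (fun F => (hF i F).le) v
  have hPsum : 0 ≤ ∑ i, penEdge ηF i v := Finset.sum_nonneg fun i _ => hP i
  have hPΓ := penBif_nonneg (M := M) (fun γ => (hΓ γ).le) v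
  have hsq : dgNorm ηF ηΓ v ^ 2 = 0 := by rw [hv, zero_pow two_ne_zero]
  rw [dgNorm_sq (fun i F => (hF i F).le) (fun γ => (hΓ γ).le), add_eq_zero_iff_of_nonneg
    (sum_edgeEnergy_nonneg v) (add_nonneg hPsum hPΓ), add_eq_zero_iff_of_nonneg hPsum hPΓ] at hsq
  obtain ⟨hE₀, hP₀, hΓ₀⟩ := hsq
  have henergy (i : Fin G.N) (K : Fin (M.n i)) : energy v i K = 0 :=
    le_antisymm (hE₀ ▸ energy_le_sum_edgeEnergy v i K) (energy_nonneg v i K)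
  have hjump i := jumpInt_eq_zero_and_valEnd_eq_zero_of_penEdge_eq_zero (hF i)
    ((Finset.sum_eq_zero_iff_of_nonneg fun i _ => hP i).1 hP₀ i (Finset.mem_univ i))
  choose k hk using fun i => exists_val_eq_of_energy_eq_zero (henergy i) (hjump i).1
  have hbif {γ : Fin G.numVert} (hγ : γ ∈ G.bifs) {i j : Fin G.N} (hi : i ∈ G.I γ)
      (hj : j ∈ G.I γ) (hij : i < j) : k i = k j := by
    have h := jumpBif_eq_zero_of_penBif_eq_zero hΓ hΓ₀ hγ (ij := (i, j))
      (Finset.mem_filter.2 ⟨Finset.mk_mem_product hi hj, hij⟩)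
    rwa [jumpBif, valEnd, valEnd, hk, hk, sub_eq_zero] at h
  have hlink (i j : Fin G.N) : G.Linked i j → k i = k j := by
    rintro ⟨γ, hγ, hi, hj⟩
    rcases lt_trichotomy i j with hij | rfl | hij
    exacts [hbif hγ hi hj hij, rfl, (hbif hγ hj hi hij).symm]
  have hbdry (j : Fin G.N) : (∃ b, G.vert j b ∉ G.bifs) → k j = 0 := by
    rintro ⟨b, hb⟩
    exact (hk j _ _).symm.trans ((hjump j).2 b (Finset.mem_filter.2 ⟨Finset.mem_univ _, hb⟩))
  funext i K
  refine Subtype.ext (Polynomial.funext fun x => ?_)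
  exact (hk i K x).trans ((eq_zero_of_reaches hG hlink hbdry i).trans Polynomial.eval_zero.symm)

theorem existsUnique_of_coercive {κ : Fin G.N → ℝ → ℝ} (hκ : G.IsCoefficient κ)
    (hG : G.ReachesBoundary) {ε : Fin G.N → ℝ} {ε₀ : ℝ} {ηF : Fin G.N → ℝ → ℝ}
    {ηΓ : Fin G.numVert → ℝ} (hF : ∀ i F, 0 < ηF i F) (hΓ : ∀ γ, 0 < ηΓ γ) {C : ℝ}
    (hcoer : ∀ v : M.V p, dgNorm ηF ηΓ v ^ 2 ≤ C * a κ ε ε₀ ηF ηΓ v v) {f : Fin G.N → ℝ → ℝ}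
    (hf : ∀ i, IntegrableOn (f i) (Ioo (G.left i) (G.right i))) :
    ∃! u : M.V p, ∀ v : M.V p, a κ ε ε₀ ηF ηΓ u v = load f v := by
  have := finite_degreeLE p
  refine (isBilin_a hκ ε ε₀ ηF ηΓ).existsUnique_of_definite (fun u hu => ?_) (isLinearMap_load hf)
  refine eq_zero_of_dgNorm_eq_zero hG hF hΓ (sq_nonpos_iff _ |>.1 ?_)
  simpa [hu] using hcoer u

end EdgeDG.Mesh

/-! ## Polynomials of several variables on balls -/

section BallPolynomials

open MvPolynomial

variable {ι : Type*}

theorem pderiv_mem_restrictTotalDegree {R : Type*} [CommSemiring R] {q : MvPolynomial ι R} {p : ℕ}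
    (hq : q ∈ restrictTotalDegree ι R p) (l : ι) : pderiv l q ∈ restrictTotalDegree ι R p := by
  classical
  rw [mem_restrictTotalDegree] at hq ⊢
  refine Finset.sup_le fun m hm => ?_
  rw [mem_support_iff, coeff_pderiv] at hm
  have hdeg := le_totalDegree (mem_support_iff.2 (left_ne_zero_of_mul hm))
  rw [Finsupp.sum_add_index' (fun _ => rfl) fun _ _ _ => rfl] at hdeg
  exact (Nat.le_add_right _ _).trans (hdeg.trans hq)

theorem eq_C_of_pderiv_eq_zero {R : Type*} [CommSemiring R] [NoZeroDivisors R] [CharZero R]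
    {q : MvPolynomial ι R} (h : ∀ l, pderiv l q = 0) : q = C (coeff 0 q) := by
  classical
  ext m
  rw [coeff_C]
  split_ifs with hm
  · rw [hm]
  · obtain ⟨l, hl⟩ := Finsupp.ne_iff.1 (Ne.symm hm)
    have hsub : m - Finsupp.single l 1 + Finsupp.single l 1 = m :=
      tsub_add_cancel_of_le (Finsupp.single_le_iff.2 (Nat.one_le_iff_ne_zero.2 hl))
    have hcoeff := coeff_pderiv (i := l) q (m - Finsupp.single l 1)
    rw [h, coeff_zero, hsub] at hcoeff
    exact (mul_eq_zero.1 hcoeff.symm).resolve_right (Nat.cast_add_one_ne_zero _)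

theorem totalDegree_aeval_le {R : Type*} [CommSemiring R] {q : MvPolynomial ι R} {p : ℕ}
    (hq : q.totalDegree ≤ p) {g : ι → MvPolynomial ι R} (hg : ∀ k, (g k).totalDegree ≤ 1) :
    (aeval g q).totalDegree ≤ p := by
  rw [aeval_def, eval₂_eq]
  refine totalDegree_finsetSum_le fun m hm => ?_
  calc
    _ ≤ (algebraMap R (MvPolynomial ι R) (coeff m q)).totalDegree +
        (∏ k ∈ m.support, g k ^ m k).totalDegree := totalDegree_mul _ _
    _ = (∏ k ∈ m.support, g k ^ m k).totalDegree := by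
      rw [algebraMap_eq, totalDegree_C, zero_add]
    _ ≤ ∑ k ∈ m.support, (g k ^ m k).totalDegree := totalDegree_finsetProd _ _
    _ ≤ ∑ k ∈ m.support, m k := Finset.sum_le_sum fun k _ =>
      (totalDegree_pow _ _).trans (mul_le_of_le_one_right (Nat.zero_le _) (hg k))
    _ ≤ p := (le_totalDegree hm).trans hq

theorem exists_eval_eq_eval_add_mul {R : Type*} [CommSemiring R] [Nontrivial R]
    {q : MvPolynomial ι R} {p : ℕ} (hq : q ∈ restrictTotalDegree ι R p) (c : ι → R) (r : R) :
    ∃ q' ∈ restrictTotalDegree ι R p, ∀ y, eval y q' = eval (fun k => c k + r * y k) q := by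
  let g : ι → MvPolynomial ι R := fun k => C (c k) + C r * X k
  have hg (k : ι) : (g k).totalDegree ≤ 1 := by
    refine (totalDegree_add _ _).trans (max_le (by simp) ((totalDegree_mul _ _).trans ?_))
    rw [totalDegree_C, zero_add, totalDegree_X]
  refine ⟨aeval g q, ?_, fun y => ?_⟩
  · rw [mem_restrictTotalDegree] at hq ⊢
    exact totalDegree_aeval_le hq hg
  · refine (eval₂Hom_bind₁ _ _ _ _).trans ?_
    rw [eval]
    congr 2
    ext k
    simp [g]

/-- The value of a polynomial at a point of Euclidean space. -/
noncomputable def polyVal (q : MvPolynomial ι ℝ) (x : EuclideanSpace ℝ ι) : ℝ :=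
  eval (fun k => x k) q

theorem isLinearMap_polyVal (x : EuclideanSpace ℝ ι) :
    IsLinearMap ℝ fun q : MvPolynomial ι ℝ => polyVal q x :=
  (aeval fun k => x k).toLinearMap.isLinear

theorem continuous_polyVal (q : MvPolynomial ι ℝ) : Continuous (polyVal q) :=
  (continuous_eval q).comp (by fun_prop)

theorem eq_zero_of_polyVal_eq_zero [Finite ι] {q : MvPolynomial ι ℝ} {U : Set (EuclideanSpace ℝ ι)}
    (hU : IsOpen U) (hne : U.Nonempty) (h : ∀ x ∈ U, polyVal q x = 0) : q = 0 := by
  obtain ⟨x, hx⟩ := hne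
  have hc : Continuous fun y : ι → ℝ => WithLp.toLp 2 y := PiLp.continuous_toLp 2 _
  obtain ⟨u, hu, hs⟩ := isOpen_pi_iff'.1 (hU.preimage hc) (fun k => x k) hx
  refine funext_set u (fun i => infinite_of_mem_nhds (x i)
    ((hu i).1.mem_nhds (hu i).2)) fun y hy => ?_
  rw [map_zero]
  exact h _ (hs hy)

variable [Fintype ι]

theorem exists_polyVal_sq_le_integral (p : ℕ) {s B : Set (EuclideanSpace ℝ ι)} (hs : IsCompact s)
    (hB : IsCompact B) (hne : (interior B).Nonempty) : ∃ C, 0 ≤ C ∧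
    ∀ q ∈ restrictTotalDegree ι ℝ p, ∀ y ∈ s, polyVal q y ^ 2 ≤ C * ∫ x in B, polyVal q x ^ 2 := by
  have hlin (x : EuclideanSpace ℝ ι) :
      IsLinearMap ℝ fun q : restrictTotalDegree ι ℝ p => polyVal q x :=
    (((isLinearMap_polyVal x).mk' _).comp (restrictTotalDegree ι ℝ p).subtype).isLinear
  have hint (q r : MvPolynomial ι ℝ) : IntegrableOn (fun x => polyVal q x * polyVal r x) B :=
    ((continuous_polyVal q).mul (continuous_polyVal r)).continuousOn.integrableOn_compact hB
  have hbilin : IsBilin fun q r : restrictTotalDegree ι ℝ p =>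
      ∫ x in B, polyVal q x * polyVal r x :=
    .integral (fun x => .mul (hlin x) (hlin x)) fun q r => hint q r
  have hdef (q : restrictTotalDegree ι ℝ p) (hq : ∫ x in B, polyVal q x * polyVal q x = 0) :
      q = 0 := by
    have hzero := eqOn_zero_of_setIntegral_eq_zero isOpen_interior interior_subset
      ((continuous_polyVal _).mul (continuous_polyVal _)).continuousOn
      (fun x => mul_self_nonneg _) (hint q q) hq
    exact Subtype.ext (eq_zero_of_polyVal_eq_zero isOpen_interior hne
      fun x hx => mul_self_eq_zero.1 (hzero hx))
  have hbdd (q : restrictTotalDegree ι ℝ p) : ∃ D, ∀ y : s, polyVal q y.1 ^ 2 ≤ D := by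
    obtain ⟨D, hD⟩ := hs.bddAbove_image
      ((continuous_polyVal (q : MvPolynomial ι ℝ)).pow 2).continuousOn
    exact ⟨D, fun y => hD (mem_image_of_mem _ y.2)⟩
  have hsymm (q r : restrictTotalDegree ι ℝ p) :
      ∫ x in B, polyVal q x * polyVal r x = ∫ x in B, polyVal r x * polyVal q x :=
    integral_congr_ae (.of_forall fun x => mul_comm _ _)
  obtain ⟨C, hC, h⟩ := hbilin.exists_forall_sq_le hsymm
    (fun q => integral_nonneg fun x => mul_self_nonneg _) hdef (fun y : s => hlin y.1) hbdd
  refine ⟨C, hC, fun q hq y hy => ?_⟩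
  simpa only [sq] using h ⟨y, hy⟩ ⟨q, hq⟩

theorem integral_closedBall_eq (f : EuclideanSpace ℝ ι → ℝ) (c : EuclideanSpace ℝ ι) {r : ℝ}
    (hr : 0 < r) : ∫ x in Metric.closedBall c r, f x =
      r ^ Fintype.card ι * ∫ y in Metric.closedBall 0 1, f (c + r • y) := by
  have hscale := Measure.setIntegral_comp_smul_of_pos volume (fun x => f (c + x))
    (Metric.closedBall 0 1) hr
  have htranslate := (measurePreserving_add_left volume c).setIntegral_preimage_emb
    (MeasurableEquiv.addLeft c).measurableEmbedding f (Metric.closedBall c r)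
  rw [smul_unitClosedBall_of_nonneg hr.le, finrank_euclideanSpace] at hscale
  rw [hscale, smul_eq_mul, mul_inv_cancel_left₀ (by positivity), ← htranslate,
    preimage_add_closedBall, sub_self]

theorem exists_pow_mul_polyVal_sq_le (p : ℕ) (R : ℝ) : ∃ C, 0 ≤ C ∧
    ∀ q ∈ restrictTotalDegree ι ℝ p, ∀ (c x : EuclideanSpace ℝ ι) (r : ℝ), 0 < r →
      dist x c ≤ R * r →
      r ^ Fintype.card ι * polyVal q x ^ 2 ≤ C * ∫ y in Metric.closedBall c r, polyVal q y ^ 2 := by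
  obtain ⟨C, hC, h⟩ := exists_polyVal_sq_le_integral p
    (isCompact_closedBall (0 : EuclideanSpace ℝ ι) R) (isCompact_closedBall 0 1)
    ⟨0, mem_interior_iff_mem_nhds.2 (Metric.closedBall_mem_nhds 0 one_pos)⟩
  refine ⟨C, hC, fun q hq c x r hr hx => ?_⟩
  obtain ⟨q', hq', he⟩ := exists_eval_eq_eval_add_mul hq (fun k => c k) r
  have hval (y : EuclideanSpace ℝ ι) : polyVal q' y = polyVal q (c + r • y) := he _
  have hmem : r⁻¹ • (x - c) ∈ Metric.closedBall 0 R := by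
    rwa [mem_closedBall_zero_iff, norm_smul, norm_inv, Real.norm_of_nonneg hr.le, ← dist_eq_norm,
      inv_mul_le_iff₀ hr, mul_comm]
  have hunit := h q' hq' _ hmem
  simp_rw [hval] at hunit
  rw [smul_inv_smul₀ hr.ne', add_sub_cancel] at hunit
  rw [integral_closedBall_eq _ c hr, mul_left_comm]
  gcongr

end BallPolynomials

/-! ## Removing a countable set from an open set -/

section Countable

variable {E : Type*} [NormedAddCommGroup E] [NormedSpace ℝ E]

theorem isPreconnected_ball_diff_countable (hE : 1 < Module.rank ℝ E) (c : E) (r : ℝ) {F : Set E}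
    (hF : F.Countable) : IsPreconnected (Metric.ball c r \ F) := by
  rcases le_or_gt r 0 with hr | hr
  · simp [Metric.ball_eq_empty.2 hr, isPreconnected_empty]
  let φ := OpenPartialHomeomorph.univBall c r
  have hsource : φ.source = univ := OpenPartialHomeomorph.univBall_source c r
  have hinj : Function.Injective φ := injOn_univ.1 (hsource ▸ φ.injOn)
  have hrange : range φ = Metric.ball c r := by
    rw [← image_univ, ← hsource, φ.image_source_eq_target]
    exact OpenPartialHomeomorph.univBall_target c hr
  have hcompl : IsPreconnected (φ ⁻¹' F)ᶜ :=
    ((hF.preimage hinj).isConnected_compl_of_one_lt_rank hE).isPreconnected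
  have himage : φ '' (φ ⁻¹' F)ᶜ = Metric.ball c r \ F := by
    rw [← preimage_compl, image_preimage_eq_inter_range, hrange, inter_comm]
    rfl
  rw [← himage]
  exact hcompl.image φ (φ.continuousOn.mono (hsource ▸ subset_univ _))

theorem isPreconnected_diff_countable (hE : 1 < Module.rank ℝ E) {U F : Set E} (hU : IsOpen U)
    (hc : IsPreconnected U) (hF : F.Countable) : IsPreconnected (U \ F) := by
  have : Nontrivial E := rank_pos_iff_nontrivial.1 (zero_lt_one.trans hE)
  have hne (x : E) : (𝓝[Fᶜ] x).NeBot := mem_closure_iff_nhdsWithin_neBot.1 (hF.dense_compl ℝ x)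
  refine isPreconnected_of_forall_constant fun f hf x hx y hy => ?_
  have hlocal (x : E) (hxU : x ∈ U) : ∃ b, ∀ᶠ y in 𝓝 x, ∀ᶠ z in 𝓝[Fᶜ] y, f z = b := by
    obtain ⟨r, hr, hball⟩ := Metric.isOpen_iff.1 hU x hxU
    obtain ⟨x₀, hx₀, hx₀F⟩ := (hF.dense_compl ℝ).inter_open_nonempty _ Metric.isOpen_ball
      ⟨x, Metric.mem_ball_self hr⟩
    refine ⟨f x₀, (Metric.isOpen_ball.eventually_mem (Metric.mem_ball_self hr)).mono fun y hy => ?_⟩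
    filter_upwards [mem_nhdsWithin_of_mem_nhds (Metric.isOpen_ball.mem_nhds hy),
      self_mem_nhdsWithin] with z hz hzF
    exact (isPreconnected_ball_diff_countable hE x r hF).constant
      (hf.mono (sdiff_subset_sdiff_left hball)) ⟨hz, hzF⟩ ⟨hx₀, hx₀F⟩
  obtain ⟨b, hbx, hby⟩ : ∃ b, (∀ᶠ z in 𝓝[Fᶜ] x, f z = b) ∧ ∀ᶠ z in 𝓝[Fᶜ] y, f z = b := by
    refine hc.induction₂' (fun x y => ∃ b, (∀ᶠ z in 𝓝[Fᶜ] x, f z = b) ∧ ∀ᶠ z in 𝓝[Fᶜ] y, f z = b)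
      (fun x hx => ?_) (fun x y z _ _ _ hxy hyz => ?_) hx.1 hy.1
    · obtain ⟨b, hb⟩ := hlocal x hx
      exact mem_nhdsWithin_of_mem_nhds (hb.mono fun y hy =>
        ⟨⟨b, hb.self_of_nhds, hy⟩, ⟨b, hy, hb.self_of_nhds⟩⟩)
    · obtain ⟨b, hb, hb'⟩ := hxy
      obtain ⟨c, hc, hc'⟩ := hyz
      obtain ⟨w, hwb, hwc⟩ := (hb'.and hc).exists
      exact ⟨b, hb, (hwb.symm.trans hwc) ▸ hc'⟩
  exact (hbx.self_of_nhdsWithin hx.2).trans (hby.self_of_nhdsWithin hy.2).symm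

theorem frontier_subset_closure_frontier_diff_countable (hE : 1 < Module.rank ℝ E) {U F : Set E}
    (hU : IsOpen U) (hreg : interior (closure U) = U) (hF : F.Countable) :
    frontier U ⊆ closure (frontier U \ F) := by
  have : Nontrivial E := rank_pos_iff_nontrivial.1 (zero_lt_one.trans hE)
  intro x hx
  rw [Metric.mem_closure_iff]
  by_contra! h
  obtain ⟨r, hr, hball⟩ := h
  have hcompl : x ∈ closure (closure U)ᶜ := by
    rw [closure_compl, hreg]
    exact (hU.frontier_eq ▸ hx).2
  have hmeet {V : Set E} (hV : IsOpen V) (hxV : x ∈ closure V) :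
      ((Metric.ball x r \ F) ∩ V).Nonempty := by
    obtain ⟨y, ⟨hyB, hyV⟩, hyF⟩ := (hF.dense_compl ℝ).inter_open_nonempty _
      (Metric.isOpen_ball.inter hV)
      (mem_closure_iff.1 hxV _ Metric.isOpen_ball (Metric.mem_ball_self hr))
    exact ⟨y, ⟨hyB, hyF⟩, hyV⟩
  have hcover : Metric.ball x r \ F ⊆ U ∪ (closure U)ᶜ := fun z hz => by
    by_contra hzU
    rw [mem_union, not_or, mem_compl_iff, not_not] at hzU
    exact (hball z ⟨hU.frontier_eq ▸ ⟨hzU.2, hzU.1⟩, hz.2⟩).not_gt (dist_comm z x ▸ hz.1)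
  obtain ⟨z, -, hzU, hzU'⟩ := isPreconnected_ball_diff_countable hE x r hF U (closure U)ᶜ hU
    isClosed_closure.isOpen_compl hcover (hmeet hU (frontier_subset_closure hx))
    (hmeet isClosed_closure.isOpen_compl hcompl)
  exact hzU' (subset_closure hzU)

end Countable

/-! ## Triangles -/

theorem tendsto_lineMap_nhdsWithin_interior {E : Type*} [AddCommGroup E] [Module ℝ E]
    [TopologicalSpace E] [IsTopologicalAddGroup E] [ContinuousSMul ℝ E] {s : Set E}
    (hs : Convex ℝ s) {x z : E} (hx : x ∈ closure s) (hz : z ∈ interior s) :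
    Tendsto (AffineMap.lineMap x z) (𝓝[>] (0 : ℝ)) (𝓝[interior s] x) := by
  refine tendsto_nhdsWithin_iff.2 ⟨?_, ?_⟩
  · have hcont : Continuous (AffineMap.lineMap x z : ℝ → E) := AffineMap.lineMap_continuous
    simpa using (hcont.tendsto 0).mono_left nhdsWithin_le_nhds
  · filter_upwards [Ioc_mem_nhdsGT one_pos] with t ht
    rw [AffineMap.lineMap_apply_module', add_comm]
    exact hs.add_smul_sub_mem_interior' hx hz ht

theorem measurePreserving_one_sub :
    MeasurePreserving (fun t : ℝ => 1 - t) (volume.restrict (Icc 0 1))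
      (volume.restrict (Icc 0 1)) := by
  have h := (Measure.measurePreserving_sub_left (volume : Measure ℝ) 1).restrict_preimage
    (measurableSet_Icc (a := 0) (b := 1))
  rwa [preimage_const_sub_Icc, sub_self, sub_zero] at h

namespace PlaneDG

theorem seg_mk {E : Type} [AddCommGroup E] [Module ℝ E] (a b : E) :
    seg s(a, b) = segment ℝ a b := by
  rw [seg, ← convexHull_pair]
  congr 1
  ext x
  simp

theorem seg_map {E F : Type} [AddCommGroup E] [Module ℝ E] [AddCommGroup F] [Module ℝ F]
    (f : E →ᵃ[ℝ] F) (s : Sym2 E) : seg (s.map f) = f '' seg s := by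
  induction s with
  | _ a b => rw [Sym2.map_mk, seg_mk, seg_mk, image_segment]

namespace Tri

theorem forall_of_rotate {P : Fin 3 → Prop} (e : Fin 3) (h₀ : P e) (h₁ : P (e + 1))
    (h₂ : P (e + 2)) (k : Fin 3) : P k := by
  have hk : ∀ e k : Fin 3, k = e ∨ k = e + 1 ∨ k = e + 2 := by decide
  rcases hk e k with rfl | rfl | rfl <;> assumption

theorem sum_eq_rotate {α : Type*} [AddCommMonoid α] (e : Fin 3) (g : Fin 3 → α) :
    ∑ k, g k = g e + g (e + 1) + g (e + 2) := by
  rw [← Equiv.sum_comp (Equiv.addLeft e) g, Fin.sum_univ_three]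
  simp

variable (T : Tri)

/-! ### Barycentric coordinates -/

theorem affineSpan_eq_top : affineSpan ℝ (range T.points) = ⊤ := by
  rw [T.independent.affineSpan_eq_top_iff_card_eq_finrank_add_one]
  simp

/-- The vertices of a triangle as an affine basis of the plane. -/
noncomputable def basis : AffineBasis (Fin 3) ℝ E2 :=
  ⟨T.points, T.independent, T.affineSpan_eq_top⟩

/-- The barycentric coordinate belonging to the vertex `e`; it vanishes on the line through the
opposite edge. -/
noncomputable def bary (e : Fin 3) : E2 →ᵃ[ℝ] ℝ := T.basis.coord e

theorem carrier_eq : T.carrier = {x | ∀ e, 0 ≤ T.bary e x} := T.basis.convexHull_eq_nonneg_coord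

theorem interior_carrier_eq : interior T.carrier = {x | ∀ e, 0 < T.bary e x} :=
  T.basis.interior_convexHull

theorem continuous_bary (e : Fin 3) : Continuous (T.bary e) :=
  continuous_barycentric_coord T.basis e

theorem bary_points (e k : Fin 3) : T.bary e (T.points k) = if e = k then 1 else 0 :=
  T.basis.coord_apply e k

theorem sum_bary (x : E2) : ∑ k, T.bary k x = 1 := T.basis.sum_coord_apply_eq_one x

theorem ext_bary {x y : E2} (h : ∀ k, T.bary k x = T.bary k y) : x = y := T.basis.ext_elem h

theorem apply_eq_sum_bary_mul (f : E2 →ᵃ[ℝ] ℝ) (x : E2) :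
    f x = ∑ k, T.bary k x * f (T.points k) := by
  have hsum := T.basis.sum_coord_apply_eq_one x
  conv_lhs => rw [← T.basis.affineCombination_coord_eq_self x,
    Finset.map_affineCombination _ _ _ hsum,
    Finset.affineCombination_eq_linear_combination _ _ _ hsum]
  rfl

theorem bary_edgePt (e k : Fin 3) (t : ℝ) : T.bary k (T.edgePt e t) =
    (1 - t) * T.bary k (T.points (e + 1)) + t * T.bary k (T.points (e + 2)) :=
  (AffineMap.apply_lineMap _ _ _ _).trans (AffineMap.lineMap_apply_module _ _ _)

theorem bary_edgePt_self (e : Fin 3) (t : ℝ) : T.bary e (T.edgePt e t) = 0 := by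
  simp [bary_edgePt, bary_points]

theorem bary_edgePt_add_one (e : Fin 3) (t : ℝ) : T.bary (e + 1) (T.edgePt e t) = 1 - t := by
  simp [bary_edgePt, bary_points]

theorem bary_edgePt_add_two (e : Fin 3) (t : ℝ) : T.bary (e + 2) (T.edgePt e t) = t := by
  simp [bary_edgePt, bary_points]

theorem edgePt_bary {e : Fin 3} {x : E2} (h : T.bary e x = 0) :
    T.edgePt e (T.bary (e + 2) x) = x := by
  refine T.ext_bary (forall_of_rotate e ?_ ?_ ?_)
  · rw [bary_edgePt_self, h]
  · rw [bary_edgePt_add_one, ← T.sum_bary x, sum_eq_rotate e, h, zero_add, add_sub_cancel_right]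
  · rw [bary_edgePt_add_two]

/-! ### Edges -/

theorem isCompact_carrier : IsCompact T.carrier := (Set.finite_range _).isCompact_convexHull ℝ

theorem convex_carrier : Convex ℝ T.carrier := convex_convexHull ℝ _

theorem points_mem (k : Fin 3) : T.points k ∈ T.carrier := subset_convexHull ℝ _ ⟨k, rfl⟩

theorem interior_nonempty : (interior T.carrier).Nonempty :=
  ⟨_, T.basis.centroid_mem_interior_convexHull⟩

theorem mem_closure_interior {x : E2} (hx : x ∈ T.carrier) : x ∈ closure (interior T.carrier) := by
  rw [T.convex_carrier.closure_interior_eq_closure_of_nonempty_interior T.interior_nonempty]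
  exact subset_closure hx

theorem integrableOn_carrier {f : E2 → ℝ} (hf : Continuous f) : IntegrableOn f T.carrier :=
  hf.continuousOn.integrableOn_compact T.isCompact_carrier

theorem restrict_carrier :
    (volume : Measure E2).restrict T.carrier = volume.restrict (interior T.carrier) :=
  (Measure.restrict_congr_set
    (interior_ae_eq_of_null_frontier (T.convex_carrier.addHaar_frontier volume))).symm

theorem continuous_edgePt (e : Fin 3) : Continuous (T.edgePt e) := AffineMap.lineMap_continuous

theorem seg_edge (e : Fin 3) : seg (T.edge e) = T.edgePt e '' Icc 0 1 := by
  rw [edge, seg_mk, segment_eq_image_lineMap]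
  rfl

theorem edgePt_mem (e : Fin 3) {t : ℝ} (ht : t ∈ Icc (0 : ℝ) 1) : T.edgePt e t ∈ T.carrier :=
  T.convex_carrier.lineMap_mem (T.points_mem _) (T.points_mem _) ht

theorem mem_seg_edge {e : Fin 3} {x : E2} (hx : x ∈ T.carrier) (h : T.bary e x = 0) :
    x ∈ seg (T.edge e) := by
  rw [seg_edge]
  rw [carrier_eq] at hx
  have hsum := T.sum_bary x
  rw [sum_eq_rotate e, h] at hsum
  exact ⟨T.bary (e + 2) x, ⟨hx _, by linarith [hx (e + 1)]⟩, T.edgePt_bary h⟩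

theorem len_pos (e : Fin 3) : 0 < T.len e :=
  dist_pos.2 (T.independent.injective.ne (by simp))

theorem len_le_diam (e : Fin 3) : T.len e ≤ Metric.diam T.carrier :=
  Metric.dist_le_diam_of_mem T.isCompact_carrier.isBounded (T.points_mem _) (T.points_mem _)

theorem norm_normal_le (e : Fin 3) : ‖T.normal e‖ ≤ 1 := by
  rw [normal, norm_smul, norm_inv, norm_norm]
  exact inv_mul_le_one

theorem edgeInt_eq (e : Fin 3) (g : E2 → ℝ) :
    T.edgeInt e g = T.len e * ∫ t in Icc (0 : ℝ) 1, g (T.edgePt e t) := by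
  rw [edgeInt, intervalIntegral.integral_of_le zero_le_one, integral_Icc_eq_integral_Ioc]

/-! ### Two triangles with a common edge -/

variable {T} {T' : Tri} {e e' : Fin 3}

theorem edgePt_eq_or (h : T.edge e = T'.edge e') :
    (∀ t, T.edgePt e t = T'.edgePt e' t) ∨ ∀ t, T.edgePt e t = T'.edgePt e' (1 - t) := by
  rcases Sym2.eq_iff.1 h with ⟨h₁, h₂⟩ | ⟨h₁, h₂⟩
  · exact .inl fun t => by rw [edgePt, h₁, h₂]; rfl
  · exact .inr fun t => by rw [edgePt, h₁, h₂, edgePt, AffineMap.lineMap_apply_one_sub]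

theorem bary_eq_mul (h : T.edge e = T'.edge e') (x : E2) :
    T'.bary e' x = T.bary e x * T'.bary e' (T.points e) := by
  have hzero : T'.bary e' (T.points (e + 1)) = 0 ∧ T'.bary e' (T.points (e + 2)) = 0 := by
    rcases Sym2.eq_iff.1 h with ⟨h₁, h₂⟩ | ⟨h₁, h₂⟩ <;> simp only [fst, snd] at h₁ h₂ <;>
      simp [h₁, h₂, bary_points]
  rw [T.apply_eq_sum_bary_mul (T'.bary e') x, sum_eq_rotate e, hzero.1, hzero.2]
  ring

theorem bary_apex_ne_zero (h : T.edge e = T'.edge e') : T'.bary e' (T.points e) ≠ 0 := by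
  intro hzero
  have := bary_eq_mul h (T'.points e')
  simp [hzero, bary_points] at this

theorem edge_injective (T : Tri) : Function.Injective T.edge := by
  intro e e' h
  by_contra hne
  exact bary_apex_ne_zero h (by rw [bary_points, if_neg (Ne.symm hne)])

theorem eventually_bary_pos (h : T.edge e = T'.edge e') {t : ℝ} (ht : t ∈ Ioo (0 : ℝ) 1) :
    ∀ᶠ x in 𝓝 (T.edgePt e t), 0 < T'.bary (e' + 1) x ∧ 0 < T'.bary (e' + 2) x := by
  have hpos : 0 < T'.bary (e' + 1) (T.edgePt e t) ∧ 0 < T'.bary (e' + 2) (T.edgePt e t) := by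
    rcases edgePt_eq_or h with h | h <;> rw [h, bary_edgePt_add_one, bary_edgePt_add_two]
    · exact ⟨by linarith [ht.2], ht.1⟩
    · exact ⟨by linarith [ht.1], by linarith [ht.2]⟩
  exact ((T'.continuous_bary _).continuousAt.eventually (lt_mem_nhds hpos.1)).and
    ((T'.continuous_bary _).continuousAt.eventually (lt_mem_nhds hpos.2))

theorem not_disjoint_interior (h : T.edge e = T'.edge e') (hs : 0 < T'.bary e' (T.points e)) :
    ¬ Disjoint (interior T.carrier) (interior T'.carrier) := by
  have hmid : (1 / 2 : ℝ) ∈ Ioo (0 : ℝ) 1 := by norm_num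
  have hmem : T.edgePt e (1 / 2) ∈ closure (interior T.carrier) :=
    T.mem_closure_interior (T.edgePt_mem e (Ioo_subset_Icc_self hmid))
  obtain ⟨x, hx', hx⟩ := mem_closure_iff_nhds.1 hmem _ (eventually_bary_pos h hmid)
  refine not_disjoint_iff.2 ⟨x, hx, ?_⟩
  rw [interior_carrier_eq] at hx ⊢
  exact forall_of_rotate e' (by rw [bary_eq_mul h]; exact mul_pos (hx e) hs) hx'.1 hx'.2

theorem union_mem_nhds (h : T.edge e = T'.edge e') (hs : T'.bary e' (T.points e) < 0) {t : ℝ}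
    (ht : t ∈ Ioo (0 : ℝ) 1) : T.carrier ∪ T'.carrier ∈ 𝓝 (T.edgePt e t) := by
  filter_upwards [eventually_bary_pos (T := T) (T' := T) (e := e) rfl ht, eventually_bary_pos h ht]
    with x hx hx'
  rw [mem_union, carrier_eq, carrier_eq]
  rcases le_total 0 (T.bary e x) with hside | hside
  · exact .inl (forall_of_rotate e hside hx.1.le hx.2.le)
  · refine .inr (forall_of_rotate e' ?_ hx'.1.le hx'.2.le)
    rw [bary_eq_mul h]
    exact mul_nonneg_of_nonpos_of_nonpos hside hs.le

/-! ### Vertices and edges of adjacent triangles -/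

theorem bary_eq_zero_of_mem_convexHull {s : Set E2} (hs : ∀ y ∈ s, T.bary e y = 0) {x : E2}
    (hx : x ∈ convexHull ℝ s) : T.bary e x = 0 :=
  convexHull_min (t := T.bary e ⁻¹' {0}) hs
    ((convex_singleton (0 : ℝ)).affine_preimage (T.bary e)) hx

theorem mem_range_points_of_bary_eq_zero {x : E2} (hne : e ≠ e') (h : T.bary e x = 0)
    (h' : T.bary e' x = 0) : x ∈ range T.points := by
  have hthird : ∀ e e' : Fin 3, e ≠ e' → ∃ k, ∀ l, l ≠ k → l = e ∨ l = e' := by decide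
  obtain ⟨k, hk⟩ := hthird e e' hne
  have hzero (l : Fin 3) (hl : l ≠ k) : T.bary l x = 0 := by
    rcases hk l hl with rfl | rfl <;> assumption
  have hone : T.bary k x = 1 := by
    rw [← T.sum_bary x, Finset.sum_eq_single k (fun l _ hl => hzero l hl) (by simp)]
  refine ⟨k, T.ext_bary fun l => ?_⟩
  rcases eq_or_ne l k with rfl | hl
  · rw [bary_points, if_pos rfl, hone]
  · rw [bary_points, if_neg hl, hzero l hl]

theorem exists_edge_eq (T : Tri) {a b : Fin 3} (hab : a ≠ b) :
    ∃ e, T.edge e = s(T.points a, T.points b) := by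
  obtain ⟨e, ⟨rfl, rfl⟩ | ⟨rfl, rfl⟩⟩ :
      ∃ e : Fin 3, (a = e + 1 ∧ b = e + 2) ∨ (a = e + 2 ∧ b = e + 1) := by decide +revert
  · exact ⟨e, rfl⟩
  · exact ⟨e, Sym2.eq_swap⟩

theorem exists_common_edge (hT : ¬ T.carrier ⊆ T'.carrier) {x : E2}
    (hx : x ∈ convexHull ℝ (range T.points ∩ range T'.points)) (hxT : x ∉ range T.points) :
    ∃ e e', T.edge e = T'.edge e' ∧ T.bary e x = 0 := by
  have hzero (k : Fin 3) (hk : T.points k ∉ range T'.points) : T.bary k x = 0 := by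
    refine bary_eq_zero_of_mem_convexHull ?_ hx
    rintro _ ⟨⟨l, rfl⟩, hl⟩
    rw [bary_points, if_neg]
    rintro rfl
    exact hk hl
  obtain ⟨e, he⟩ : ∃ e, T.points e ∉ range T'.points := by
    by_contra! h
    exact hT (convexHull_mono (range_subset_iff.2 h))
  have hmem (k : Fin 3) (hk : k ≠ e) : T.points k ∈ range T'.points := by
    by_contra h
    exact hxT (mem_range_points_of_bary_eq_zero hk (hzero k h) (hzero e he))
  obtain ⟨a, ha⟩ := hmem (e + 1) (by simp)
  obtain ⟨b, hb⟩ := hmem (e + 2) (by simp)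
  have hab : a ≠ b := by
    rintro rfl
    exact absurd (T.independent.injective (ha.symm.trans hb)) (by simp)
  obtain ⟨e', he'⟩ := T'.exists_edge_eq hab
  exact ⟨e, e', by rw [he', ha, hb]; rfl, hzero e he⟩

theorem eq_of_bary_edgePt_eq_zero {t : ℝ} (ht : t ∈ Ioo (0 : ℝ) 1)
    (h : T.bary e' (T.edgePt e t) = 0) : e' = e := by
  refine forall_of_rotate (P := fun k => T.bary k (T.edgePt e t) = 0 → k = e) e (fun _ => rfl)
    (fun h => ?_) (fun h => ?_) e' h
  · rw [bary_edgePt_add_one] at h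
    linarith [ht.2]
  · rw [bary_edgePt_add_two] at h
    linarith [ht.1]

theorem edgePt_notMem_range_points {t : ℝ} (ht : t ∈ Ioo (0 : ℝ) 1) :
    T.edgePt e t ∉ range T.points := by
  rintro ⟨k, hk⟩
  have hzero (l : Fin 3) (hl : l ≠ k) : l = e :=
    eq_of_bary_edgePt_eq_zero ht (by rw [← hk, bary_points, if_neg hl])
  have hne : k + 1 ≠ k + 2 := by simp
  exact hne ((hzero _ (by simp)).trans (hzero _ (by simp)).symm)

end Tri

end PlaneDG

/-! ## Plane-networks -/

theorem PlaneDG.Network.IsCoefficient.exists_bounds {G : PlaneDG.Network}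
    {κ : Fin G.N → PlaneDG.E2 → ℝ} (hκ : G.IsCoefficient κ) : ∃ b c, 0 < b ∧
      (∀ i, ∀ᵐ x ∂(volume.restrict (G.dom i)), b ≤ κ i x) ∧
      ∀ i, ∀ᵐ x ∂(volume.restrict (G.dom i)), |κ i x| ≤ c := by
  obtain ⟨-, ⟨b, hb₀, hb⟩, c, hc⟩ := hκ
  refine ⟨b, c, hb₀, hb, fun i => ?_⟩
  filter_upwards [hb i, hc i] with x hbx hxc
  exact abs_le.2 ⟨by linarith, hxc⟩

namespace PlaneDG.Mesh

variable {G : Network} {M : Mesh G} {p : ℕ}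

theorem carrier_subset (M : Mesh G) (i : Fin G.N) (K : Fin (M.n i)) :
    (M.tri i K).carrier ⊆ closure (G.dom i) := by
  rw [← M.cover i]
  exact subset_iUnion (fun K => (M.tri i K).carrier) K

theorem interior_carrier_subset (M : Mesh G) (i : Fin G.N) (K : Fin (M.n i)) :
    interior (M.tri i K).carrier ⊆ G.dom i := by
  rw [← (G.polygonal i).2.2.1]
  exact interior_mono (M.carrier_subset i K)

theorem ae_carrier_of_ae_dom (M : Mesh G) {i : Fin G.N} (K : Fin (M.n i)) {P : E2 → Prop}
    (h : ∀ᵐ x ∂(volume.restrict (G.dom i)), P x) :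
    ∀ᵐ x ∂(volume.restrict (M.tri i K).carrier), P x := by
  rw [Tri.restrict_carrier]
  exact ae_restrict_of_ae_restrict_of_subset (M.interior_carrier_subset i K) h

/-- The point with parameter `t ∈ [0, 1]` on a local edge. -/
noncomputable def pt {i : Fin G.N} (F : M.Loc i) (t : ℝ) : E2 := (M.tri i F.1).edgePt F.2 t

theorem continuous_pt {i : Fin G.N} (F : M.Loc i) : Continuous (pt F) := Tri.continuous_edgePt _ _

theorem pt_mem {i : Fin G.N} (F : M.Loc i) {t : ℝ} (ht : t ∈ Icc (0 : ℝ) 1) :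
    pt F t ∈ (M.tri i F.1).carrier := Tri.edgePt_mem _ _ ht

theorem len_pos (M : Mesh G) {i : Fin G.N} (F : M.Loc i) : 0 < M.len F := Tri.len_pos _ _

theorem faceInt_eq (M : Mesh G) {i : Fin G.N} (F : M.Loc i) (g : E2 → ℝ) :
    M.faceInt F g = M.len F * ∫ t in Icc (0 : ℝ) 1, g (pt F t) := Tri.edgeInt_eq _ _ _

/-! ### Traces of the coefficient -/

theorem ae_tendsto_kTrace {κ : Fin G.N → E2 → ℝ} (hκ : M.HasTraces κ) {i : Fin G.N}
    (F : M.Loc i) : ∀ᵐ t ∂(volume.restrict (Icc (0 : ℝ) 1)),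
      pt F t ∈ closure (interior (M.tri i F.1).carrier) ∧
      Tendsto (κ i) (𝓝[interior (M.tri i F.1).carrier] (pt F t))
        (𝓝 (M.kTrace κ i F.1 (pt F t))) := by
  filter_upwards [hκ i F.1 F.2, ae_restrict_mem measurableSet_Icc] with t hlim ht
  have hcl := Tri.mem_closure_interior _ (pt_mem F ht)
  have := mem_closure_iff_nhdsWithin_neBot.1 hcl
  exact ⟨hcl, tendsto_nhds_limUnder hlim⟩

theorem ae_abs_kTrace_le {κ : Fin G.N → E2 → ℝ} (hκ : M.HasTraces κ) {c : ℝ}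
    (hc : ∀ i, ∀ᵐ x ∂(volume.restrict (G.dom i)), |κ i x| ≤ c) {i : Fin G.N} (F : M.Loc i) :
    ∀ᵐ t ∂(volume.restrict (Icc (0 : ℝ) 1)), |M.kTrace κ i F.1 (pt F t)| ≤ c := by
  filter_upwards [ae_tendsto_kTrace hκ F] with t ⟨hcl, hlim⟩
  exact mem_of_tendsto_nhdsWithin_of_ae_mem (s := {y | |y| ≤ c}) isOpen_interior
    (isClosed_le continuous_abs continuous_const) hcl
    (ae_restrict_of_ae_restrict_of_subset (M.interior_carrier_subset i F.1) (hc i)) hlim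

theorem aemeasurable_kTrace {κ : Fin G.N → E2 → ℝ} (hm : ∀ i, Measurable (κ i))
    (hκ : M.HasTraces κ) {i : Fin G.N} (F : M.Loc i) :
    AEMeasurable (fun t => M.kTrace κ i F.1 (pt F t)) (volume.restrict (Icc (0 : ℝ) 1)) := by
  obtain ⟨z, hz⟩ := (M.tri i F.1).interior_nonempty
  refine aemeasurable_of_tendsto_metrizable_ae (𝓝[>] (0 : ℝ))
    (f := fun s t => κ i (AffineMap.lineMap (pt F t) z s)) (fun s => ?_) ?_
  · refine ((hm i).comp (Continuous.measurable ?_)).aemeasurable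
    simp only [AffineMap.lineMap_apply_module]
    have := continuous_pt F
    fun_prop
  · filter_upwards [ae_tendsto_kTrace hκ F, ae_restrict_mem measurableSet_Icc] with t hlim ht
    exact hlim.2.comp (tendsto_lineMap_nhdsWithin_interior (Tri.convex_carrier _)
      (subset_closure (pt_mem F ht)) hz)

/-! ### Inverse trace inequality -/

theorem isLinearMap_val (i : Fin G.N) (K : Fin (M.n i)) (x : E2) :
    IsLinearMap ℝ fun v : M.V p => val v i K x :=
  ⟨fun u v => (isLinearMap_polyVal x).map_add (u i K) (v i K),
    fun c v => (isLinearMap_polyVal x).map_smul c (v i K)⟩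

theorem grad_apply (v : M.V p) (i : Fin G.N) (K : Fin (M.n i)) (x : E2) (l : Fin 2) :
    grad v i K x l = polyVal (MvPolynomial.pderiv l (v i K : MvPolynomial (Fin 2) ℝ)) x := rfl

theorem isLinearMap_grad (i : Fin G.N) (K : Fin (M.n i)) (x : E2) :
    IsLinearMap ℝ fun v : M.V p => grad v i K x where
  map_add u v := by
    ext l
    rw [PiLp.add_apply, grad_apply, grad_apply, grad_apply, ← (isLinearMap_polyVal x).map_add,
      ← map_add]
    rfl
  map_smul c v := by
    ext l
    rw [PiLp.smul_apply, grad_apply, grad_apply, ← (isLinearMap_polyVal x).map_smul,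
      ← Derivation.map_smul]
    rfl

theorem isBilin_inner_grad (i : Fin G.N) (K : Fin (M.n i)) (x : E2) :
    IsBilin fun u v : M.V p => inner ℝ (grad u i K x) (grad v i K x) where
  left v := ((innerₗ E2).flip (grad v i K x) ∘ₗ (isLinearMap_grad i K x).mk' _).isLinear
  right u := ((innerₗ E2) (grad u i K x) ∘ₗ (isLinearMap_grad i K x).mk' _).isLinear

theorem isLinearMap_inner_grad (i : Fin G.N) (K : Fin (M.n i)) (x n : E2) :
    IsLinearMap ℝ fun v : M.V p => inner ℝ (grad v i K x) n :=
  ((innerₗ E2).flip n ∘ₗ (isLinearMap_grad i K x).mk' _).isLinear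

theorem continuous_val (v : M.V p) (i : Fin G.N) (K : Fin (M.n i)) : Continuous (val v i K) :=
  continuous_polyVal _

theorem continuous_grad (v : M.V p) (i : Fin G.N) (K : Fin (M.n i)) : Continuous (grad v i K) :=
  (PiLp.continuous_toLp 2 _).comp (continuous_pi fun _ => continuous_polyVal _)

/-- The Dirichlet energy of a mesh function on a triangle. -/
noncomputable def energy (v : M.V p) (i : Fin G.N) (K : Fin (M.n i)) : ℝ :=
  ∫ x in (M.tri i K).carrier, ‖grad v i K x‖ ^ 2

/-- The broken Dirichlet energy of a mesh function on a surface. -/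
noncomputable def surfEnergy (v : M.V p) (i : Fin G.N) : ℝ := ∑ K, energy v i K

theorem energy_nonneg (v : M.V p) (i : Fin G.N) (K : Fin (M.n i)) : 0 ≤ energy v i K :=
  integral_nonneg fun _ => sq_nonneg _

theorem surfEnergy_nonneg (v : M.V p) (i : Fin G.N) : 0 ≤ surfEnergy v i :=
  Finset.sum_nonneg fun K _ => energy_nonneg v i K

theorem sum_surfEnergy_nonneg (v : M.V p) : 0 ≤ ∑ i, surfEnergy v i :=
  Finset.sum_nonneg fun i _ => surfEnergy_nonneg v i

theorem surfEnergy_le_sum (v : M.V p) (i : Fin G.N) : surfEnergy v i ≤ ∑ i, surfEnergy v i :=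
  Finset.single_le_sum (f := fun i => surfEnergy v i) (fun i _ => surfEnergy_nonneg v i)
    (Finset.mem_univ i)

theorem norm_grad_sq (v : M.V p) (i : Fin G.N) (K : Fin (M.n i)) (x : E2) :
    ‖grad v i K x‖ ^ 2 =
      ∑ l, polyVal (MvPolynomial.pderiv l (v i K : MvPolynomial (Fin 2) ℝ)) x ^ 2 :=
  EuclideanSpace.real_norm_sq_eq _

theorem exists_sq_mul_norm_grad_sq_le (G : Network) (p : ℕ) (R : ℝ) : ∃ C, 0 ≤ C ∧
    ∀ (M : Mesh G) (v : M.V p) (i : Fin G.N) (K : Fin (M.n i)) (c x : E2) (r : ℝ), 0 < r →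
      Metric.closedBall c r ⊆ (M.tri i K).carrier → dist x c ≤ R * r →
        r ^ 2 * ‖grad v i K x‖ ^ 2 ≤ C * energy v i K := by
  obtain ⟨C, hC, hinv⟩ := exists_pow_mul_polyVal_sq_le (ι := Fin 2) p R
  refine ⟨C, hC, fun M v i K c x r hr hball hx => ?_⟩
  have hint (l : Fin 2) : IntegrableOn (fun y => polyVal (MvPolynomial.pderiv l
      (v i K : MvPolynomial (Fin 2) ℝ)) y ^ 2) (M.tri i K).carrier :=
    Tri.integrableOn_carrier _ ((continuous_polyVal _).pow 2)
  have hbound (l : Fin 2) := (hinv _ (pderiv_mem_restrictTotalDegree (v i K).2 l) c x r hr hx).trans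
    (mul_le_mul_of_nonneg_left
      (setIntegral_mono_set (hint l) (.of_forall fun _ => sq_nonneg _) hball.eventuallyLE) hC)
  rw [energy]
  simp_rw [norm_grad_sq]
  rw [integral_finsetSum _ fun l _ => hint l, Finset.mul_sum, Finset.mul_sum]
  rw [Fintype.card_fin] at hbound
  exact Finset.sum_le_sum fun l _ => hbound l

theorem exists_len_sq_mul_norm_grad_sq_le (G : Network) (p : ℕ) (σ : ℝ) : ∃ C, 0 ≤ C ∧
    ∀ M : Mesh G, M.ShapeRegular σ → ∀ (v : M.V p) (i : Fin G.N) (F : M.Loc i),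
      ∀ x ∈ (M.tri i F.1).carrier, M.len F ^ 2 * ‖grad v i F.1 x‖ ^ 2 ≤ C * energy v i F.1 := by
  obtain ⟨C, hC, hinv⟩ := exists_sq_mul_norm_grad_sq_le G p (2 * σ)
  refine ⟨(2 * σ) ^ 2 * C, by positivity, fun M hM v i F x hx => ?_⟩
  obtain ⟨c, r, hball, hdiam, hr⟩ := hM i F.1
  replace hdiam : Metric.diam (M.tri i F.1).carrier ≤ 2 * σ * r := by linarith
  have hlen : M.len F ≤ 2 * σ * r := ((M.tri i F.1).len_le_diam F.2).trans hdiam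
  have hr₀ : 0 < r := hr.lt_of_ne' fun h => by
    rw [h, mul_zero] at hlen
    exact (M.len_pos F).not_ge hlen
  have hdist : dist x c ≤ 2 * σ * r := (Metric.dist_le_diam_of_mem
    (M.tri i F.1).isCompact_carrier.isBounded hx (hball (Metric.mem_closedBall_self hr))).trans
      hdiam
  have hlen₀ := (M.len_pos F).le
  calc M.len F ^ 2 * ‖grad v i F.1 x‖ ^ 2 ≤ (2 * σ * r) ^ 2 * ‖grad v i F.1 x‖ ^ 2 := by gcongr
    _ = (2 * σ) ^ 2 * (r ^ 2 * ‖grad v i F.1 x‖ ^ 2) := by ring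
    _ ≤ (2 * σ) ^ 2 * (C * energy v i F.1) :=
        mul_le_mul_of_nonneg_left (hinv M v i F.1 c x r hr₀ hball hdist) (sq_nonneg _)
    _ = (2 * σ) ^ 2 * C * energy v i F.1 := by ring

/-- The inverse trace inequality for the flux in the direction of a unit vector, with constant
`C`.  It holds almost everywhere on an edge, where the coefficient has a trace. -/
def FluxBound (κ : Fin G.N → E2 → ℝ) (M : Mesh G) (p : ℕ) (C : ℝ) : Prop :=
  ∀ (v : M.V p) (i : Fin G.N) (F : M.Loc i) (n : E2), ‖n‖ ≤ 1 →
    ∀ᵐ t ∂(volume.restrict (Icc (0 : ℝ) 1)),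
      M.len F ^ 2 * flux κ v i F.1 n (pt F t) ^ 2 ≤ C * energy v i F.1

theorem exists_fluxBound {κ : Fin G.N → E2 → ℝ} {c : ℝ}
    (hc : ∀ i, ∀ᵐ x ∂(volume.restrict (G.dom i)), |κ i x| ≤ c) (p : ℕ) (σ : ℝ) :
    ∃ C, 0 ≤ C ∧ ∀ M : Mesh G, M.ShapeRegular σ → M.HasTraces κ → FluxBound κ M p C := by
  obtain ⟨C, hC, hinv⟩ := exists_len_sq_mul_norm_grad_sq_le G p σ
  refine ⟨c ^ 2 * C, by positivity, fun M hσ hM v i F n hn => ?_⟩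
  filter_upwards [ae_abs_kTrace_le hM hc F, ae_restrict_mem measurableSet_Icc] with t htrace ht
  have hinner : inner ℝ (grad v i F.1 (pt F t)) n ^ 2 ≤ ‖grad v i F.1 (pt F t)‖ ^ 2 :=
    sq_le_sq.2 (((abs_real_inner_le_norm _ _).trans
      (mul_le_of_le_one_right (norm_nonneg _) hn)).trans (le_abs_self _))
  calc M.len F ^ 2 * flux κ v i F.1 n (pt F t) ^ 2
      = M.kTrace κ i F.1 (pt F t) ^ 2 * (M.len F ^ 2 * inner ℝ (grad v i F.1 (pt F t)) n ^ 2) := by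
        rw [flux]; ring
    _ ≤ c ^ 2 * (M.len F ^ 2 * ‖grad v i F.1 (pt F t)‖ ^ 2) :=
        mul_le_mul (sq_le_sq.2 (htrace.trans (le_abs_self _))) (by gcongr) (by positivity)
          (sq_nonneg _)
    _ ≤ c ^ 2 * (C * energy v i F.1) :=
        mul_le_mul_of_nonneg_left (hinv M hσ v i F _ (pt_mem F ht)) (sq_nonneg _)
    _ = c ^ 2 * C * energy v i F.1 := by ring

/-! ### Faces shared by two triangles -/

theorem transfer_eq {i j : Fin G.N} {x y : E2} (h : G.emb i x = G.emb j y) :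
    transfer G i j x = y := by
  rw [transfer, h]
  exact Function.leftInverse_invFun (G.emb j).injective y

theorem transfer_self (i : Fin G.N) (x : E2) : transfer G i i x = x := transfer_eq rfl

theorem emb_pt {i : Fin G.N} (F : M.Loc i) (t : ℝ) : G.emb i (pt F t) =
    AffineMap.lineMap (G.emb i ((M.tri i F.1).fst F.2)) (G.emb i ((M.tri i F.1).snd F.2)) t :=
  (G.emb i).toAffineMap.apply_lineMap _ _ _

theorem exists_transfer_pt_eq {i j : Fin G.N} {F : M.Loc i} {F' : M.Loc j}
    (h : M.edge3 F = M.edge3 F') :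
    ∃ τ : ℝ → ℝ, Continuous τ ∧ MeasurePreserving τ (volume.restrict (Icc 0 1))
      (volume.restrict (Icc 0 1)) ∧ ∀ t, transfer G i j (pt F t) = pt F' (τ t) := by
  rcases Sym2.eq_iff.1 h with ⟨h₁, h₂⟩ | ⟨h₁, h₂⟩
  · refine ⟨id, continuous_id, .id _, fun t => transfer_eq ?_⟩
    rw [emb_pt, emb_pt, h₁, h₂, id]
  · refine ⟨fun t => 1 - t, by fun_prop, measurePreserving_one_sub, fun t => transfer_eq ?_⟩
    rw [emb_pt, emb_pt, h₁, h₂, AffineMap.lineMap_apply_one_sub]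

theorem edge3_eq_iff {i : Fin G.N} {F F' : M.Loc i} :
    M.edge3 F = M.edge3 F' ↔ M.edge F = M.edge F' :=
  (Sym2.map.injective (G.emb i).injective).eq_iff

theorem len_eq_of_edge3_eq {i j : Fin G.N} {F : M.Loc i} {F' : M.Loc j}
    (h : M.edge3 F = M.edge3 F') : M.len F = M.len F' := by
  rw [len, len, Tri.len, Tri.len, ← (G.emb i).dist_map, ← (G.emb j).dist_map]
  rcases Sym2.eq_iff.1 h with ⟨h₁, h₂⟩ | ⟨h₁, h₂⟩ <;> rw [h₁, h₂]
  exact dist_comm _ _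

theorem eq_of_same_side {i : Fin G.N} {F F' : M.Loc i} (h : M.edge F = M.edge F')
    (hs : 0 < (M.tri i F'.1).bary F'.2 ((M.tri i F.1).points F.2)) : F = F' := by
  obtain ⟨K, e⟩ := F
  obtain ⟨K', e'⟩ := F'
  obtain rfl : K = K' := by
    by_contra hne
    exact Tri.not_disjoint_interior h hs (M.disjoint_interior i hne)
  exact Prod.ext rfl ((M.tri i K).edge_injective h)

open Classical in
theorem card_edge3_eq_le (M : Mesh G) (i : Fin G.N) (s : Sym2 E3) :
    (Finset.univ.filter fun F : M.Loc i => M.edge3 F = s).card ≤ 2 := by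
  rcases (Finset.univ.filter fun F : M.Loc i => M.edge3 F = s).eq_empty_or_nonempty
    with hempty | ⟨F₀, h₀⟩
  · simp [hempty]
  have edge_eq {F : M.Loc i}
      (hF : F ∈ (Finset.univ.filter fun F : M.Loc i => M.edge3 F = s : Finset (M.Loc i))) :
      M.edge F = M.edge F₀ :=
    edge3_eq_iff.1 ((Finset.mem_filter.1 hF).2.trans (Finset.mem_filter.1 h₀).2.symm)
  -- A triangle with this edge is determined by the side on which it has the apex of `F₀`.
  refine (Finset.card_le_card_of_injOn (t := (Finset.univ : Finset Bool))
    (fun F => decide (0 < (M.tri i F.1).bary F.2 ((M.tri i F₀.1).points F₀.2)))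
    (fun _ _ => Finset.mem_univ _) fun F hF F' hF' hside => ?_).trans_eq Fintype.card_bool
  have h : M.edge F = M.edge F' := (edge_eq hF).trans (edge_eq hF').symm
  have hF₀ := Tri.bary_apex_ne_zero (edge_eq hF).symm
  have hmul := Tri.bary_eq_mul h ((M.tri i F₀.1).points F₀.2)
  have hiff : 0 < (M.tri i F.1).bary F.2 ((M.tri i F₀.1).points F₀.2) ↔
      0 < (M.tri i F'.1).bary F'.2 ((M.tri i F₀.1).points F₀.2) := decide_eq_decide.1 hside
  refine eq_of_same_side h ?_
  rcases hF₀.lt_or_gt with hneg | hpos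
  · by_contra! hle
    exact Tri.bary_apex_ne_zero (edge_eq hF').symm
      ((not_lt.1 (hiff.not.1 hneg.not_gt)).antisymm
        (hmul ▸ mul_nonneg_of_nonpos_of_nonpos hneg.le hle))
  · exact pos_of_mul_pos_right (hmul ▸ hiff.1 hpos) hpos.le

theorem sum_loc_energy (v : M.V p) (i : Fin G.N) :
    ∑ F : M.Loc i, energy v i F.1 = 3 * surfEnergy v i := by
  rw [Fintype.sum_prod_type, surfEnergy, Finset.mul_sum]
  simp only [Finset.sum_const, Finset.card_univ, Fintype.card_fin, nsmul_eq_mul, Nat.cast_ofNat]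

theorem sum_fst_energy_le {i j : Fin G.N} {S : Finset (M.Loc i × M.Loc j)}
    (hS : ∀ F ∈ S, M.edge3 F.1 = M.edge3 F.2) (v : M.V p) :
    ∑ F ∈ S, energy v i F.1.1 ≤ 6 * surfEnergy v i := by
  classical
  have hcard (F₀ : M.Loc i) : (S.filter fun F => F.1 = F₀).card ≤ 2 := by
    refine (Finset.card_le_card_of_injOn Prod.snd (fun F hF => ?_) fun F hF F' hF' h => ?_).trans
      (M.card_edge3_eq_le j (M.edge3 F₀))
    · obtain ⟨hFS, rfl⟩ := Finset.mem_filter.1 hF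
      exact Finset.mem_filter.2 ⟨Finset.mem_univ _, (hS F hFS).symm⟩
    · exact Prod.ext ((Finset.mem_filter.1 hF).2.trans (Finset.mem_filter.1 hF').2.symm) h
  calc ∑ F ∈ S, energy v i F.1.1
      ≤ (2 : ℕ) * ∑ F : M.Loc i, energy v i F.1 :=
        sum_comp_le_card_mul_sum (f := fun F : M.Loc i => energy v i F.1)
          (fun F => energy_nonneg v i F.1) hcard
    _ = 6 * surfEnergy v i := by rw [sum_loc_energy]; push_cast; ring

theorem sum_snd_energy_le {i j : Fin G.N} {S : Finset (M.Loc i × M.Loc j)}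
    (hS : ∀ F ∈ S, M.edge3 F.1 = M.edge3 F.2) (v : M.V p) :
    ∑ F ∈ S, energy v j F.2.1 ≤ 6 * surfEnergy v j := by
  have h := sum_fst_energy_le (S := S.map (Equiv.prodComm _ _).toEmbedding) (fun F hF => by
    obtain ⟨F', hF', rfl⟩ := Finset.mem_map.1 hF
    exact (hS F' hF').symm) v
  rwa [Finset.sum_map] at h

/-! ### Consistency terms -/

theorem faceInt_sq_nonneg {i : Fin G.N} (F : M.Loc i) (j : E2 → ℝ) :
    0 ≤ M.faceInt F fun x => j x ^ 2 := by
  rw [faceInt_eq]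
  exact mul_nonneg (M.len_pos F).le (integral_nonneg fun _ => sq_nonneg _)

theorem one_div_len_mul_faceInt_sq_nonneg {i : Fin G.N} (F : M.Loc i) (j : E2 → ℝ) :
    0 ≤ 1 / M.len F * M.faceInt F fun x => j x ^ 2 :=
  mul_nonneg (one_div_nonneg.2 (M.len_pos F).le) (faceInt_sq_nonneg F j)

theorem faceInt_mul_sq_le {i : Fin G.N} {F : M.Loc i} {g j : E2 → ℝ} {B : ℝ}
    (hj : Continuous fun t => j (pt F t))
    (hg : ∀ᵐ t ∂(volume.restrict (Icc (0 : ℝ) 1)), M.len F ^ 2 * g (pt F t) ^ 2 ≤ B) :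
    (M.faceInt F fun x => g x * j x) ^ 2 ≤ B * (1 / M.len F * M.faceInt F fun x => j x ^ 2) := by
  have : IsProbabilityMeasure (volume.restrict (Icc (0 : ℝ) 1)) := ⟨by simp⟩
  have hj₂ : MemLp (fun t => j (pt F t)) 2 (volume.restrict (Icc (0 : ℝ) 1)) :=
    (memLp_two_iff_integrable_sq hj.aestronglyMeasurable).2
      ((hj.pow 2).continuousOn.integrableOn_compact isCompact_Icc)
  have h := sq_integral_mul_le (g := fun t => M.len F * g (pt F t)) hj₂
    (by simpa only [mul_pow] using hg)
  simp_rw [mul_assoc] at h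
  rw [integral_const_mul, ← faceInt_eq M F fun x => g x * j x] at h
  rwa [faceInt_eq M F fun x => j x ^ 2, ← mul_assoc (1 / M.len F),
    one_div_mul_cancel (M.len_pos F).ne', one_mul]

theorem sum_faceInt_mul_sq_le {ι : Type*} {S : Finset ι} {i : Fin G.N} {F : ι → M.Loc i}
    {g j : ι → E2 → ℝ} {B : ι → ℝ} (hB : ∀ s ∈ S, 0 ≤ B s)
    (hj : ∀ s ∈ S, Continuous fun t => j s (pt (F s) t))
    (hg : ∀ s ∈ S, ∀ᵐ t ∂(volume.restrict (Icc (0 : ℝ) 1)),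
      M.len (F s) ^ 2 * g s (pt (F s) t) ^ 2 ≤ B s) :
    (∑ s ∈ S, M.faceInt (F s) fun x => g s x * j s x) ^ 2 ≤
      (∑ s ∈ S, B s) * ∑ s ∈ S, 1 / M.len (F s) * M.faceInt (F s) fun x => j s x ^ 2 :=
  Finset.sum_sq_le_sum_mul_sum_of_sq_le_mul _ hB
    (fun s _ => one_div_len_mul_faceInt_sq_nonneg (F s) (j s))
    fun s hs => faceInt_mul_sq_le (hj s hs) (hg s hs)

theorem continuous_jumpInt (v : M.V p) (i : Fin G.N) (F : M.Loc i × M.Loc i) :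
    Continuous (jumpInt v i F) := (continuous_val v i _).sub (continuous_val v i _)

theorem continuous_jumpBif_pt (v : M.V p) {i j : Fin G.N} {F : M.Loc i × M.Loc j}
    (hF : M.edge3 F.1 = M.edge3 F.2) : Continuous fun t => jumpBif v i j F (pt F.1 t) := by
  obtain ⟨τ, hτ, -, h⟩ := exists_transfer_pt_eq hF
  simp_rw [jumpBif, h]
  exact ((continuous_val v i _).comp (continuous_pt _)).sub
    ((continuous_val v j _).comp ((continuous_pt _).comp hτ))

theorem FluxBound.ae_transfer_le {κ : Fin G.N → E2 → ℝ} {C : ℝ} (hC : FluxBound κ M p C)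
    (v : M.V p) {i j : Fin G.N} {F : M.Loc i × M.Loc j} (hF : M.edge3 F.1 = M.edge3 F.2) {n : E2}
    (hn : ‖n‖ ≤ 1) : ∀ᵐ t ∂(volume.restrict (Icc (0 : ℝ) 1)),
      M.len F.1 ^ 2 * flux κ v j F.2.1 n (transfer G i j (pt F.1 t)) ^ 2 ≤
        C * energy v j F.2.1 := by
  obtain ⟨τ, -, hτ, h⟩ := exists_transfer_pt_eq hF
  filter_upwards [hτ.quasiMeasurePreserving.ae (hC v j F.2 n hn)] with t ht
  rw [h, len_eq_of_edge3_eq hF]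
  exact ht

theorem edge3_eq_of_mem_intFaces {i : Fin G.N} {F : M.Loc i × M.Loc i} (hF : F ∈ M.intFaces i) :
    M.edge3 F.1 = M.edge3 F.2 :=
  edge3_eq_iff.2 (Finset.mem_filter.1 hF).2.2

theorem edge3_eq_of_mem_bifFaces {γ : Sym2 E3} {i j : Fin G.N} {F : M.Loc i × M.Loc j}
    (hF : F ∈ M.bifFaces γ i j) : M.edge3 F.1 = M.edge3 F.2 := by
  classical
  simp only [bifFaces, Finset.mem_filter] at hF
  exact hF.2.1

theorem FluxBound.ae_avgInt_le {κ : Fin G.N → E2 → ℝ} {C : ℝ} (hC : FluxBound κ M p C) (v : M.V p)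
    {i : Fin G.N} {F : M.Loc i × M.Loc i} (hF : F ∈ M.intFaces i) :
    ∀ᵐ t ∂(volume.restrict (Icc (0 : ℝ) 1)), M.len F.1 ^ 2 * avgInt κ v i F (pt F.1 t) ^ 2 ≤
      C / 2 * (energy v i F.1.1 + energy v i F.2.1) := by
  have hn : ‖M.normal F.1‖ ≤ 1 := Tri.norm_normal_le _ _
  filter_upwards [hC v i F.1 _ hn, hC.ae_transfer_le v (edge3_eq_of_mem_intFaces hF) hn]
    with t h₁ h₂
  rw [transfer_self] at h₂
  have havg : avgInt κ v i F (pt F.1 t) ^ 2 ≤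
      1 / 2 * (flux κ v i F.1.1 (M.normal F.1) (pt F.1 t) ^ 2
      + flux κ v i F.2.1 (M.normal F.1) (pt F.1 t) ^ 2) := by
    rw [avgInt]
    linarith [sq_nonneg (flux κ v i F.1.1 (M.normal F.1) (pt F.1 t)
      - flux κ v i F.2.1 (M.normal F.1) (pt F.1 t))]
  linarith [mul_le_mul_of_nonneg_left havg (sq_nonneg (M.len F.1))]

theorem FluxBound.ae_avgBif_le {κ : Fin G.N → E2 → ℝ} {C : ℝ} (hC : FluxBound κ M p C) (v : M.V p)
    {i j : Fin G.N} {F : M.Loc i × M.Loc j} (hF : M.edge3 F.1 = M.edge3 F.2) :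
    ∀ᵐ t ∂(volume.restrict (Icc (0 : ℝ) 1)), M.len F.1 ^ 2 * avgBif κ v i j F (pt F.1 t) ^ 2 ≤
      2 * C * (energy v i F.1.1 + energy v j F.2.1) := by
  filter_upwards [hC v i F.1 (M.normal F.1) (Tri.norm_normal_le _ _),
    hC.ae_transfer_le v hF (n := M.normal F.2) (Tri.norm_normal_le _ _)] with t h₁ h₂
  have havg : avgBif κ v i j F (pt F.1 t) ^ 2 ≤ 2 * (flux κ v i F.1.1 (M.normal F.1) (pt F.1 t) ^ 2
      + flux κ v j F.2.1 (M.normal F.2) (transfer G i j (pt F.1 t)) ^ 2) := by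
    rw [avgBif]
    linarith [sq_nonneg (flux κ v i F.1.1 (M.normal F.1) (pt F.1 t)
      + flux κ v j F.2.1 (M.normal F.2) (transfer G i j (pt F.1 t)))]
  linarith [mul_le_mul_of_nonneg_left havg (sq_nonneg (M.len F.1))]

/-- The consistency term of a surface: the fluxes of `w` tested with the jumps of `v`. -/
noncomputable def consSurf (κ : Fin G.N → E2 → ℝ) (i : Fin G.N) (w v : M.V p) : ℝ :=
  (∑ F ∈ M.intFaces i, M.faceInt F.1 fun x => avgInt κ w i F x * jumpInt v i F x)
    + ∑ F ∈ M.bdryFaces i, M.faceInt F fun x => flux κ w i F.1 (M.normal F) x * val v i F.1 x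

/-- The penalty term of a surface. -/
noncomputable def penSurf (ηF : Fin G.N → Sym2 E2 → ℝ) (i : Fin G.N) (v : M.V p) : ℝ :=
  (∑ F ∈ M.intFaces i, ηF i (M.edge F.1) / M.len F.1 *
      M.faceInt F.1 fun x => jumpInt v i F x ^ 2)
    + ∑ F ∈ M.bdryFaces i, ηF i (M.edge F) / M.len F * M.faceInt F fun x => val v i F.1 x ^ 2

/-- The penalty term of a bifurcation, with penalty parameter `1`. -/
noncomputable def penSeg (γ : Sym2 E3) (v : M.V p) : ℝ :=
  ∑ ij ∈ G.D γ, ∑ F ∈ M.bifFaces γ ij.1 ij.2,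
    1 / M.len F.1 * M.faceInt F.1 fun x => jumpBif v ij.1 ij.2 F x ^ 2

/-- The penalty term of the bifurcations. -/
noncomputable def penBif (ηΓ : Sym2 E3 → ℝ) (v : M.V p) : ℝ :=
  ∑ γ ∈ G.bifs, ηΓ γ * penSeg γ v

theorem penSurf_nonneg {ηF : Fin G.N → Sym2 E2 → ℝ} {i : Fin G.N} (h : ∀ F, 0 ≤ ηF i F)
    (v : M.V p) : 0 ≤ penSurf ηF i v :=
  add_nonneg
    (Finset.sum_nonneg fun F _ =>
      mul_nonneg (div_nonneg (h _) (M.len_pos _).le) (faceInt_sq_nonneg F.1 _))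
    (Finset.sum_nonneg fun F _ =>
      mul_nonneg (div_nonneg (h _) (M.len_pos _).le) (faceInt_sq_nonneg F _))

theorem penSeg_nonneg (γ : Sym2 E3) (v : M.V p) : 0 ≤ penSeg γ v :=
  Finset.sum_nonneg fun _ _ => Finset.sum_nonneg fun F _ =>
    one_div_len_mul_faceInt_sq_nonneg F.1 _

theorem penBif_nonneg {ηΓ : Sym2 E3 → ℝ} (h : ∀ γ, 0 ≤ ηΓ γ) (v : M.V p) : 0 ≤ penBif ηΓ v :=
  Finset.sum_nonneg fun γ _ => mul_nonneg (h γ) (penSeg_nonneg γ v)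

theorem mul_penSurf_one_le {ηF : Fin G.N → Sym2 E2 → ℝ} {i : Fin G.N} {η₀ : ℝ}
    (h : ∀ F, η₀ ≤ ηF i F) (v : M.V p) : η₀ * penSurf (fun _ _ => 1) i v ≤ penSurf ηF i v := by
  rw [penSurf, penSurf, mul_add, Finset.mul_sum, Finset.mul_sum]
  refine add_le_add (Finset.sum_le_sum fun F _ => ?_) (Finset.sum_le_sum fun F _ => ?_)
  · rw [← mul_assoc, mul_one_div]
    exact mul_le_mul_of_nonneg_right (div_le_div_of_nonneg_right (h _) (M.len_pos _).le)
      (faceInt_sq_nonneg F.1 _)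
  · rw [← mul_assoc, mul_one_div]
    exact mul_le_mul_of_nonneg_right (div_le_div_of_nonneg_right (h _) (M.len_pos _).le)
      (faceInt_sq_nonneg F _)

theorem mul_penBif_one_le {ηΓ : Sym2 E3 → ℝ} {η₀ : ℝ} (h : ∀ γ, η₀ ≤ ηΓ γ) (v : M.V p) :
    η₀ * penBif (fun _ => 1) v ≤ penBif ηΓ v := by
  simp only [penBif, Finset.mul_sum, one_mul]
  exact Finset.sum_le_sum fun γ _ => mul_le_mul_of_nonneg_right (h γ) (penSeg_nonneg γ v)

theorem sum_avgInt_mul_jumpInt_sq_le {κ : Fin G.N → E2 → ℝ} {C : ℝ} (hC₀ : 0 ≤ C)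
    (hC : FluxBound κ M p C) (v : M.V p) (i : Fin G.N) :
    (∑ F ∈ M.intFaces i, M.faceInt F.1 fun x => avgInt κ v i F x * jumpInt v i F x) ^ 2 ≤
      6 * C * surfEnergy v i * ∑ F ∈ M.intFaces i,
        1 / M.len F.1 * M.faceInt F.1 fun x => jumpInt v i F x ^ 2 := by
  have henergy (F : M.Loc i × M.Loc i) : 0 ≤ C / 2 * (energy v i F.1.1 + energy v i F.2.1) := by
    have := add_nonneg (energy_nonneg v i F.1.1) (energy_nonneg v i F.2.1)
    positivity
  refine (sum_faceInt_mul_sq_le (fun F _ => henergy F)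
    (fun F _ => (continuous_jumpInt v i F).comp (continuous_pt F.1))
    fun F hF => hC.ae_avgInt_le v hF).trans (mul_le_mul_of_nonneg_right ?_
      (Finset.sum_nonneg fun F _ => one_div_len_mul_faceInt_sq_nonneg F.1 _))
  have h₁ := sum_fst_energy_le (S := M.intFaces i) (fun F hF => edge3_eq_of_mem_intFaces hF) v
  have h₂ := sum_snd_energy_le (S := M.intFaces i) (fun F hF => edge3_eq_of_mem_intFaces hF) v
  calc ∑ F ∈ M.intFaces i, C / 2 * (energy v i F.1.1 + energy v i F.2.1)
      = C / 2 * (∑ F ∈ M.intFaces i, energy v i F.1.1 + ∑ F ∈ M.intFaces i, energy v i F.2.1) := by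
        rw [← Finset.mul_sum, Finset.sum_add_distrib]
    _ ≤ C / 2 * (6 * surfEnergy v i + 6 * surfEnergy v i) := by gcongr
    _ = 6 * C * surfEnergy v i := by ring

theorem sum_flux_mul_val_sq_le {κ : Fin G.N → E2 → ℝ} {C : ℝ} (hC₀ : 0 ≤ C)
    (hC : FluxBound κ M p C) (v : M.V p) (i : Fin G.N) :
    (∑ F ∈ M.bdryFaces i,
      M.faceInt F fun x => flux κ v i F.1 (M.normal F) x * val v i F.1 x) ^ 2 ≤
      3 * C * surfEnergy v i * ∑ F ∈ M.bdryFaces i,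
        1 / M.len F * M.faceInt F fun x => val v i F.1 x ^ 2 := by
  refine (sum_faceInt_mul_sq_le (fun F _ => mul_nonneg hC₀ (energy_nonneg v i F.1))
    (fun F _ => (continuous_val v i F.1).comp (continuous_pt F))
    fun F _ => hC v i F _ (Tri.norm_normal_le _ _)).trans (mul_le_mul_of_nonneg_right ?_
      (Finset.sum_nonneg fun F _ => one_div_len_mul_faceInt_sq_nonneg F _))
  calc ∑ F ∈ M.bdryFaces i, C * energy v i F.1
      = C * ∑ F ∈ M.bdryFaces i, energy v i F.1 := (Finset.mul_sum _ _ _).symm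
    _ ≤ C * ∑ F : M.Loc i, energy v i F.1 :=
        mul_le_mul_of_nonneg_left (Finset.sum_le_sum_of_subset_of_nonneg (Finset.subset_univ _)
          fun F _ _ => energy_nonneg v i F.1) hC₀
    _ = 3 * C * surfEnergy v i := by rw [sum_loc_energy]; ring

theorem consSurf_self_sq_le {κ : Fin G.N → E2 → ℝ} {C : ℝ} (hC₀ : 0 ≤ C)
    (hC : FluxBound κ M p C) (v : M.V p) (i : Fin G.N) :
    consSurf κ i v v ^ 2 ≤ 9 * C * (surfEnergy v i * penSurf (fun _ _ => 1) i v) := by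
  have hE := surfEnergy_nonneg v i
  calc consSurf κ i v v ^ 2
      ≤ (6 * C * surfEnergy v i + 3 * C * surfEnergy v i) * penSurf (fun _ _ => 1) i v :=
        sq_add_le_add_mul_add (by positivity) (by positivity)
          (Finset.sum_nonneg fun F _ => one_div_len_mul_faceInt_sq_nonneg F.1 _)
          (Finset.sum_nonneg fun F _ => one_div_len_mul_faceInt_sq_nonneg F _)
          (sum_avgInt_mul_jumpInt_sq_le hC₀ hC v i) (sum_flux_mul_val_sq_le hC₀ hC v i)
    _ = 9 * C * (surfEnergy v i * penSurf (fun _ _ => 1) i v) := by ring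

theorem sum_avgBif_mul_jumpBif_sq_le {κ : Fin G.N → E2 → ℝ} {C : ℝ} (hC₀ : 0 ≤ C)
    (hC : FluxBound κ M p C) (v : M.V p) (γ : Sym2 E3) (i j : Fin G.N) :
    (∑ F ∈ M.bifFaces γ i j, M.faceInt F.1 fun x => avgBif κ v i j F x * jumpBif v i j F x) ^ 2 ≤
      24 * C * (∑ i, surfEnergy v i) * ∑ F ∈ M.bifFaces γ i j,
        1 / M.len F.1 * M.faceInt F.1 fun x => jumpBif v i j F x ^ 2 := by
  have henergy (F : M.Loc i × M.Loc j) : 0 ≤ 2 * C * (energy v i F.1.1 + energy v j F.2.1) := by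
    have := add_nonneg (energy_nonneg v i F.1.1) (energy_nonneg v j F.2.1)
    positivity
  refine (sum_faceInt_mul_sq_le (fun F _ => henergy F)
    (fun F hF => continuous_jumpBif_pt v (edge3_eq_of_mem_bifFaces hF))
    fun F hF => hC.ae_avgBif_le v (edge3_eq_of_mem_bifFaces hF)).trans
      (mul_le_mul_of_nonneg_right ?_
        (Finset.sum_nonneg fun F _ => one_div_len_mul_faceInt_sq_nonneg F.1 _))
  have h₁ := sum_fst_energy_le (S := M.bifFaces γ i j) (fun F hF => edge3_eq_of_mem_bifFaces hF) v
  have h₂ := sum_snd_energy_le (S := M.bifFaces γ i j) (fun F hF => edge3_eq_of_mem_bifFaces hF) v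
  calc ∑ F ∈ M.bifFaces γ i j, 2 * C * (energy v i F.1.1 + energy v j F.2.1)
      = 2 * C * (∑ F ∈ M.bifFaces γ i j, energy v i F.1.1
          + ∑ F ∈ M.bifFaces γ i j, energy v j F.2.1) := by
        rw [← Finset.mul_sum, Finset.sum_add_distrib]
    _ ≤ 2 * C * (6 * ∑ i, surfEnergy v i + 6 * ∑ i, surfEnergy v i) := by
        have := surfEnergy_le_sum v i
        have := surfEnergy_le_sum v j
        refine mul_le_mul_of_nonneg_left ?_ (by positivity)
        linarith
    _ = 24 * C * ∑ i, surfEnergy v i := by ring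

theorem avgJump_self_sq_le {κ : Fin G.N → E2 → ℝ} {C : ℝ} (hC₀ : 0 ≤ C)
    (hC : FluxBound κ M p C) (v : M.V p) (γ : Sym2 E3) :
    avgJump κ v v γ ^ 2 ≤ 24 * G.N ^ 2 * C * (∑ i, surfEnergy v i) * penSeg γ v := by
  have hE : 0 ≤ 24 * C * ∑ i, surfEnergy v i := by
    have := sum_surfEnergy_nonneg v
    positivity
  have hinv : (1 / ((G.I γ).card : ℝ)) ^ 2 ≤ 1 := by
    rw [one_div]
    exact pow_le_one₀ (by positivity) (Nat.cast_inv_le_one _)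
  have hcard : ((G.D γ).card : ℝ) ≤ (G.N : ℝ) ^ 2 := by
    have h := Finset.card_le_univ (G.D γ)
    rw [Fintype.card_prod, Fintype.card_fin, ← sq] at h
    exact_mod_cast h
  calc avgJump κ v v γ ^ 2
      = (1 / ((G.I γ).card : ℝ)) ^ 2 * (∑ ij ∈ G.D γ, ∑ F ∈ M.bifFaces γ ij.1 ij.2, M.faceInt F.1
          fun x => avgBif κ v ij.1 ij.2 F x * jumpBif v ij.1 ij.2 F x) ^ 2 := by
        rw [avgJump, mul_pow]
    _ ≤ (∑ ij ∈ G.D γ, ∑ F ∈ M.bifFaces γ ij.1 ij.2, M.faceInt F.1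
          fun x => avgBif κ v ij.1 ij.2 F x * jumpBif v ij.1 ij.2 F x) ^ 2 :=
        mul_le_of_le_one_left (sq_nonneg _) hinv
    _ ≤ (∑ ij ∈ G.D γ, 24 * C * ∑ i, surfEnergy v i) * penSeg γ v :=
        Finset.sum_sq_le_sum_mul_sum_of_sq_le_mul _ (fun _ _ => hE)
          (fun ij _ => Finset.sum_nonneg fun F _ => one_div_len_mul_faceInt_sq_nonneg F.1 _)
          fun ij _ => sum_avgBif_mul_jumpBif_sq_le hC₀ hC v γ ij.1 ij.2
    _ ≤ G.N ^ 2 * (24 * C * ∑ i, surfEnergy v i) * penSeg γ v := by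
        rw [Finset.sum_const, nsmul_eq_mul]
        exact mul_le_mul_of_nonneg_right (mul_le_mul_of_nonneg_right hcard hE) (penSeg_nonneg γ v)
    _ = _ := by ring

theorem sum_avgJump_self_sq_le {κ : Fin G.N → E2 → ℝ} {C : ℝ} (hC₀ : 0 ≤ C)
    (hC : FluxBound κ M p C) (v : M.V p) :
    (∑ γ ∈ G.bifs, avgJump κ v v γ) ^ 2 ≤
      24 * G.N ^ 2 * G.bifs.card * C * ((∑ i, surfEnergy v i) * penBif (fun _ => 1) v) := by
  have hE : 0 ≤ 24 * G.N ^ 2 * C * ∑ i, surfEnergy v i := by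
    have := sum_surfEnergy_nonneg v
    positivity
  calc (∑ γ ∈ G.bifs, avgJump κ v v γ) ^ 2
      ≤ (∑ γ ∈ G.bifs, 24 * G.N ^ 2 * C * ∑ i, surfEnergy v i) * ∑ γ ∈ G.bifs, penSeg γ v :=
        Finset.sum_sq_le_sum_mul_sum_of_sq_le_mul _ (fun _ _ => hE)
          (fun γ _ => penSeg_nonneg γ v) fun γ _ => avgJump_self_sq_le hC₀ hC v γ
    _ = _ := by
        simp only [Finset.sum_const, nsmul_eq_mul, penBif, one_mul]
        ring

/-! ### Coercivity -/

theorem dgNorm_sq {ηF : Fin G.N → Sym2 E2 → ℝ} {ηΓ : Sym2 E3 → ℝ} (hF : ∀ i F, 0 ≤ ηF i F)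
    (hΓ : ∀ γ, 0 ≤ ηΓ γ) (v : M.V p) :
    dgNorm ηF ηΓ v ^ 2 = ∑ i, surfEnergy v i + (∑ i, penSurf ηF i v + penBif ηΓ v) := by
  have hsum : ∑ i, dgSqSurf ηF i v = ∑ i, surfEnergy v i + ∑ i, penSurf ηF i v := by
    simp only [← Finset.sum_add_distrib, dgSqSurf, penSurf, surfEnergy, energy, add_assoc]
  rw [← add_assoc, ← hsum]
  refine Real.sq_sqrt ?_
  rw [hsum]
  exact add_nonneg (add_nonneg (sum_surfEnergy_nonneg v)
    (Finset.sum_nonneg fun i _ => penSurf_nonneg (hF i) v)) (penBif_nonneg hΓ v)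

theorem aSurf_self (κ : Fin G.N → E2 → ℝ) (ε : Fin G.N → ℝ) (ηF : Fin G.N → Sym2 E2 → ℝ)
    (i : Fin G.N) (v : M.V p) : aSurf κ ε ηF i v v =
      (∑ K, ∫ x in (M.tri i K).carrier, κ i x * inner ℝ (grad v i K x) (grad v i K x))
        - (1 + ε i) * consSurf κ i v v + penSurf ηF i v := by
  simp only [aSurf, consSurf, penSurf, sq]
  ring

theorem a_self (κ : Fin G.N → E2 → ℝ) (ε : Fin G.N → ℝ) (ε₀ : ℝ) (ηF : Fin G.N → Sym2 E2 → ℝ)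
    (ηΓ : Sym2 E3 → ℝ) (v : M.V p) :
    a κ ε ε₀ ηF ηΓ v v =
      ∑ i, ((∑ K, ∫ x in (M.tri i K).carrier, κ i x * inner ℝ (grad v i K x) (grad v i K x))
        - (1 + ε i) * consSurf κ i v v + penSurf ηF i v)
      - (1 + ε₀) * (∑ γ ∈ G.bifs, avgJump κ v v γ) + penBif ηΓ v := by
  simp only [a, aSurf_self, penBif, penSeg, jumpJump, ← sq]
  ring

theorem integrableOn_coeff_mul (M : Mesh G) {κ : Fin G.N → E2 → ℝ} (hκ : G.IsCoefficient κ)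
    (i : Fin G.N) (K : Fin (M.n i)) {f : E2 → ℝ} (hf : Continuous f) :
    IntegrableOn (fun x => κ i x * f x) (M.tri i K).carrier := by
  obtain ⟨b, c, -, -, hc⟩ := hκ.exists_bounds
  exact Integrable.bdd_mul (Tri.integrableOn_carrier _ hf) (hκ.1 i).aestronglyMeasurable
    (M.ae_carrier_of_ae_dom K (hc i))

theorem mul_energy_le {κ : Fin G.N → E2 → ℝ} (hκ : G.IsCoefficient κ) {b : ℝ}
    (hb : ∀ i, ∀ᵐ x ∂(volume.restrict (G.dom i)), b ≤ κ i x)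
    (v : M.V p) (i : Fin G.N) (K : Fin (M.n i)) : b * energy v i K ≤
      ∫ x in (M.tri i K).carrier, κ i x * inner ℝ (grad v i K x) (grad v i K x) := by
  rw [energy, ← integral_const_mul]
  have hg := continuous_grad v i K
  refine integral_mono_ae (Tri.integrableOn_carrier _ ((hg.norm.pow 2).const_mul b))
    (M.integrableOn_coeff_mul hκ i K (hg.inner hg)) ?_
  filter_upwards [M.ae_carrier_of_ae_dom K (hb i)] with x hx
  rw [real_inner_self_eq_norm_sq]
  exact mul_le_mul_of_nonneg_right hx (sq_nonneg _)

theorem exists_coercive {κ : Fin G.N → E2 → ℝ} (hκ : G.IsCoefficient κ) (p : ℕ) (σ e : ℝ) :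
    ∃ η₀ > 0, ∃ C > 0, ∀ M : Mesh G, M.ShapeRegular σ → M.HasTraces κ →
      ∀ ε ε₀ ηF ηΓ, AdmissibleParams e η₀ ε ε₀ ηF ηΓ →
        ∀ v : M.V p, dgNorm ηF ηΓ v ^ 2 ≤ C * a κ ε ε₀ ηF ηΓ v v := by
  obtain ⟨b, c, hb₀, hb, hc⟩ := hκ.exists_bounds
  obtain ⟨B, hB, hflux⟩ := exists_fluxBound hc p σ
  have hR₁ : 0 ≤ 9 * B := by positivity
  have hR₂ : 0 ≤ 24 * G.N ^ 2 * G.bifs.card * B := by positivity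
  set R := 9 * B + 24 * G.N ^ 2 * G.bifs.card * B
  obtain ⟨η₀, hη₀, hbη⟩ := exists_pos_le_mul hb₀ (4 * (1 + e) ^ 2 * R)
  refine ⟨η₀, hη₀, 2 / b + 4 / 3, by positivity, fun M hM hT ε ε₀ ηF ηΓ hparams v => ?_⟩
  have hF i F := (hparams.pos hη₀ i F).le
  have hΓ γ := (hparams.bif_pos hη₀ γ).le
  have hE i := surfEnergy_nonneg v i
  have hP i := penSurf_nonneg (M := M) (ηF := fun _ _ => 1) (i := i) (fun _ => zero_le_one) v
  have hPΓ := penBif_nonneg (M := M) (ηΓ := fun _ => 1) (fun _ => zero_le_one) v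
  have hcons i : consSurf κ i v v ^ 2 ≤ R * (surfEnergy v i * penSurf (fun _ _ => 1) i v) :=
    (consSurf_self_sq_le hB (hflux M hM hT) v i).trans
      (mul_le_mul_of_nonneg_right (le_add_of_nonneg_right hR₂) (mul_nonneg (hE i) (hP i)))
  have hbif : (∑ γ ∈ G.bifs, avgJump κ v v γ) ^ 2 ≤
      R * ((∑ i, surfEnergy v i) * penBif (fun _ => 1) v) :=
    (sum_avgJump_self_sq_le hB (hflux M hM hT) v).trans
      (mul_le_mul_of_nonneg_right (le_add_of_nonneg_left hR₁)
        (mul_nonneg (sum_surfEnergy_nonneg v) hPΓ))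
  rw [dgNorm_sq hF hΓ, a_self]
  refine energy_add_penalty_le hb₀ hbη hE hP (fun i => penSurf_nonneg (hF i) v) hPΓ
    (penBif_nonneg hΓ v) (fun i => ?_) hcons hbif hparams.abs_le hparams.abs_le₀
    (fun i hi => mul_penSurf_one_le (hparams.le_of_ne i hi) v)
    (mul_penBif_one_le hparams.le_bif v)
  rw [surfEnergy, Finset.mul_sum]
  exact Finset.sum_le_sum fun K _ => mul_energy_le hκ hb v i K

/-! ### Bilinearity -/

theorem isLinearMap_flux (κ : Fin G.N → E2 → ℝ) (i : Fin G.N) (K : Fin (M.n i)) (n x : E2) :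
    IsLinearMap ℝ fun v : M.V p => flux κ v i K n x :=
  isLinearMap_const_mul (isLinearMap_inner_grad i K x n) _

theorem isLinearMap_jumpInt (i : Fin G.N) (F : M.Loc i × M.Loc i) (x : E2) :
    IsLinearMap ℝ fun v : M.V p => jumpInt v i F x :=
  isLinearMap_sub (isLinearMap_val _ _ _) (isLinearMap_val _ _ _)

theorem isLinearMap_avgInt (κ : Fin G.N → E2 → ℝ) (i : Fin G.N) (F : M.Loc i × M.Loc i) (x : E2) :
    IsLinearMap ℝ fun v : M.V p => avgInt κ v i F x :=
  isLinearMap_add (isLinearMap_const_mul (isLinearMap_flux _ _ _ _ _) _)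
    (isLinearMap_const_mul (isLinearMap_flux _ _ _ _ _) _)

theorem isLinearMap_jumpBif (i j : Fin G.N) (F : M.Loc i × M.Loc j) (x : E2) :
    IsLinearMap ℝ fun v : M.V p => jumpBif v i j F x :=
  isLinearMap_sub (isLinearMap_val _ _ _) (isLinearMap_val _ _ _)

theorem isLinearMap_avgBif (κ : Fin G.N → E2 → ℝ) (i j : Fin G.N) (F : M.Loc i × M.Loc j)
    (x : E2) : IsLinearMap ℝ fun v : M.V p => avgBif κ v i j F x :=
  isLinearMap_sub (isLinearMap_flux _ _ _ _ _) (isLinearMap_flux _ _ _ _ _)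

theorem integrableOn_flux {κ : Fin G.N → E2 → ℝ} (hκ : G.IsCoefficient κ) (hT : M.HasTraces κ)
    (v : M.V p) {i : Fin G.N} (F : M.Loc i) (n : E2) :
    IntegrableOn (fun t => flux κ v i F.1 n (pt F t)) (Icc (0 : ℝ) 1) := by
  obtain ⟨b, c, -, -, hc⟩ := hκ.exists_bounds
  have hgrad : Continuous fun t => inner ℝ (grad v i F.1 (pt F t)) n :=
    ((continuous_grad v i F.1).comp (continuous_pt F)).inner continuous_const
  exact Integrable.bdd_mul (hgrad.continuousOn.integrableOn_compact isCompact_Icc)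
    (aemeasurable_kTrace hκ.1 hT F).aestronglyMeasurable (ae_abs_kTrace_le hT hc F)

theorem integrableOn_flux_transfer {κ : Fin G.N → E2 → ℝ} (hκ : G.IsCoefficient κ)
    (hT : M.HasTraces κ) (v : M.V p) {i j : Fin G.N} {F : M.Loc i × M.Loc j}
    (hF : M.edge3 F.1 = M.edge3 F.2) (n : E2) :
    IntegrableOn (fun t => flux κ v j F.2.1 n (transfer G i j (pt F.1 t))) (Icc (0 : ℝ) 1) := by
  obtain ⟨τ, -, hτ, h⟩ := exists_transfer_pt_eq hF
  simp_rw [h]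
  exact hτ.integrable_comp_of_integrable (integrableOn_flux hκ hT v F.2 n)

theorem integrableOn_avgInt {κ : Fin G.N → E2 → ℝ} (hκ : G.IsCoefficient κ) (hT : M.HasTraces κ)
    (v : M.V p) {i : Fin G.N} {F : M.Loc i × M.Loc i} (hF : F ∈ M.intFaces i) :
    IntegrableOn (fun t => avgInt κ v i F (pt F.1 t)) (Icc (0 : ℝ) 1) := by
  have h := integrableOn_flux_transfer hκ hT v (edge3_eq_of_mem_intFaces hF) (M.normal F.1)
  simp_rw [transfer_self] at h
  exact ((integrableOn_flux hκ hT v F.1 _).const_mul _).add (h.const_mul _)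

theorem integrableOn_avgBif {κ : Fin G.N → E2 → ℝ} (hκ : G.IsCoefficient κ) (hT : M.HasTraces κ)
    (v : M.V p) {i j : Fin G.N} {F : M.Loc i × M.Loc j} (hF : M.edge3 F.1 = M.edge3 F.2) :
    IntegrableOn (fun t => avgBif κ v i j F (pt F.1 t)) (Icc (0 : ℝ) 1) :=
  (integrableOn_flux hκ hT v F.1 _).sub (integrableOn_flux_transfer hκ hT v hF _)

theorem isBilin_faceInt {V : Type*} [AddCommGroup V] [Module ℝ V] {i : Fin G.N} (F : M.Loc i)
    {g j : V → E2 → ℝ} (hg : ∀ x, IsLinearMap ℝ fun v => g v x)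
    (hj : ∀ x, IsLinearMap ℝ fun v => j v x)
    (hgi : ∀ v, IntegrableOn (fun t => g v (pt F t)) (Icc (0 : ℝ) 1))
    (hjc : ∀ v, Continuous fun t => j v (pt F t)) :
    IsBilin fun w v => M.faceInt F fun x => g w x * j v x := by
  simp_rw [faceInt_eq]
  exact (IsBilin.integral (fun t => .mul (hg _) (hj _)) fun w v =>
    (hgi w).mul_continuousOn (hjc v).continuousOn isCompact_Icc).const_mul _

theorem isBilin_faceInt_of_continuous {V : Type*} [AddCommGroup V] [Module ℝ V] {i : Fin G.N}
    (F : M.Loc i) {j : V → E2 → ℝ} (hj : ∀ x, IsLinearMap ℝ fun v => j v x)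
    (hjc : ∀ v, Continuous fun t => j v (pt F t)) :
    IsBilin fun w v => M.faceInt F fun x => j w x * j v x :=
  isBilin_faceInt F hj hj (fun v => (hjc v).continuousOn.integrableOn_compact isCompact_Icc) hjc

theorem isBilin_integral_inner_grad {κ : Fin G.N → E2 → ℝ} (hκ : G.IsCoefficient κ) (i : Fin G.N)
    (K : Fin (M.n i)) : IsBilin fun w v : M.V p =>
      ∫ x in (M.tri i K).carrier, κ i x * inner ℝ (grad w i K x) (grad v i K x) :=
  .integral (f := fun x w v => κ i x * inner ℝ (grad w i K x) (grad v i K x))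
    (fun x => (isBilin_inner_grad i K x).const_mul _) fun w v =>
    M.integrableOn_coeff_mul hκ i K ((continuous_grad w i K).inner (continuous_grad v i K))

theorem isBilin_aSurf {κ : Fin G.N → E2 → ℝ} (hκ : G.IsCoefficient κ) (hT : M.HasTraces κ)
    (ε : Fin G.N → ℝ) (ηF : Fin G.N → Sym2 E2 → ℝ) (i : Fin G.N) :
    IsBilin (aSurf (M := M) (p := p) κ ε ηF i) := by
  have hjump (F : M.Loc i × M.Loc i) (v : M.V p) : Continuous fun t => jumpInt v i F (pt F.1 t) :=
    (continuous_jumpInt v i F).comp (continuous_pt F.1)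
  have hval (F : M.Loc i) (v : M.V p) : Continuous fun t => val v i F.1 (pt F t) :=
    (continuous_val v i _).comp (continuous_pt F)
  have hint : IsBilin fun w v : M.V p =>
      ∑ F ∈ M.intFaces i, M.faceInt F.1 fun x => avgInt κ w i F x * jumpInt v i F x :=
    .sum _ fun F hF => isBilin_faceInt F.1 (isLinearMap_avgInt κ i F) (isLinearMap_jumpInt i F)
      (fun v => integrableOn_avgInt hκ hT v hF) (hjump F)
  have hbdry : IsBilin fun w v : M.V p => ∑ F ∈ M.bdryFaces i,
      M.faceInt F fun x => flux κ w i F.1 (M.normal F) x * val v i F.1 x :=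
    .sum _ fun F _ => isBilin_faceInt F (isLinearMap_flux κ i F.1 _) (isLinearMap_val i F.1)
      (fun v => integrableOn_flux hκ hT v F _) (hval F)
  have hpenInt : IsBilin fun w v : M.V p => ∑ F ∈ M.intFaces i, ηF i (M.edge F.1) / M.len F.1 *
      M.faceInt F.1 fun x => jumpInt w i F x * jumpInt v i F x :=
    .sum _ fun F _ =>
      (isBilin_faceInt_of_continuous F.1 (isLinearMap_jumpInt i F) (hjump F)).const_mul _
  have hpenBdry : IsBilin fun w v : M.V p => ∑ F ∈ M.bdryFaces i, ηF i (M.edge F) / M.len F *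
      M.faceInt F fun x => val w i F.1 x * val v i F.1 x :=
    .sum _ fun F _ => (isBilin_faceInt_of_continuous (j := fun v x => val v i F.1 x) F
      (fun x => isLinearMap_val i F.1 x) (hval F)).const_mul _
  exact (((((IsBilin.sum _ fun K _ => isBilin_integral_inner_grad hκ i K).sub hint).sub
    (hint.swap.const_mul _)).add hpenInt).sub hbdry).sub (hbdry.swap.const_mul _) |>.add hpenBdry

theorem isBilin_faceInt_avgBif {κ : Fin G.N → E2 → ℝ} (hκ : G.IsCoefficient κ)
    (hT : M.HasTraces κ) {i j : Fin G.N} {F : M.Loc i × M.Loc j} (hF : M.edge3 F.1 = M.edge3 F.2) :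
    IsBilin fun w v : M.V p => M.faceInt F.1 fun x => avgBif κ w i j F x * jumpBif v i j F x :=
  isBilin_faceInt F.1 (isLinearMap_avgBif κ i j F) (isLinearMap_jumpBif i j F)
    (fun v => integrableOn_avgBif hκ hT v hF) fun v => continuous_jumpBif_pt v hF

theorem isBilin_faceInt_jumpBif {i j : Fin G.N} {F : M.Loc i × M.Loc j}
    (hF : M.edge3 F.1 = M.edge3 F.2) :
    IsBilin fun w v : M.V p => M.faceInt F.1 fun x => jumpBif w i j F x * jumpBif v i j F x :=
  isBilin_faceInt_of_continuous F.1 (isLinearMap_jumpBif i j F) fun v =>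
    continuous_jumpBif_pt v hF

theorem isBilin_avgJump {κ : Fin G.N → E2 → ℝ} (hκ : G.IsCoefficient κ) (hT : M.HasTraces κ)
    (γ : Sym2 E3) : IsBilin fun w v : M.V p => avgJump κ w v γ := by
  have h : IsBilin fun w v : M.V p => ∑ ij ∈ G.D γ, ∑ F ∈ M.bifFaces γ ij.1 ij.2,
      M.faceInt F.1 fun x => avgBif κ w ij.1 ij.2 F x * jumpBif v ij.1 ij.2 F x :=
    .sum _ fun ij _ => .sum _ fun F hF =>
      isBilin_faceInt_avgBif hκ hT (edge3_eq_of_mem_bifFaces hF)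
  exact h.const_mul _

theorem isBilin_jumpJump (γ : Sym2 E3) : IsBilin fun w v : M.V p => jumpJump w v γ :=
  IsBilin.sum _ fun _ _ => IsBilin.sum _ fun _ hF =>
    (isBilin_faceInt_jumpBif (edge3_eq_of_mem_bifFaces hF)).const_mul _

theorem isBilin_a {κ : Fin G.N → E2 → ℝ} (hκ : G.IsCoefficient κ) (hT : M.HasTraces κ)
    (ε : Fin G.N → ℝ) (ε₀ : ℝ) (ηF : Fin G.N → Sym2 E2 → ℝ) (ηΓ : Sym2 E3 → ℝ) :
    IsBilin (a (M := M) (p := p) κ ε ε₀ ηF ηΓ) := by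
  have hcons : IsBilin fun w v : M.V p => ∑ γ ∈ G.bifs, avgJump κ w v γ :=
    .sum _ fun γ _ => isBilin_avgJump hκ hT γ
  have hpen : IsBilin fun w v : M.V p => ∑ γ ∈ G.bifs, ηΓ γ * jumpJump w v γ :=
    .sum _ fun γ _ => (isBilin_jumpJump γ).const_mul _
  exact ((IsBilin.sum _ fun i _ => isBilin_aSurf hκ hT ε ηF i).sub hcons).sub
    (hcons.swap.const_mul _) |>.add hpen

theorem isLinearMap_load {f : Fin G.N → E2 → ℝ} (hf : ∀ i, IntegrableOn (f i) (G.dom i)) :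
    IsLinearMap ℝ fun v : M.V p => load f v := by
  refine isLinearMap_sum _ fun i _ => isLinearMap_sum _ fun K _ =>
    isLinearMap_integral (fun x => isLinearMap_const_mul (isLinearMap_val i K x) _) fun v => ?_
  have hfK : IntegrableOn (f i) (M.tri i K).carrier := by
    rw [IntegrableOn, Tri.restrict_carrier]
    exact (hf i).mono_set (M.interior_carrier_subset i K)
  exact hfK.mul_continuousOn (continuous_val v i K).continuousOn (Tri.isCompact_carrier _)

/-! ### Adjacent triangles and boundary edges -/

theorem one_lt_rank_E2 : 1 < Module.rank ℝ E2 := by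
  rw [← Module.finrank_eq_rank, finrank_euclideanSpace_fin]
  norm_num

theorem exists_common_edge {i : Fin G.N} {K K' : Fin (M.n i)} (hne : K ≠ K') {x : E2}
    (hx : x ∈ (M.tri i K).carrier) (hx' : x ∈ (M.tri i K').carrier)
    (hv : x ∉ range (M.tri i K).points) :
    ∃ e e', M.edge (K, e) = M.edge (K', e') ∧ (M.tri i K).bary e x = 0 := by
  refine Tri.exists_common_edge (fun h => ?_) ((M.conforming i hne).subset ⟨hx, hx'⟩) hv
  obtain ⟨z, hz⟩ := (M.tri i K).interior_nonempty
  exact disjoint_left.1 (M.disjoint_interior i hne) hz (interior_mono h hz)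

/-- The set of vertices of the triangulation of a surface. -/
def vertices (M : Mesh G) (i : Fin G.N) : Set E2 := ⋃ K, range (M.tri i K).points

theorem range_points_subset_vertices (M : Mesh G) (i : Fin G.N) (K : Fin (M.n i)) :
    range (M.tri i K).points ⊆ M.vertices i :=
  subset_iUnion (fun K => range (M.tri i K).points) K

theorem countable_vertices (M : Mesh G) (i : Fin G.N) : (M.vertices i).Countable :=
  countable_iUnion fun _ => countable_range _

theorem isClosed_biUnion_carrier (M : Mesh G) (i : Fin G.N) (S : Set (Fin (M.n i))) :
    IsClosed (⋃ K ∈ S, (M.tri i K).carrier) :=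
  S.toFinite.isClosed_biUnion fun K _ => (M.tri i K).isCompact_carrier.isClosed

/-- Since the vertices do not disconnect the surface, two complementary families of triangles meet
in a point that is not a vertex, and then two of these triangles share an edge. -/
theorem eq_of_eq_on_adjacent {i : Fin G.N} {α : Type*} {k : Fin (M.n i) → α}
    (hk : ∀ F F' : M.Loc i, F.1 ≠ F'.1 → M.edge F = M.edge F' → k F.1 = k F'.1)
    (K₀ K₁ : Fin (M.n i)) : k K₀ = k K₁ := by
  by_contra hne
  have hmeet (S : Set (Fin (M.n i))) {K : Fin (M.n i)} (hK : K ∈ S) :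
      ((G.dom i \ M.vertices i) ∩ ⋃ K ∈ S, (M.tri i K).carrier).Nonempty := by
    obtain ⟨x, hx, hxv⟩ := ((M.countable_vertices i).dense_compl ℝ).inter_open_nonempty _
      isOpen_interior (M.tri i K).interior_nonempty
    exact ⟨x, ⟨M.interior_carrier_subset i K hx, hxv⟩, mem_biUnion hK (interior_subset hx)⟩
  have hcover : G.dom i \ M.vertices i ⊆ (⋃ K ∈ {K | k K = k K₀}, (M.tri i K).carrier) ∪
      ⋃ K ∈ {K | k K = k K₀}ᶜ, (M.tri i K).carrier := by
    rw [← biUnion_union, union_compl_self, biUnion_univ, M.cover i]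
    exact sdiff_subset.trans subset_closure
  obtain ⟨x, ⟨-, hxv⟩, hx, hx'⟩ := isPreconnected_closed_iff.1
    (isPreconnected_diff_countable one_lt_rank_E2 (G.polygonal i).1
      (G.polygonal i).2.1.isPreconnected (M.countable_vertices i)) _ _
    (M.isClosed_biUnion_carrier i _) (M.isClosed_biUnion_carrier i _) hcover
    (hmeet {K | k K = k K₀} rfl) (hmeet _ (Ne.symm hne))
  obtain ⟨K, hK, hxK⟩ := mem_iUnion₂.1 hx
  obtain ⟨K', hK', hxK'⟩ := mem_iUnion₂.1 hx'
  have hKK' : K ≠ K' := fun h => hK' (h ▸ hK)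
  obtain ⟨e, e', h, -⟩ :=
    exists_common_edge hKK' hxK hxK' fun h => hxv (M.range_points_subset_vertices i K h)
  exact hK' ((hk (K, e) (K', e') hKK' h).symm.trans hK)

theorem exists_edge_eq_of_pt_mem {i : Fin G.N} {F : M.Loc i} {t : ℝ} (ht : t ∈ Ioo (0 : ℝ) 1)
    {K : Fin (M.n i)} (hK : K ≠ F.1) (h : pt F t ∈ (M.tri i K).carrier) :
    ∃ e, M.edge F = M.edge (K, e) := by
  obtain ⟨e, e', hedge, he⟩ := exists_common_edge hK.symm (pt_mem F (Ioo_subset_Icc_self ht)) h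
    (Tri.edgePt_notMem_range_points ht)
  obtain rfl := Tri.eq_of_bary_edgePt_eq_zero ht he
  exact ⟨e', hedge⟩

theorem pt_mem_dom_of_edge_eq {i : Fin G.N} {F F' : M.Loc i} (h : M.edge F = M.edge F')
    (hne : F ≠ F') {t : ℝ} (ht : t ∈ Ioo (0 : ℝ) 1) : pt F t ∈ G.dom i := by
  rw [← (G.polygonal i).2.2.1]
  rcases (Tri.bary_apex_ne_zero h).lt_or_gt with hs | hs
  · exact mem_interior_iff_mem_nhds.2 (mem_of_superset (Tri.union_mem_nhds h hs ht)
      (union_subset (M.carrier_subset i _) (M.carrier_subset i _)))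
  · exact absurd (eq_of_same_side h hs) hne

theorem pt_notMem_dom {i : Fin G.N} {F : M.Loc i} (hF : ∀ F', M.edge F = M.edge F' → F = F')
    {t : ℝ} (ht : t ∈ Ioo (0 : ℝ) 1) : pt F t ∉ G.dom i := by
  intro hdom
  have hother : pt F t ∉ ⋃ K ∈ ({F.1}ᶜ : Set (Fin (M.n i))), (M.tri i K).carrier := fun h => by
    obtain ⟨K, hK, hmem⟩ := mem_iUnion₂.1 h
    obtain ⟨e, he⟩ := exists_edge_eq_of_pt_mem ht hK hmem
    exact hK (congrArg Prod.fst (hF _ he)).symm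
  have hnhds : (M.tri i F.1).carrier ∈ 𝓝 (pt F t) := by
    filter_upwards [(G.polygonal i).1.mem_nhds hdom,
      (M.isClosed_biUnion_carrier i _).isOpen_compl.mem_nhds hother] with y hy hy'
    obtain ⟨K, hK⟩ := mem_iUnion.1 (M.cover i ▸ subset_closure hy)
    obtain rfl : K = F.1 := by_contra fun hne => hy' (mem_biUnion hne hK)
    exact hK
  have hpos := Tri.interior_carrier_eq _ ▸ mem_interior_iff_mem_nhds.2 hnhds
  exact (hpos F.2).ne' (Tri.bary_edgePt_self _ _ _)

theorem seg_edge_subset_frontier {i : Fin G.N} {F : M.Loc i}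
    (hF : ∀ F', M.edge F = M.edge F' → F = F') : seg (M.edge F) ⊆ frontier (G.dom i) := by
  have hopen : Ioo 0 1 ⊆ pt F ⁻¹' frontier (G.dom i) := fun t ht => by
    rw [mem_preimage, (G.polygonal i).1.frontier_eq]
    exact ⟨M.carrier_subset i _ (pt_mem F (Ioo_subset_Icc_self ht)), pt_notMem_dom hF ht⟩
  have hclosed : Icc 0 1 ⊆ pt F ⁻¹' frontier (G.dom i) := by
    rw [← closure_Ioo zero_ne_one]
    exact closure_minimal hopen (isClosed_frontier.preimage (continuous_pt F))
  exact (Tri.seg_edge _ _).trans_subset (image_subset_iff.2 hclosed)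

theorem exists_edge_subset_frontier_of_notMem_vertices (M : Mesh G) {i : Fin G.N} {y : E2}
    (hy : y ∈ frontier (G.dom i)) (hv : y ∉ M.vertices i) :
    ∃ F : M.Loc i, seg (M.edge F) ⊆ frontier (G.dom i) ∧ y ∈ seg (M.edge F) := by
  rw [(G.polygonal i).1.frontier_eq, ← M.cover i] at hy
  obtain ⟨K, hK⟩ := mem_iUnion.1 hy.1
  obtain ⟨e, he⟩ : ∃ e, (M.tri i K).bary e y = 0 := by
    by_contra! h
    refine hy.2 (M.interior_carrier_subset i K ?_)
    rw [Tri.carrier_eq] at hK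
    rw [Tri.interior_carrier_eq]
    exact fun e => (hK e).lt_of_ne' (h e)
  have hseg := Tri.mem_seg_edge _ hK he
  refine ⟨(K, e), seg_edge_subset_frontier fun F' h => by_contra fun hne => ?_, hseg⟩
  rw [Tri.seg_edge] at hseg
  obtain ⟨t, ht, rfl⟩ := hseg
  have ht₀ : t ≠ 0 := by
    rintro rfl
    exact hv (M.range_points_subset_vertices i K ⟨e + 1, (AffineMap.lineMap_apply_zero _ _).symm⟩)
  have ht₁ : t ≠ 1 := by
    rintro rfl
    exact hv (M.range_points_subset_vertices i K ⟨e + 2, (AffineMap.lineMap_apply_one _ _).symm⟩)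
  exact hy.2 (pt_mem_dom_of_edge_eq h hne ⟨ht.1.lt_of_ne' ht₀, ht.2.lt_of_ne ht₁⟩)

theorem exists_edge_subset_frontier (M : Mesh G) {i : Fin G.N} {y : E2}
    (hy : y ∈ frontier (G.dom i)) :
    ∃ F : M.Loc i, seg (M.edge F) ⊆ frontier (G.dom i) ∧ y ∈ seg (M.edge F) := by
  have hclosed : IsClosed (⋃ F ∈ {F : M.Loc i | seg (M.edge F) ⊆ frontier (G.dom i)},
      seg (M.edge F)) := (toFinite _).isClosed_biUnion fun F _ => by
    rw [edge, Tri.seg_edge]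
    exact (isCompact_Icc.image (Tri.continuous_edgePt _ _)).isClosed
  have hsub : frontier (G.dom i) ⊆
      ⋃ F ∈ {F : M.Loc i | seg (M.edge F) ⊆ frontier (G.dom i)}, seg (M.edge F) :=
    (frontier_subset_closure_frontier_diff_countable one_lt_rank_E2 (G.polygonal i).1
      (G.polygonal i).2.2.1 (M.countable_vertices i)).trans <|
      closure_minimal (fun z hz => by
        obtain ⟨F, hF, hzF⟩ := M.exists_edge_subset_frontier_of_notMem_vertices hz.1 hz.2
        exact mem_biUnion hF hzF) hclosed
  obtain ⟨F, hF, hyF⟩ := mem_iUnion₂.1 (hsub hy)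
  exact ⟨F, hF, hyF⟩

theorem bdryFaces_nonempty (M : Mesh G) {i : Fin G.N}
    (h : ((G.emb i '' frontier (G.dom i)) \ G.bifSet).Nonempty) : (M.bdryFaces i).Nonempty := by
  obtain ⟨_, ⟨y, hy, rfl⟩, hbif⟩ := h
  obtain ⟨F, hF, hyF⟩ := M.exists_edge_subset_frontier hy
  have hyF3 : G.emb i y ∈ seg (M.edge3 F) :=
    (seg_map (G.emb i).toAffineMap (M.edge F)).symm ▸ mem_image_of_mem _ hyF
  refine ⟨F, ?_⟩
  classical
  simp only [bdryFaces, Finset.mem_filter, Finset.mem_univ, true_and]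
  exact ⟨hF, fun γ hγ hsub => hbif (mem_biUnion hγ (hsub hyF3))⟩

theorem bifFaces_nonempty (M : Mesh G) {γ : Sym2 E3} (hγ : γ ∈ G.bifs) {i j : Fin G.N}
    (hi : i ∈ G.I γ) (hj : j ∈ G.I γ) : (M.bifFaces γ i j).Nonempty := by
  obtain ⟨y, hy⟩ : (seg γ).Nonempty := by
    induction γ using Sym2.ind with
    | _ γ₁ γ₂ => exact ⟨γ₁, subset_convexHull ℝ _ (Sym2.mem_mk_left γ₁ γ₂)⟩
  obtain ⟨K, e, hsub, -⟩ := M.bif_partition γ hγ i hi y hy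
  obtain ⟨K', e', hedge⟩ := M.bif_match γ hγ i hi j hj K e hsub
  refine ⟨((K, e), (K', e')), ?_⟩
  classical
  simp only [bifFaces, Finset.mem_filter, Finset.mem_univ, true_and]
  exact ⟨hedge.symm, hsub⟩

/-! ### Definiteness -/

theorem exists_val_eq_of_energy_eq_zero {v : M.V p} {i : Fin G.N} {K : Fin (M.n i)}
    (h : energy v i K = 0) : ∃ k, ∀ x, val v i K x = k := by
  have hg := (continuous_grad v i K).norm.pow 2
  have hzero := eqOn_zero_of_setIntegral_eq_zero isOpen_interior interior_subset hg.continuousOn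
    (fun x => sq_nonneg _) (Tri.integrableOn_carrier _ hg) h
  have hpderiv (l : Fin 2) : MvPolynomial.pderiv l (v i K : MvPolynomial (Fin 2) ℝ) = 0 :=
    eq_zero_of_polyVal_eq_zero isOpen_interior (M.tri i K).interior_nonempty fun x hx => by
      have hgrad : grad v i K x = 0 := norm_eq_zero.1 ((pow_eq_zero_iff two_ne_zero).1 (hzero hx))
      rw [← grad_apply, hgrad, PiLp.zero_apply]
  exact ⟨_, fun x => by rw [val, eq_C_of_pderiv_eq_zero hpderiv, MvPolynomial.eval_C]⟩

theorem faceInt_const (M : Mesh G) {i : Fin G.N} (F : M.Loc i) (c : ℝ) :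
    M.faceInt F (fun _ => c) = M.len F * c := by
  simp only [faceInt, Tri.edgeInt, len, intervalIntegral.integral_const, sub_zero, one_smul]

theorem div_len_mul_faceInt_const (M : Mesh G) {i : Fin G.N} (F : M.Loc i) (η c : ℝ) :
    η / M.len F * M.faceInt F (fun _ => c) = η * c := by
  rw [faceInt_const, ← mul_assoc, div_mul_cancel₀ _ (M.len_pos F).ne']

theorem eq_of_penSurf_eq_zero {ηF : Fin G.N → Sym2 E2 → ℝ} {i : Fin G.N} (hF : ∀ F, 0 < ηF i F)
    {v : M.V p} {k : Fin (M.n i) → ℝ} (hk : ∀ K x, val v i K x = k K) (h : penSurf ηF i v = 0) :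
    (∀ F ∈ M.intFaces i, k F.1.1 = k F.2.1) ∧ ∀ F ∈ M.bdryFaces i, k F.1 = 0 := by
  simp only [penSurf, jumpInt, hk, div_len_mul_faceInt_const] at h
  rw [add_eq_zero_iff_of_nonneg
    (Finset.sum_nonneg fun F _ => mul_nonneg (hF _).le (sq_nonneg _))
    (Finset.sum_nonneg fun F _ => mul_nonneg (hF _).le (sq_nonneg _))] at h
  exact ⟨fun F hFi => sub_eq_zero.1 (eq_zero_of_sum_mul_sq_eq_zero (fun F _ => hF _) h.1 hFi),
    fun F => eq_zero_of_sum_mul_sq_eq_zero (x := fun F : M.Loc i => k F.1) (fun F _ => hF _) h.2⟩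

theorem exists_forall_val_eq {ηF : Fin G.N → Sym2 E2 → ℝ} {i : Fin G.N} (hF : ∀ F, 0 < ηF i F)
    {v : M.V p} (hE : ∀ K, energy v i K = 0) (hP : penSurf ηF i v = 0) :
    ∃ k, (∀ K x, val v i K x = k) ∧ ((M.bdryFaces i).Nonempty → k = 0) := by
  choose k hk using fun K => exists_val_eq_of_energy_eq_zero (hE K)
  obtain ⟨hint, hbdry⟩ := eq_of_penSurf_eq_zero hF hk hP
  have hadj (F F' : M.Loc i) (hne : F.1 ≠ F'.1) (h : M.edge F = M.edge F') : k F.1 = k F'.1 := by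
    rcases hne.lt_or_gt with hlt | hlt
    · exact hint (F, F') (Finset.mem_filter.2 ⟨Finset.mem_univ _, hlt, h⟩)
    · exact (hint (F', F) (Finset.mem_filter.2 ⟨Finset.mem_univ _, hlt, h.symm⟩)).symm
  obtain ⟨x, hx⟩ := (G.polygonal i).2.1.nonempty
  obtain ⟨K₀, -⟩ := mem_iUnion.1 ((M.cover i).superset (subset_closure hx))
  refine ⟨k K₀, fun K x => (hk K x).trans (eq_of_eq_on_adjacent hadj K K₀), ?_⟩
  rintro ⟨F, hFi⟩
  rw [eq_of_eq_on_adjacent hadj K₀ F.1, hbdry F hFi]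

theorem eq_of_penBif_eq_zero {ηΓ : Sym2 E3 → ℝ} (hΓ : ∀ γ, 0 < ηΓ γ) {v : M.V p}
    {k : Fin G.N → ℝ} (hk : ∀ i K x, val v i K x = k i) (h : penBif ηΓ v = 0) {γ : Sym2 E3}
    (hγ : γ ∈ G.bifs) {i j : Fin G.N} (hi : i ∈ G.I γ) (hj : j ∈ G.I γ) (hij : i < j) :
    k i = k j := by
  have hγ₀ := (Finset.sum_eq_zero_iff_of_nonneg fun γ _ =>
    mul_nonneg (hΓ γ).le (penSeg_nonneg γ v)).1 h γ hγ
  have hseg := (mul_eq_zero.1 hγ₀).resolve_left (hΓ γ).ne'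
  simp only [penSeg, jumpBif, hk, div_len_mul_faceInt_const] at hseg
  have hsum := (Finset.sum_eq_zero_iff_of_nonneg fun ij _ =>
    Finset.sum_nonneg fun F _ => mul_nonneg zero_le_one (sq_nonneg _)).1 hseg (i, j)
      (Finset.mem_filter.2 ⟨Finset.mk_mem_product hi hj, hij⟩)
  obtain ⟨F, hF⟩ := M.bifFaces_nonempty hγ hi hj
  exact sub_eq_zero.1 (eq_zero_of_sum_mul_sq_eq_zero (fun F _ => one_pos) hsum hF)

theorem eq_zero_of_dgNorm_eq_zero (hG : G.ReachesBoundary) {ηF : Fin G.N → Sym2 E2 → ℝ}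
    {ηΓ : Sym2 E3 → ℝ} (hF : ∀ i F, 0 < ηF i F) (hΓ : ∀ γ, 0 < ηΓ γ) {v : M.V p}
    (hv : dgNorm ηF ηΓ v = 0) : v = 0 := by
  have hP i := penSurf_nonneg (M := M) (fun F => (hF i F).le) v
  have hPsum : 0 ≤ ∑ i, penSurf ηF i v := Finset.sum_nonneg fun i _ => hP i
  have hPΓ := penBif_nonneg (M := M) (fun γ => (hΓ γ).le) v
  have hsq : dgNorm ηF ηΓ v ^ 2 = 0 := by rw [hv, zero_pow two_ne_zero]
  rw [dgNorm_sq (fun i F => (hF i F).le) (fun γ => (hΓ γ).le), add_eq_zero_iff_of_nonneg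
    (sum_surfEnergy_nonneg v) (add_nonneg hPsum hPΓ), add_eq_zero_iff_of_nonneg hPsum hPΓ] at hsq
  obtain ⟨hE₀, hP₀, hΓ₀⟩ := hsq
  have henergy (i : Fin G.N) (K : Fin (M.n i)) : energy v i K = 0 := by
    have hi := le_antisymm (hE₀ ▸ surfEnergy_le_sum v i) (surfEnergy_nonneg v i)
    exact (Finset.sum_eq_zero_iff_of_nonneg fun K _ => energy_nonneg v i K).1 hi K
      (Finset.mem_univ K)
  choose k hk hbdry using fun i => exists_forall_val_eq (hF i) (henergy i)
    ((Finset.sum_eq_zero_iff_of_nonneg fun i _ => hP i).1 hP₀ i (Finset.mem_univ i))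
  have hlink (i j : Fin G.N) : G.Linked i j → k i = k j := by
    rintro ⟨γ, hγ, hi, hj⟩
    rcases lt_trichotomy i j with hij | rfl | hij
    exacts [eq_of_penBif_eq_zero hΓ hk hΓ₀ hγ hi hj hij, rfl,
      (eq_of_penBif_eq_zero hΓ hk hΓ₀ hγ hj hi hij).symm]
  have hk₀ := eq_zero_of_reaches hG hlink fun j hj => hbdry j (M.bdryFaces_nonempty hj)
  funext i K
  refine Subtype.ext (eq_zero_of_polyVal_eq_zero isOpen_univ univ_nonempty fun x _ => ?_)
  exact (hk i K x).trans (hk₀ i)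

theorem existsUnique_of_coercive {κ : Fin G.N → E2 → ℝ} (hκ : G.IsCoefficient κ)
    (hT : M.HasTraces κ) (hG : G.ReachesBoundary) {ε : Fin G.N → ℝ} {ε₀ : ℝ}
    {ηF : Fin G.N → Sym2 E2 → ℝ} {ηΓ : Sym2 E3 → ℝ} (hF : ∀ i F, 0 < ηF i F)
    (hΓ : ∀ γ, 0 < ηΓ γ) {C : ℝ}
    (hcoer : ∀ v : M.V p, dgNorm ηF ηΓ v ^ 2 ≤ C * a κ ε ε₀ ηF ηΓ v v) {f : Fin G.N → E2 → ℝ}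
    (hf : ∀ i, IntegrableOn (f i) (G.dom i)) :
    ∃! u : M.V p, ∀ v : M.V p, a κ ε ε₀ ηF ηΓ u v = load f v := by
  refine (isBilin_a hκ hT ε ε₀ ηF ηΓ).existsUnique_of_definite (fun u hu => ?_)
    (isLinearMap_load hf)
  refine eq_zero_of_dgNorm_eq_zero hG hF hΓ (sq_nonpos_iff _ |>.1 ?_)
  simpa [hu] using hcoer u

end PlaneDG.Mesh

theorem PlaneDG.IsPolygonalDomain.isCompact_closure {Ω : Set E2} (h : IsPolygonalDomain Ω) :
    IsCompact (closure Ω) := by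
  obtain ⟨-, -, -, S, hS, hΩ⟩ := h
  rw [hΩ]
  exact hS.isCompact_biUnion fun T _ => T.isCompact_carrier

theorem mainTheorem5_general :
    (∀ (G : EdgeDG.Network) (κ : Fin G.N → ℝ → ℝ), G.IsCoefficient κ →
      ∀ (p : ℕ) (σ e : ℝ), ∃ η₀ > 0, ∃ C > 0,
        ∀ M : EdgeDG.Mesh G, M.ShapeRegular σ → M.HasTraces κ →
        ∀ (ε : Fin G.N → ℝ) (ε₀ : ℝ) (ηF : Fin G.N → ℝ → ℝ) (ηΓ : Fin G.numVert → ℝ),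
          AdmissibleParams e η₀ ε ε₀ ηF ηΓ →
          (∀ v : M.V p,
            EdgeDG.Mesh.dgNorm ηF ηΓ v ^ 2 ≤ C * EdgeDG.Mesh.a κ ε ε₀ ηF ηΓ v v) ∧
          (G.ReachesBoundary → ∀ f : Fin G.N → ℝ → ℝ,
            (∀ i, IntegrableOn (f i) (Ioo (G.left i) (G.right i))) →
            ∃! u : M.V p, ∀ v : M.V p,
              EdgeDG.Mesh.a κ ε ε₀ ηF ηΓ u v = EdgeDG.Mesh.load f v)) ∧
    (∀ (G : PlaneDG.Network) (κ : Fin G.N → PlaneDG.E2 → ℝ), G.IsCoefficient κ →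
      ∀ (p : ℕ) (σ e : ℝ), ∃ η₀ > 0, ∃ C > 0,
        ∀ M : PlaneDG.Mesh G, M.ShapeRegular σ → M.HasTraces κ →
        ∀ (ε : Fin G.N → ℝ) (ε₀ : ℝ) (ηF : Fin G.N → Sym2 PlaneDG.E2 → ℝ)
          (ηΓ : Sym2 PlaneDG.E3 → ℝ), AdmissibleParams e η₀ ε ε₀ ηF ηΓ →
          (∀ v : M.V p,
            PlaneDG.Mesh.dgNorm ηF ηΓ v ^ 2 ≤ C * PlaneDG.Mesh.a κ ε ε₀ ηF ηΓ v v) ∧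
          (G.ReachesBoundary → ∀ f : Fin G.N → PlaneDG.E2 → ℝ,
            (∀ i, IntegrableOn (f i) (G.dom i)) →
            ∃! u : M.V p, ∀ v : M.V p,
              PlaneDG.Mesh.a κ ε ε₀ ηF ηΓ u v = PlaneDG.Mesh.load f v)) := by
  refine ⟨fun G κ hκ p σ e => ?_, fun G κ hκ p σ e => ?_⟩
  · obtain ⟨η₀, hη₀, C, hC, hcoer⟩ := EdgeDG.Mesh.exists_coercive hκ p σ e
    refine ⟨η₀, hη₀, C, hC, fun M hM hT ε ε₀ ηF ηΓ h => ⟨hcoer M hM hT ε ε₀ ηF ηΓ h, ?_⟩⟩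
    exact fun hG f => EdgeDG.Mesh.existsUnique_of_coercive hκ hG (h.pos hη₀) (h.bif_pos hη₀)
      (hcoer M hM hT ε ε₀ ηF ηΓ h)
  · obtain ⟨η₀, hη₀, C, hC, hcoer⟩ := PlaneDG.Mesh.exists_coercive hκ p σ e
    refine ⟨η₀, hη₀, C, hC, fun M hM hT ε ε₀ ηF ηΓ h => ⟨hcoer M hM hT ε ε₀ ηF ηΓ h, ?_⟩⟩
    exact fun hG f => PlaneDG.Mesh.existsUnique_of_coercive hκ hT hG (h.pos hη₀) (h.bif_pos hη₀)
      (hcoer M hM hT ε ε₀ ηF ηΓ h)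

theorem mainTheorem5 :
    (∀ (G : EdgeDG.Network) (κ : Fin G.N → ℝ → ℝ), G.IsCoefficient κ →
      ∀ (p : ℕ) (σ : ℝ), ∃ η₀ > 0, ∃ C > 0,
        ∀ M : EdgeDG.Mesh G, M.ShapeRegular σ → M.HasTraces κ →
        ∀ (ε : Fin G.N → ℝ) (ε₀ : ℝ) (ηF : Fin G.N → ℝ → ℝ) (ηΓ : Fin G.numVert → ℝ),
          (∀ i, ε i ∈ ({-1, 0, 1} : Set ℝ)) → ε₀ ∈ ({-1, 0, 1} : Set ℝ) →
          (∀ i, ε i = -1 → ∀ F, 0 < ηF i F) →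
          (∀ i, ε i = 0 ∨ ε i = 1 → ∀ F, η₀ ≤ ηF i F) →
          (∀ γ, η₀ ≤ ηΓ γ) →
          (∀ v : M.V p,
            EdgeDG.Mesh.dgNorm ηF ηΓ v ^ 2 ≤ C * EdgeDG.Mesh.a κ ε ε₀ ηF ηΓ v v) ∧
          (G.ReachesBoundary → ∀ f : Fin G.N → ℝ → ℝ,
            (∀ i, MeasureTheory.MemLp (f i) 2
              (MeasureTheory.volume.restrict (Set.Ioo (G.left i) (G.right i)))) →
            ∃! u : M.V p, ∀ v : M.V p,
              EdgeDG.Mesh.a κ ε ε₀ ηF ηΓ u v = EdgeDG.Mesh.load f v)) ∧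
    (∀ (G : PlaneDG.Network) (κ : Fin G.N → PlaneDG.E2 → ℝ), G.IsCoefficient κ →
      ∀ (p : ℕ) (σ : ℝ), ∃ η₀ > 0, ∃ C > 0,
        ∀ M : PlaneDG.Mesh G, M.ShapeRegular σ → M.HasTraces κ →
        ∀ (ε : Fin G.N → ℝ) (ε₀ : ℝ) (ηF : Fin G.N → Sym2 PlaneDG.E2 → ℝ)
          (ηΓ : Sym2 PlaneDG.E3 → ℝ),
          (∀ i, ε i ∈ ({-1, 0, 1} : Set ℝ)) → ε₀ ∈ ({-1, 0, 1} : Set ℝ) →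
          (∀ i, ε i = -1 → ∀ F, 0 < ηF i F) →
          (∀ i, ε i = 0 ∨ ε i = 1 → ∀ F, η₀ ≤ ηF i F) →
          (∀ γ, η₀ ≤ ηΓ γ) →
          (∀ v : M.V p,
            PlaneDG.Mesh.dgNorm ηF ηΓ v ^ 2 ≤ C * PlaneDG.Mesh.a κ ε ε₀ ηF ηΓ v v) ∧
          (G.ReachesBoundary → ∀ f : Fin G.N → PlaneDG.E2 → ℝ,
            (∀ i, MeasureTheory.MemLp (f i) 2
              (MeasureTheory.volume.restrict (G.dom i))) →
            ∃! u : M.V p, ∀ v : M.V p,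
              PlaneDG.Mesh.a κ ε ε₀ ηF ηΓ u v = PlaneDG.Mesh.load f v)) := by
  refine ⟨fun G κ hκ p σ => ?_, fun G κ hκ p σ => ?_⟩
  · obtain ⟨η₀, hη₀, C, hC, h⟩ := mainTheorem5_general.1 G κ hκ p σ 1
    refine ⟨η₀, hη₀, C, hC, fun M hM hT ε ε₀ ηF ηΓ hε hε₀ hpos hle hΓ => ?_⟩
    obtain ⟨hcoer, hwell⟩ := h M hM hT ε ε₀ ηF ηΓ (.of_mem hε hε₀ hpos hle hΓ)
    exact ⟨hcoer, fun hG f hf => hwell hG f fun i => (hf i).integrable one_le_two⟩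
  · obtain ⟨η₀, hη₀, C, hC, h⟩ := mainTheorem5_general.2 G κ hκ p σ 1
    refine ⟨η₀, hη₀, C, hC, fun M hM hT ε ε₀ ηF ηΓ hε hε₀ hpos hle hΓ => ?_⟩
    obtain ⟨hcoer, hwell⟩ := h M hM hT ε ε₀ ηF ηΓ (.of_mem hε hε₀ hpos hle hΓ)
    have (i : Fin G.N) : IsFiniteMeasure (volume.restrict (G.dom i)) :=
      isFiniteMeasure_restrict.2 ((measure_mono subset_closure).trans_lt
        (G.polygonal i).isCompact_closure.measure_lt_top).ne
    exact ⟨hcoer, fun hG f hf => hwell hG f fun i => (hf i).integrable one_le_two⟩
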